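/- **Setting.** Let $M$ be an episodic Markov decision process with finite state space $\mathcal S$, finite action space $\mathcal A$ ($S=|\mathcal S|$, $A=|\mathcal A|$), horizon $H\ge 1$, initial distribution $d_1$, time-dependent transition probabilities $P_t(s'\mid s,a)$, and random rewards $r_t\in[0,1]$ whose conditional law depends on $(s_t,a_t,s_{t+1})$ (a reward depending only on $(s_t,a_t)$ is a special case); $r_t(s,a)=\mathbb E[r_t\mid s_t=s,a_t=a]$. For a non-stationary, possibly randomized policy $\pi$ let $d^\pi_t(s)$, $d^\pi_t(s,a)$ be the state and state-action marginals at step $t$, and $v^\pi=\sum_{t=1}^H\sum_{s,a}d^\pi_t(s,a)r_t(s,a)$ its value; let $\pi^\star$ maximize $v^\pi$. The data consist of $n\ge1$ independent episodes $(s_1^{(i)},a_1^{(i)},r_1^{(i)},\dots,s_H^{(i)},a_H^{(i)},r_H^{(i)},s_{H+1}^{(i)})$ of $M$ collected with a logging policy $\mu$. Assume that $d^\mu_t(s,a)>0$ for every step $t$, every action $a$ and every state $s$ with $d^\pi_t(s)>0$ for some policy $\pi$, and put $d_m=\min\{d^\mu_t(s,a): 1\le t\le H,\ d^\mu_t(s,a)>0\}$.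 The empirical model $\widehat M$ has as initial distribution the empirical distribution of $s_1^{(i)}$, as transition weights $\widehat P_t(s'\mid s,a)$ the empirical frequencies of $s'$ among the episodes with $(s_t,a_t)=(s,a)$, and as rewards $\widehat r_t(s,a)$ the empirical mean rewards over these episodes, with $\widehat P_t(\cdot\mid s,a)=0$ and $\widehat r_t(s,a)=0$ if there is no such episode. Let $\widehat v^\pi$ and $\widehat V^\pi_t(s)$ be the value and the value functions of $\pi$ in $\widehat M$, and let $\widehat\pi^\star$ be an empirically optimal policy, i.e. $\widehat V^{\widehat\pi^\star}_t(s)=\max_\pi\widehat V^\pi_t(s)$ for all $t$ and $s$ (hence $\widehat v^{\widehat\pi^\star}=\max_\pi\widehat v^\pi$). **Theorem.** There is a universal constant $c>0$ such that the following holds in every such setting, for every $\delta\in(0,1)$ and every $\epsilon_{\mathrm{opt}}$. Let $\widehat\pi$ be any data-dependent policy with $\widehat v^{\widehat\pi^\star}-\widehat v^{\widehat\pi}\le\epsilon_{\mathrm{opt}}$ almost surely. Then with probability at least $1-\delta$ all of the following hold. 1. $\displaystyle v^{\pi^\star}-v^{\widehat\pi}\le c\sqrt{\frac{H^4S\log(HSA/\delta)}{d_m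 n}}+\epsilon_{\mathrm{opt}}.$ 2. If $\delta<e^{-S}$, then $\displaystyle v^{\pi^\star}-v^{\widehat\pi}\le c\sqrt{\frac{H^4\log(HSA/\delta)}{d_m n}}+\epsilon_{\mathrm{opt}}$; and if in addition $\widehat\pi$ is deterministic, then $\displaystyle v^{\pi^\star}-v^{\widehat\pi}\le c\sqrt{\frac{H^3\min\{H,S\}\log(HSA/\delta)}{d_m n}}+\epsilon_{\mathrm{opt}}.$ 3. If $\epsilon_{\mathrm{opt}}\le\sqrt H/S$ and $\|\widehat V^{\widehat\pi}_t-\widehat V^{\widehat\pi^\star}_t\|_\infty\le\epsilon_{\mathrm{opt}}$ for all $t=1,\dots,H$, then $\displaystyle v^{\pi^\star}-v^{\widehat\pi}\le c\sqrt{\frac{H^3\log(HSA/\delta)}{d_m n}}+\epsilon_{\mathrm{opt}}.$ -/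

import Mathlib

open MeasureTheory ProbabilityTheory

/-! Tabular, time-inhomogeneous, finite-horizon Markov decision processes.
The steps of an episode of horizon `H` are numbered `0, …, H - 1`.
Models and policies are indexed by `ℕ`; entries at times `t ≥ H` are never used. -/

/-- A (non-stationary, possibly randomized) policy: at every step and state a probability
vector over the actions. -/
abbrev Policy (𝒮 𝒜 : Type*) [Fintype 𝒜] : Type _ := ℕ → 𝒮 → stdSimplex ℝ 𝒜

/-- A policy is deterministic on an episode of horizon `H` if at every step and state it puts
all its mass on one action. -/
def Policy.IsDeterministic {𝒮 𝒜 : Type*} [Fintype 𝒜] (H : ℕ) (π : Policy 𝒮 𝒜) : Prop :=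
  ∀ t < H, ∀ s, ∃ a, (π t s).1 a = 1

/-- The numerical data of a tabular model: initial weights, transition weights and mean rewards.
The weights are not required to be stochastic, because the empirical transition weights of a
state-action pair that was never visited are zero. -/
structure TabularModel (𝒮 𝒜 : Type*) where
  init : 𝒮 → ℝ
  trans : ℕ → 𝒮 → 𝒜 → 𝒮 → ℝ
  reward : ℕ → 𝒮 → 𝒜 → ℝ

namespace TabularModel

variable {𝒮 𝒜 : Type*} [Fintype 𝒮] [Fintype 𝒜]

/-- The marginal state distribution `d^π_t(s)`. -/
noncomputable def stateDist (M : TabularModel 𝒮 𝒜) (π : Policy 𝒮 𝒜) : ℕ → 𝒮 → ℝ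
  | 0 => M.init
  | t + 1 => fun s' => ∑ s, ∑ a, stateDist M π t s * (π t s).1 a * M.trans t s a s'

/-- The marginal state-action distribution `d^π_t(s, a)`. -/
noncomputable def occupancy (M : TabularModel 𝒮 𝒜) (π : Policy 𝒮 𝒜) (t : ℕ) (s : 𝒮) (a : 𝒜) : ℝ :=
  M.stateDist π t s * (π t s).1 a

/-- The value `v^π = ∑_t ∑_{s, a} d^π_t(s, a) r_t(s, a)` of a policy over `H` steps. -/
noncomputable def value (M : TabularModel 𝒮 𝒜) (H : ℕ) (π : Policy 𝒮 𝒜) : ℝ :=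
  ∑ t ∈ Finset.range H, ∑ s, ∑ a, M.occupancy π t s a * M.reward t s a

/-- Expected total reward of `π` over `k` steps, starting in state `s` at step `t`. -/
noncomputable def valueToGo (M : TabularModel 𝒮 𝒜) (π : Policy 𝒮 𝒜) : ℕ → ℕ → 𝒮 → ℝ
  | 0, _, _ => 0
  | k + 1, t, s =>
      ∑ a, (π t s).1 a * (M.reward t s a + ∑ s', M.trans t s a s' * valueToGo M π k (t + 1) s')

/-- The value function `V^π_t(s)` of a policy in a problem of horizon `H`. -/
noncomputable def valueFunction (M : TabularModel 𝒮 𝒜) (H : ℕ) (π : Policy 𝒮 𝒜) (t : ℕ) (s : 𝒮) :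
    ℝ :=
  M.valueToGo π (H - t) t s

/-- `π` maximizes the value `v^π`. -/
def IsOptimal (M : TabularModel 𝒮 𝒜) (H : ℕ) (π : Policy 𝒮 𝒜) : Prop :=
  ∀ π' : Policy 𝒮 𝒜, M.value H π' ≤ M.value H π

/-- `π` is optimal from every state at every step, as a policy computed by dynamic programming
(Bellman's optimality equation) is. -/
def IsBellmanOptimal (M : TabularModel 𝒮 𝒜) (H : ℕ) (π : Policy 𝒮 𝒜) : Prop :=
  ∀ π' : Policy 𝒮 𝒜, ∀ t < H, ∀ s, M.valueFunction H π' t s ≤ M.valueFunction H π t s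

/-- The logging policy `μ` takes every action with positive probability in every accessible
state, that is, in every state that some policy reaches with positive probability. -/
def IsExploratory (M : TabularModel 𝒮 𝒜) (H : ℕ) (μ : Policy 𝒮 𝒜) : Prop :=
  ∀ t < H, ∀ s, (∃ π : Policy 𝒮 𝒜, 0 < M.stateDist π t s) → ∀ a, 0 < M.occupancy μ t s a

/-- `d_m`, the smallest positive value of the occupancy `d^μ_t(s, a)` (the infimum is over a
finite set). -/
noncomputable def minOccupancy (M : TabularModel 𝒮 𝒜) (H : ℕ) (μ : Policy 𝒮 𝒜) : ℝ :=
  sInf {x : ℝ | 0 < x ∧ ∃ t < H, ∃ s a, M.occupancy μ t s a = x}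

end TabularModel

/-- A Markov decision process with random rewards in `[0, 1]`. `rewardLaw t s a s'` is the law of
the reward at step `t` given state `s`, action `a` and next state `s'`. -/
structure MDP (𝒮 𝒜 : Type*) [Fintype 𝒮] where
  init : stdSimplex ℝ 𝒮
  trans : ℕ → 𝒮 → 𝒜 → stdSimplex ℝ 𝒮
  rewardLaw : ℕ → 𝒮 → 𝒜 → 𝒮 → ProbabilityMeasure ℝ
  reward_mem : ∀ t s a s', ∀ᵐ x ∂(rewardLaw t s a s' : Measure ℝ), x ∈ Set.Icc (0 : ℝ) 1

/-- An episode: states `s_0, …, s_H`, actions `a_0, …, a_{H-1}`, rewards `r_0, …, r_{H-1}`. -/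
abbrev Trajectory (𝒮 𝒜 : Type*) (H : ℕ) : Type _ :=
  ((Fin (H + 1) → 𝒮) × (Fin H → 𝒜)) × (Fin H → ℝ)

namespace Trajectory

variable {𝒮 𝒜 : Type*} {H : ℕ}

/-- The states of an episode. -/
def state (τ : Trajectory 𝒮 𝒜 H) : Fin (H + 1) → 𝒮 := τ.1.1

/-- The actions of an episode. -/
def action (τ : Trajectory 𝒮 𝒜 H) : Fin H → 𝒜 := τ.1.2

/-- The rewards of an episode. -/
def reward (τ : Trajectory 𝒮 𝒜 H) : Fin H → ℝ := τ.2

end Trajectory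

namespace MDP

variable {𝒮 𝒜 : Type*} [Fintype 𝒮] [Fintype 𝒜]

/-- The numerical data of an MDP; the mean reward is `r_t(s, a) = 𝔼[r_t | s_t = s, a_t = a]`. -/
noncomputable def toModel (M : MDP 𝒮 𝒜) : TabularModel 𝒮 𝒜 where
  init := M.init.1
  trans t s a := (M.trans t s a).1
  reward t s a := ∑ s', (M.trans t s a).1 s' * ∫ x, x ∂(M.rewardLaw t s a s' : Measure ℝ)

/-- The law of an episode of horizon `H` under the policy `μ`: `s_0` is drawn from the initial
distribution, `a_t` from `μ_t(· | s_t)`, `s_{t+1}` from `P_t(· | s_t, a_t)`, and `r_t` from the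
reward law of `(s_t, a_t, s_{t+1})`. -/
noncomputable def trajectoryLaw [MeasurableSpace 𝒮] [MeasurableSpace 𝒜]
    (M : MDP 𝒮 𝒜) (μ : Policy 𝒮 𝒜) (H : ℕ) : Measure (Trajectory 𝒮 𝒜 H) :=
  ∑ σ : Fin (H + 1) → 𝒮, ∑ α : Fin H → 𝒜,
    ENNReal.ofReal (M.init.1 (σ 0) *
        ∏ t : Fin H, (μ t (σ t.castSucc)).1 (α t) *
          (M.trans t (σ t.castSucc) (α t)).1 (σ t.succ)) •
      (Measure.dirac (σ, α)).prod
        (Measure.pi fun t : Fin H =>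
          (M.rewardLaw t (σ t.castSucc) (α t) (σ t.succ) : Measure ℝ))

end MDP

section Empirical

variable {𝒮 𝒜 : Type*} {H n : ℕ}

open Classical in
/-- The episodes of the data set that visit the pair `(s, a)` at step `t`. -/
noncomputable def visits (D : Fin n → Trajectory 𝒮 𝒜 H) (t : Fin H) (s : 𝒮) (a : 𝒜) :
    Finset (Fin n) :=
  {i | (D i).state t.castSucc = s ∧ (D i).action t = a}

open Classical in
/-- The empirical (plug-in) model: empirical frequencies of initial states and transitions, and
empirical mean rewards. Since `x / 0 = 0`, transition weights and reward are `0` at a pair that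
was never visited. -/
noncomputable def empiricalModel (D : Fin n → Trajectory 𝒮 𝒜 H) : TabularModel 𝒮 𝒜 where
  init s := ({i | (D i).state 0 = s} : Finset (Fin n)).card / (n : ℝ)
  trans t s a s' :=
    if h : t < H then
      ({i ∈ visits D ⟨t, h⟩ s a | (D i).state (Fin.succ ⟨t, h⟩) = s'}).card /
        ((visits D ⟨t, h⟩ s a).card : ℝ)
    else 0
  reward t s a :=
    if h : t < H then
      (∑ i ∈ visits D ⟨t, h⟩ s a, (D i).reward ⟨t, h⟩) / ((visits D ⟨t, h⟩ s a).card : ℝ)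
    else 0

end Empirical

/-!
Write `m` for the true model, `N` for the empirical one, `d` for the marginals under the logging
policy, `P̂`, `P` for the transition weights of `N` and `m`, and `ε ^ 2` for `log (H S A / δ)`
divided by `n d_m`, up to a constant. Since the empirically optimal policy beats `π⋆` in `N`, the
suboptimality of `π̂` is at most `εopt` plus the errors of the empirical values of `π⋆` and of `π̂`.

*From rows to values* (`MDP.abs_value_sub_value_le`). The error of the value of a policy is the sum
along the *true* model of the row errors `(P̂ - P) V̂`, with `V̂` the value function in `N`. If such an
error is at most `a √(Var_P V̂) + b`, the sum of the errors is governed by the sum of the one-step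
variances of `V̂` along the true model. That sum is `O(H ^ 2)` by the law of total variance,
up to a multiple of the row errors themselves which is absorbed when `a √H ≤ 1`; this gives
`O(a H ^ (3 / 2) + H b)` in place of `O(a H ^ 2 + H b)`.

*Backward conditional independence* (`MDP.map_inRow_future`, `MDP.backward_bernstein`). The function
`V̂` at step `t + 1` depends on the same data as `P̂` at step `t`, but, for the optimal policy of `N`
and for the fixed policy `π⋆`, only through the parts of the episodes after step `t`. By the Markov
property, given these parts the events that the episodes were at `(s, a)` at step `t` are independent
with probabilities `d_t(s, a) P(s' | s, a) / d_{t+1}(s')`, where `s'` is the state at step `t + 1`. A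
Bernstein inequality for independent indicators therefore controls `(P̂ - P) V̂` by `ε √(Var_P V̂)`, as if
`V̂` were a fixed function, with no factor `S`
(`MDP.GoodData.abs_sum_trans_sub_le_of_backwardBound`). This bounds the error for `π⋆`, and also for
`π̂` if its empirical value functions are close to the optimal ones: the difference costs at most
`εopt` times the `ℓ¹` error of a row, which is of order `ε √S`.

For an arbitrary data-dependent `π̂`, Bernstein's inequality for every entry of `P̂` and
Cauchy–Schwarz give the row bound with `a` of order `ε √S`; if `δ < exp (-S)`, a union bound over all
sets of next states bounds the `ℓ¹` error of a row by a multiple of `ε` instead. The better of the two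
resulting bounds is the one with the factor `min H S`. When `ε` is too large for the row bounds to be
useful, the claims follow from `v ≤ H` (`le_sqrt_of_regime`).
-/

set_option linter.unusedSectionVars false

/-! ### Bernstein's inequality on a finite product of probability spaces -/

section Bernstein

variable {α : Type*} [MeasurableSpace α]

lemma Real.exp_le_one_add_add_sq {y : ℝ} (hy : |y| ≤ 1) : Real.exp y ≤ 1 + y + y ^ 2 := by
  have h := (abs_le.1 (Real.abs_exp_sub_one_sub_id_le hy)).2
  linarith

lemma integrable_of_ae_abs_le {μ : Measure α} [IsFiniteMeasure μ] {f : α → ℝ}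
    (hf : Measurable f) {b : ℝ} (hb : ∀ᵐ a ∂μ, |f a| ≤ b) : Integrable f μ :=
  Integrable.of_bound hf.aestronglyMeasurable b (by simpa [Real.norm_eq_abs] using hb)

lemma integrable_exp_mul_of_ae_abs_le {μ : Measure α} [IsFiniteMeasure μ] {f : α → ℝ}
    (hf : Measurable f) {b : ℝ} (hb : ∀ᵐ a ∂μ, |f a| ≤ b) (l : ℝ) :
    Integrable (fun a => Real.exp (l * f a)) μ := by
  refine integrable_of_ae_abs_le (by fun_prop) (b := Real.exp (|l| * b)) ?_
  filter_upwards [hb] with a ha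
  rw [abs_of_pos (Real.exp_pos _), Real.exp_le_exp]
  calc l * f a ≤ |l * f a| := le_abs_self _
    _ = |l| * |f a| := abs_mul _ _
    _ ≤ |l| * b := by gcongr

/-- The moment generating function of a bounded centred variable, below the inverse of the
bound. -/
lemma integral_exp_mul_le {μ : Measure α} [IsProbabilityMeasure μ] {f : α → ℝ}
    (hf : Measurable f) {b v l : ℝ} (hb : ∀ᵐ a ∂μ, |f a| ≤ b) (hmean : ∫ a, f a ∂μ = 0)
    (hv : ∫ a, f a ^ 2 ∂μ ≤ v) (hl : 0 ≤ l) (hlb : l * b ≤ 1) :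
    ∫ a, Real.exp (l * f a) ∂μ ≤ Real.exp (l ^ 2 * v) := by
  have hint := integrable_of_ae_abs_le hf hb
  have hint2 : Integrable (fun a => f a ^ 2) μ := by
    refine integrable_of_ae_abs_le (by fun_prop) (b := b ^ 2) ?_
    filter_upwards [hb] with a ha
    rw [abs_of_nonneg (sq_nonneg _), ← sq_abs]
    gcongr
  have h1 : ∫ a, Real.exp (l * f a) ∂μ ≤ ∫ a, (1 + l * f a + l ^ 2 * f a ^ 2) ∂μ := by
    refine integral_mono_ae (integrable_exp_mul_of_ae_abs_le hf hb l)
      (((integrable_const 1).add (hint.const_mul l)).add (hint2.const_mul (l ^ 2))) ?_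
    filter_upwards [hb] with a ha
    have : |l * f a| ≤ 1 := by
      rw [abs_mul, abs_of_nonneg hl]
      exact (mul_le_mul_of_nonneg_left ha hl).trans hlb
    have := Real.exp_le_one_add_add_sq this
    rw [mul_pow] at this
    exact this
  have h2 : ∫ a, (1 + l * f a + l ^ 2 * f a ^ 2) ∂μ = 1 + l ^ 2 * ∫ a, f a ^ 2 ∂μ := by
    have hi : Integrable (fun a => 1 + l * f a) μ := (integrable_const 1).add (hint.const_mul l)
    rw [integral_add hi (hint2.const_mul (l ^ 2)),
      integral_add (integrable_const 1) (hint.const_mul l), integral_const_mul,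
      integral_const_mul, hmean]
    simp
  have h3 : l ^ 2 * ∫ a, f a ^ 2 ∂μ ≤ l ^ 2 * v := by gcongr
  linarith [Real.add_one_le_exp (l ^ 2 * v)]

variable {ι : Type*} [Fintype ι]

/-- One-sided exponential tail bound, before the optimization over `l`. -/
lemma measure_pi_sum_gt_le (μ : ι → Measure α) [∀ i, IsProbabilityMeasure (μ i)]
    {f : ι → α → ℝ} (hf : ∀ i, Measurable (f i)) {b : ℝ}
    (hb : ∀ i, ∀ᵐ a ∂μ i, |f i a| ≤ b) (hmean : ∀ i, ∫ a, f i a ∂μ i = 0) {v : ι → ℝ}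
    (hv : ∀ i, ∫ a, f i a ^ 2 ∂μ i ≤ v i) {l y x : ℝ} (hl : 0 ≤ l) (hlb : l * b ≤ 1)
    (hx : l ^ 2 * ∑ i, v i + x ≤ l * y) :
    (Measure.pi μ) {ω | y ≤ ∑ i, f i (ω i)} ≤ ENNReal.ofReal (Real.exp (-x)) := by
  have hprod : ∀ ω : ι → α, Real.exp (l * ∑ i, f i (ω i)) = ∏ i, Real.exp (l * f i (ω i)) := by
    intro ω
    rw [Finset.mul_sum, Real.exp_sum]
  have hint : Integrable (fun ω : ι → α => Real.exp (l * ∑ i, f i (ω i))) (Measure.pi μ) := by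
    simp_rw [hprod]
    exact Integrable.fintype_prod (f := fun i a => Real.exp (l * f i a))
      fun i => integrable_exp_mul_of_ae_abs_le (hf i) (hb i) l
  have hmgf : mgf (fun ω : ι → α => ∑ i, f i (ω i)) (Measure.pi μ) l
      ≤ Real.exp (l ^ 2 * ∑ i, v i) := by
    unfold mgf
    simp_rw [hprod]
    rw [integral_fintype_prod_eq_prod (f := fun i a => Real.exp (l * f i a)), Finset.mul_sum,
      Real.exp_sum]
    refine Finset.prod_le_prod (fun i _ => integral_nonneg fun a => (Real.exp_pos _).le) ?_
    exact fun i _ => integral_exp_mul_le (hf i) (hb i) (hmean i) (hv i) hl hlb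
  have h := measure_ge_le_exp_mul_mgf (μ := Measure.pi μ) y hl hint
  have h2 : (Measure.pi μ).real {ω | y ≤ ∑ i, f i (ω i)} ≤ Real.exp (-x) := by
    refine h.trans ?_
    calc Real.exp (-l * y) * mgf (fun ω : ι → α => ∑ i, f i (ω i)) (Measure.pi μ) l
        ≤ Real.exp (-l * y) * Real.exp (l ^ 2 * ∑ i, v i) := by gcongr
      _ = Real.exp (-l * y + l ^ 2 * ∑ i, v i) := (Real.exp_add _ _).symm
      _ ≤ Real.exp (-x) := Real.exp_le_exp.2 (by linarith)
  rw [← ENNReal.ofReal_toReal (measure_ne_top (Measure.pi μ) _)]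
  exact ENNReal.ofReal_le_ofReal h2

/-- The choice of the Chernoff parameter in Bernstein's inequality. -/
lemma exists_chernoff_parameter {b v x : ℝ} (hb : 0 < b) (hv : 0 ≤ v) (hx : 0 < x) :
    ∃ l : ℝ, 0 ≤ l ∧ l * b ≤ 1 ∧ l ^ 2 * v + x ≤ l * (2 * √(v * x) + 2 * b * x) := by
  have hs := Real.sqrt_nonneg (v * x)
  -- the minimizer `√(v x) / v` is admissible unless the variance is small; then `1 / b` does
  rcases le_or_gt v (b ^ 2 * x) with h | h
  · refine ⟨1 / b, by positivity, by field_simp; rfl, ?_⟩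
    have h1 : (1 / b) ^ 2 * v ≤ x := by
      rw [one_div, inv_pow, inv_mul_le_iff₀ (by positivity)]
      exact h
    have h2 : 1 / b * (2 * √(v * x) + 2 * b * x) = 2 * x + 1 / b * (2 * √(v * x)) := by
      field_simp
      ring
    have h3 : 0 ≤ 1 / b * (2 * √(v * x)) := by positivity
    linarith
  · have hv' : 0 < v := lt_of_le_of_lt (by positivity) h
    have hs2 : √(v * x) ^ 2 = v * x := Real.sq_sqrt (by positivity)
    refine ⟨√(v * x) / v, by positivity, ?_, ?_⟩
    · rw [div_mul_eq_mul_div, div_le_one hv']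
      refine abs_le_of_sq_le_sq' ?_ hv'.le |>.2
      rw [mul_pow, hs2]
      nlinarith
    · have h1 : (√(v * x) / v) ^ 2 * v = x := by
        rw [div_pow, hs2]
        field_simp
      have h2 : √(v * x) / v * (2 * √(v * x)) = 2 * x := by
        have : √(v * x) / v * (2 * √(v * x)) = 2 * √(v * x) ^ 2 / v := by ring
        rw [this, hs2]
        field_simp
      have h3 : 0 ≤ √(v * x) / v * (2 * b * x) := by positivity
      rw [mul_add, h1, h2]
      linarith

/-- **Bernstein's inequality** for independent, bounded, centred variables. -/
theorem bernstein_pi (μ : ι → Measure α) [∀ i, IsProbabilityMeasure (μ i)]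
    {f : ι → α → ℝ} (hf : ∀ i, Measurable (f i)) {b : ℝ} (hb0 : 0 < b)
    (hb : ∀ i, ∀ᵐ a ∂μ i, |f i a| ≤ b) (hmean : ∀ i, ∫ a, f i a ∂μ i = 0) {v : ι → ℝ}
    (hv : ∀ i, ∫ a, f i a ^ 2 ∂μ i ≤ v i) {x : ℝ} (hx : 0 < x) :
    (Measure.pi μ) {ω | 2 * √((∑ i, v i) * x) + 2 * b * x < |∑ i, f i (ω i)|}
      ≤ 2 * ENNReal.ofReal (Real.exp (-x)) := by
  have hv0 : 0 ≤ ∑ i, v i := Finset.sum_nonneg fun i _ =>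
    le_trans (integral_nonneg fun a => sq_nonneg _) (hv i)
  obtain ⟨l, hl, hlb, hlx⟩ := exists_chernoff_parameter hb0 hv0 hx
  have h1 := measure_pi_sum_gt_le μ hf hb hmean hv hl hlb hlx
  have h2 := measure_pi_sum_gt_le μ (f := fun i a => - f i a) (fun i => (hf i).neg)
    (by simpa using hb) (by simpa [integral_neg] using hmean) (by simpa using hv) hl hlb hlx
  calc (Measure.pi μ) {ω | 2 * √((∑ i, v i) * x) + 2 * b * x < |∑ i, f i (ω i)|}
      ≤ (Measure.pi μ) ({ω | 2 * √((∑ i, v i) * x) + 2 * b * x ≤ ∑ i, f i (ω i)} ∪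
          {ω | 2 * √((∑ i, v i) * x) + 2 * b * x ≤ ∑ i, - f i (ω i)}) := by
        refine measure_mono fun ω hω => ?_
        simp only [Set.mem_ofPred_eq, Set.mem_union, Finset.sum_neg_distrib] at hω ⊢
        rcases lt_abs.1 hω with h | h
        · exact Or.inl h.le
        · exact Or.inr h.le
    _ ≤ _ := measure_union_le _ _
    _ ≤ _ := by
        rw [two_mul (ENNReal.ofReal _)]
        exact add_le_add h1 h2

end Bernstein

/-! ### The variance of a function under a weight vector -/

/-- The variance of `g` under the weights `p` (meaningful when `p` is a probability vector). -/
noncomputable def wvar {ι : Type*} [Fintype ι] (p g : ι → ℝ) : ℝ :=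
  ∑ i, p i * (g i - ∑ j, p j * g j) ^ 2

section Wvar

variable {ι : Type*} [Fintype ι] {p : ι → ℝ}

lemma wvar_nonneg (hp : ∀ i, 0 ≤ p i) (g : ι → ℝ) : 0 ≤ wvar p g :=
  Finset.sum_nonneg fun i _ => mul_nonneg (hp i) (sq_nonneg _)

lemma wvar_eq (hp1 : ∑ i, p i = 1) (g : ι → ℝ) :
    wvar p g = ∑ i, p i * g i ^ 2 - (∑ i, p i * g i) ^ 2 := by
  unfold wvar
  set c := ∑ j, p j * g j with hc
  have : ∀ i, p i * (g i - c) ^ 2 = p i * g i ^ 2 - 2 * c * (p i * g i) + c ^ 2 * p i := by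
    intro i; ring
  simp_rw [this]
  rw [Finset.sum_add_distrib, Finset.sum_sub_distrib, ← Finset.mul_sum, ← Finset.mul_sum, hp1,
    ← hc]
  ring

lemma sq_sum_mul_le_sum_mul_sq (hp : ∀ i, 0 ≤ p i) (hp1 : ∑ i, p i = 1) (g : ι → ℝ) :
    (∑ i, p i * g i) ^ 2 ≤ ∑ i, p i * g i ^ 2 := by
  have := wvar_nonneg hp g
  rw [wvar_eq hp1] at this
  linarith

lemma sum_mul_le_of_le (hp : ∀ i, 0 ≤ p i) (hp1 : ∑ i, p i ≤ 1) {g : ι → ℝ} {b : ℝ} (hb : 0 ≤ b)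
    (hg : ∀ i, g i ≤ b) : ∑ i, p i * g i ≤ b := by
  calc ∑ i, p i * g i ≤ ∑ i, p i * b :=
        Finset.sum_le_sum fun i _ => mul_le_mul_of_nonneg_left (hg i) (hp i)
    _ = (∑ i, p i) * b := by rw [Finset.sum_mul]
    _ ≤ 1 * b := by gcongr
    _ = b := one_mul b

/-- Cauchy–Schwarz for the mean absolute deviation. -/
lemma sum_mul_abs_sub_le_sqrt_wvar (hp : ∀ i, 0 ≤ p i) (hp1 : ∑ i, p i = 1) (g : ι → ℝ) :
    ∑ i, p i * |g i - ∑ j, p j * g j| ≤ √(wvar p g) := by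
  refine Real.le_sqrt_of_sq_le ?_
  have := sq_sum_mul_le_sum_mul_sq hp hp1 (fun i => |g i - ∑ j, p j * g j|)
  simp only [sq_abs] at this
  exact this

/-- The variance of a perturbed function. -/
lemma wvar_le_of_abs_sub_le (hp : ∀ i, 0 ≤ p i) (hp1 : ∑ i, p i = 1) {f g : ι → ℝ} {b : ℝ}
    (h : ∀ i, |f i - g i| ≤ b) : wvar p f ≤ 2 * wvar p g + 2 * b ^ 2 := by
  -- the mean minimizes the second moment of the deviation from a constant
  set c := ∑ j, p j * g j with hc
  have h1 : wvar p f ≤ ∑ i, p i * (f i - c) ^ 2 := by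
    have h2 := wvar_eq hp1 f
    have : ∀ i, p i * (f i - c) ^ 2 = p i * f i ^ 2 - 2 * c * (p i * f i) + c ^ 2 * p i := by
      intro i; ring
    simp_rw [this]
    rw [Finset.sum_add_distrib, Finset.sum_sub_distrib, ← Finset.mul_sum, ← Finset.mul_sum, hp1]
    nlinarith [sq_nonneg (c - ∑ i, p i * f i)]
  refine h1.trans ?_
  calc ∑ i, p i * (f i - c) ^ 2 ≤ ∑ i, (2 * (p i * (g i - c) ^ 2) + 2 * b ^ 2 * p i) := by
        refine Finset.sum_le_sum fun i _ => ?_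
        have h3 : (f i - g i) ^ 2 ≤ b ^ 2 := by
          rw [← sq_abs]
          exact pow_le_pow_left₀ (abs_nonneg _) (h i) 2
        have h4 : (f i - c) ^ 2 ≤ 2 * (g i - c) ^ 2 + 2 * b ^ 2 := by
          nlinarith [sq_nonneg ((f i - g i) - (g i - c))]
        nlinarith [mul_le_mul_of_nonneg_left h4 (hp i)]
    _ = _ := by
        rw [Finset.sum_add_distrib, ← Finset.mul_sum, ← Finset.mul_sum, hp1, wvar, mul_one]

end Wvar

/-! ### Values and value functions of tabular models -/

namespace TabularModel

variable {𝒮 𝒜 : Type*} [Fintype 𝒮] [Fintype 𝒜]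

lemma sum_stateDist_succ_mul (N : TabularModel 𝒮 𝒜) (π : Policy 𝒮 𝒜) (t : ℕ) (g : 𝒮 → ℝ) :
    ∑ s', N.stateDist π (t + 1) s' * g s' =
      ∑ s, ∑ a, N.occupancy π t s a * ∑ s', N.trans t s a s' * g s' := by
  simp only [stateDist, occupancy, Finset.sum_mul, Finset.mul_sum]
  rw [Finset.sum_comm]
  refine Finset.sum_congr rfl fun s _ => ?_
  rw [Finset.sum_comm]
  refine Finset.sum_congr rfl fun a _ => Finset.sum_congr rfl fun s' _ => by ring

lemma valueFunction_of_le (N : TabularModel 𝒮 𝒜) {H : ℕ} (π : Policy 𝒮 𝒜) {t : ℕ} (h : H ≤ t)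
    (s : 𝒮) : N.valueFunction H π t s = 0 := by
  simp [valueFunction, Nat.sub_eq_zero_of_le h, valueToGo]

lemma valueFunction_of_lt (N : TabularModel 𝒮 𝒜) {H : ℕ} (π : Policy 𝒮 𝒜) {t : ℕ} (h : t < H)
    (s : 𝒮) : N.valueFunction H π t s = ∑ a, (π t s).1 a *
      (N.reward t s a + ∑ s', N.trans t s a s' * N.valueFunction H π (t + 1) s') := by
  obtain ⟨k, hk⟩ : ∃ k, H - t = k + 1 := ⟨H - t - 1, by omega⟩
  have hk' : H - (t + 1) = k := by omega
  simp [valueFunction, hk, hk', valueToGo]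

lemma sum_action (π : Policy 𝒮 𝒜) (t : ℕ) (s : 𝒮) : ∑ a, (π t s).1 a = 1 := (π t s).2.2

lemma action_nonneg (π : Policy 𝒮 𝒜) (t : ℕ) (s : 𝒮) (a : 𝒜) : 0 ≤ (π t s).1 a := (π t s).2.1 a

lemma sum_occupancy (N : TabularModel 𝒮 𝒜) (π : Policy 𝒮 𝒜) (t : ℕ) (s : 𝒮) :
    ∑ a, N.occupancy π t s a = N.stateDist π t s := by
  simp only [occupancy, ← Finset.mul_sum, sum_action, mul_one]

/-- One step of the comparison of two models: the state distribution of the first one is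
paired with the value function of the second one. -/
lemma sum_stateDist_mul_valueFunction_sub (M N : TabularModel 𝒮 𝒜) {H t : ℕ} (π : Policy 𝒮 𝒜)
    (h : t < H) :
    ∑ s, M.stateDist π t s * N.valueFunction H π t s -
        ∑ s, M.stateDist π (t + 1) s * N.valueFunction H π (t + 1) s =
      ∑ s, ∑ a, M.occupancy π t s a * (N.reward t s a +
        ∑ s', (N.trans t s a s' - M.trans t s a s') * N.valueFunction H π (t + 1) s') := by
  rw [sum_stateDist_succ_mul, ← Finset.sum_sub_distrib]
  refine Finset.sum_congr rfl fun s _ => ?_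
  rw [valueFunction_of_lt N π h, Finset.mul_sum, ← Finset.sum_sub_distrib]
  refine Finset.sum_congr rfl fun a _ => ?_
  simp only [sub_mul, Finset.sum_sub_distrib, occupancy]
  ring

/-- The simulation lemma: the difference of the values of a policy in two models is the sum of
the one-step model errors along the first model. -/
lemma sum_init_mul_valueFunction_sub_value (M N : TabularModel 𝒮 𝒜) (H : ℕ) (π : Policy 𝒮 𝒜) :
    ∑ s, M.init s * N.valueFunction H π 0 s - M.value H π =
      ∑ t ∈ Finset.range H, ∑ s, ∑ a, M.occupancy π t s a *
        ((N.reward t s a - M.reward t s a) +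
          ∑ s', (N.trans t s a s' - M.trans t s a s') * N.valueFunction H π (t + 1) s') := by
  have h1 := Finset.sum_range_sub' (fun t => ∑ s, M.stateDist π t s * N.valueFunction H π t s) H
  simp only [valueFunction_of_le N π le_rfl, mul_zero, Finset.sum_const_zero, sub_zero] at h1
  have h0 : ∀ s, M.stateDist π 0 s = M.init s := fun s => rfl
  simp only [h0] at h1
  rw [← h1, value, ← Finset.sum_sub_distrib]
  refine Finset.sum_congr rfl fun t ht => ?_
  rw [sum_stateDist_mul_valueFunction_sub M N π (Finset.mem_range.1 ht), ← Finset.sum_sub_distrib]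
  refine Finset.sum_congr rfl fun s _ => ?_
  rw [← Finset.sum_sub_distrib]
  refine Finset.sum_congr rfl fun a _ => by ring

lemma value_eq_sum_init (N : TabularModel 𝒮 𝒜) (H : ℕ) (π : Policy 𝒮 𝒜) :
    N.value H π = ∑ s, N.init s * N.valueFunction H π 0 s := by
  have := sum_init_mul_valueFunction_sub_value N N H π
  simp only [sub_self, zero_mul, Finset.sum_const_zero, add_zero, mul_zero] at this
  linarith

/-- Weights that are substochastic and mean rewards in `[0, 1]`. -/
structure IsSubstochastic (N : TabularModel 𝒮 𝒜) : Prop where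
  trans_nonneg : ∀ t s a s', 0 ≤ N.trans t s a s'
  sum_trans_le : ∀ t s a, ∑ s', N.trans t s a s' ≤ 1
  reward_nonneg : ∀ t s a, 0 ≤ N.reward t s a
  reward_le : ∀ t s a, N.reward t s a ≤ 1

lemma IsSubstochastic.valueToGo_nonneg {N : TabularModel 𝒮 𝒜} (hN : N.IsSubstochastic)
    (π : Policy 𝒮 𝒜) (k t : ℕ) (s : 𝒮) : 0 ≤ N.valueToGo π k t s := by
  induction k generalizing t s with
  | zero => simp [valueToGo]
  | succ k ih =>
    rw [valueToGo]
    exact Finset.sum_nonneg fun a _ => mul_nonneg (action_nonneg π t s a)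
      (add_nonneg (hN.reward_nonneg t s a)
        (Finset.sum_nonneg fun s' _ => mul_nonneg (hN.trans_nonneg t s a s') (ih _ _)))

lemma IsSubstochastic.backup_le {N : TabularModel 𝒮 𝒜} (hN : N.IsSubstochastic) {k : ℕ}
    {g : 𝒮 → ℝ} (hg : ∀ s, g s ≤ k) (t : ℕ) (s : 𝒮) (a : 𝒜) :
    N.reward t s a + ∑ s', N.trans t s a s' * g s' ≤ ((k + 1 : ℕ) : ℝ) := by
  have h1 := sum_mul_le_of_le (hN.trans_nonneg t s a) (hN.sum_trans_le t s a)
    (Nat.cast_nonneg k) hg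
  have h2 := hN.reward_le t s a
  push_cast
  linarith

lemma IsSubstochastic.valueToGo_le {N : TabularModel 𝒮 𝒜} (hN : N.IsSubstochastic)
    (π : Policy 𝒮 𝒜) (k t : ℕ) (s : 𝒮) : N.valueToGo π k t s ≤ k := by
  induction k generalizing t s with
  | zero => simp [valueToGo]
  | succ k ih =>
    rw [valueToGo]
    exact sum_mul_le_of_le (action_nonneg π t s) (sum_action π t s).le (by positivity)
      (hN.backup_le (ih (t + 1)) t s)

lemma IsSubstochastic.valueFunction_nonneg {N : TabularModel 𝒮 𝒜} (hN : N.IsSubstochastic)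
    (H : ℕ) (π : Policy 𝒮 𝒜) (t : ℕ) (s : 𝒮) : 0 ≤ N.valueFunction H π t s :=
  hN.valueToGo_nonneg π _ t s

lemma IsSubstochastic.valueFunction_le {N : TabularModel 𝒮 𝒜} (hN : N.IsSubstochastic)
    (H : ℕ) (π : Policy 𝒮 𝒜) (t : ℕ) (s : 𝒮) : N.valueFunction H π t s ≤ H :=
  (hN.valueToGo_le π _ t s).trans (by exact_mod_cast Nat.sub_le H t)

/-- The optimal expected total reward over `k` steps from state `s` at step `t`, computed by
dynamic programming. -/
noncomputable def optimalToGo (N : TabularModel 𝒮 𝒜) : ℕ → ℕ → 𝒮 → ℝ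
  | 0, _, _ => 0
  | k + 1, t, s => ⨆ a, (N.reward t s a + ∑ s', N.trans t s a s' * optimalToGo N k (t + 1) s')

lemma valueToGo_le_optimalToGo {N : TabularModel 𝒮 𝒜} (hN : ∀ t s a s', 0 ≤ N.trans t s a s')
    (π : Policy 𝒮 𝒜) (k t : ℕ) (s : 𝒮) : N.valueToGo π k t s ≤ N.optimalToGo k t s := by
  induction k generalizing t s with
  | zero => simp [valueToGo, optimalToGo]
  | succ k ih =>
    rw [valueToGo, optimalToGo]
    calc ∑ a, (π t s).1 a * (N.reward t s a + ∑ s', N.trans t s a s' * N.valueToGo π k (t + 1) s')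
        ≤ ∑ a, (π t s).1 a *
            ⨆ a, (N.reward t s a + ∑ s', N.trans t s a s' * N.optimalToGo k (t + 1) s') := by
          refine Finset.sum_le_sum fun a _ =>
            mul_le_mul_of_nonneg_left ?_ (action_nonneg π t s a)
          refine le_trans ?_ (le_ciSup (Set.finite_range fun a =>
            N.reward t s a + ∑ s', N.trans t s a s' * N.optimalToGo k (t + 1) s').bddAbove a)
          gcongr with s' _
          · exact hN t s a s'
          · exact ih (t + 1) s'
      _ = _ := by rw [← Finset.sum_mul, sum_action, one_mul]

/-- Acting greedily with respect to the optimal values attains them. -/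
lemma exists_valueFunction_eq_optimalToGo [Nonempty 𝒜] (N : TabularModel 𝒮 𝒜) (H : ℕ) :
    ∃ π : Policy 𝒮 𝒜, ∀ t ≤ H, ∀ s, N.valueFunction H π t s = N.optimalToGo (H - t) t s := by
  classical
  have hex : ∀ t s, ∃ a, N.reward t s a +
      ∑ s', N.trans t s a s' * N.optimalToGo (H - (t + 1)) (t + 1) s' =
      ⨆ a, (N.reward t s a + ∑ s', N.trans t s a s' * N.optimalToGo (H - (t + 1)) (t + 1) s') :=
    fun t s => exists_eq_ciSup_of_finite
  choose g hg using hex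
  let π : Policy 𝒮 𝒜 := fun t s => ⟨Pi.single (g t s) 1, single_mem_stdSimplex ℝ (g t s)⟩
  have hπ : ∀ k, ∀ t, t + k = H → ∀ s, N.valueToGo π k t s = N.optimalToGo k t s := by
    intro k
    induction k with
    | zero => intro t _ s; simp [valueToGo, optimalToGo]
    | succ k ih =>
      intro t ht s
      have hk : H - (t + 1) = k := by omega
      rw [valueToGo, optimalToGo]
      have := hg t s
      rw [hk] at this
      rw [← this]
      simp only [ih (t + 1) (by omega)]
      rw [Finset.sum_eq_single (g t s)]
      · simp [π]
      · intro a _ ha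
        simp [π, Pi.single_eq_of_ne ha]
      · simp
  exact ⟨π, fun t ht s => hπ (H - t) t (by omega) s⟩

lemma IsBellmanOptimal.valueFunction_eq [Nonempty 𝒜] {N : TabularModel 𝒮 𝒜}
    (hN : ∀ t s a s', 0 ≤ N.trans t s a s') {H : ℕ} {π : Policy 𝒮 𝒜}
    (h : N.IsBellmanOptimal H π) {t : ℕ} (ht : t ≤ H) (s : 𝒮) :
    N.valueFunction H π t s = N.optimalToGo (H - t) t s := by
  refine le_antisymm (valueToGo_le_optimalToGo hN π _ t s) ?_
  obtain ⟨π', hπ'⟩ := exists_valueFunction_eq_optimalToGo N H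
  rcases ht.lt_or_eq with h' | rfl
  · rw [← hπ' t ht s]
    exact h π' t h' s
  · simp [optimalToGo, valueFunction, valueToGo]

lemma IsBellmanOptimal.value_le {N : TabularModel 𝒮 𝒜} (hN : ∀ s, 0 ≤ N.init s) {H : ℕ}
    (hH : 0 < H) {π : Policy 𝒮 𝒜} (h : N.IsBellmanOptimal H π) (π' : Policy 𝒮 𝒜) :
    N.value H π' ≤ N.value H π := by
  rw [value_eq_sum_init, value_eq_sum_init]
  exact Finset.sum_le_sum fun s _ => mul_le_mul_of_nonneg_left (h π' 0 hH s) (hN s)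

lemma valueToGo_congr {N N' : TabularModel 𝒮 𝒜} {π : Policy 𝒮 𝒜} {t : ℕ}
    (hP : ∀ u, t ≤ u → N.trans u = N'.trans u) (hr : ∀ u, t ≤ u → N.reward u = N'.reward u)
    (k u : ℕ) (hu : t ≤ u) (s : 𝒮) : N.valueToGo π k u s = N'.valueToGo π k u s := by
  induction k generalizing u s with
  | zero => simp [valueToGo]
  | succ k ih => simp only [valueToGo, hP u hu, hr u hu, ih (u + 1) (by omega)]

lemma optimalToGo_congr {N N' : TabularModel 𝒮 𝒜} {t : ℕ}
    (hP : ∀ u, t ≤ u → N.trans u = N'.trans u) (hr : ∀ u, t ≤ u → N.reward u = N'.reward u)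
    (k u : ℕ) (hu : t ≤ u) (s : 𝒮) : N.optimalToGo k u s = N'.optimalToGo k u s := by
  induction k generalizing u s with
  | zero => simp [optimalToGo]
  | succ k ih => simp only [optimalToGo, hP u hu, hr u hu, ih (u + 1) (by omega)]

end TabularModel

/-! ### From one-step errors to errors of values -/

namespace MDP

variable {𝒮 𝒜 : Type*} [Fintype 𝒮] [Fintype 𝒜]

lemma trans_nonneg (M : MDP 𝒮 𝒜) (t : ℕ) (s : 𝒮) (a : 𝒜) (s' : 𝒮) :
    0 ≤ M.toModel.trans t s a s' := (M.trans t s a).2.1 s'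

lemma sum_trans (M : MDP 𝒮 𝒜) (t : ℕ) (s : 𝒮) (a : 𝒜) :
    ∑ s', M.toModel.trans t s a s' = 1 := (M.trans t s a).2.2

lemma stateDist_nonneg (M : MDP 𝒮 𝒜) (π : Policy 𝒮 𝒜) (t : ℕ) (s : 𝒮) :
    0 ≤ M.toModel.stateDist π t s := by
  induction t generalizing s with
  | zero => exact M.init.2.1 s
  | succ t ih =>
    exact Finset.sum_nonneg fun s' _ => Finset.sum_nonneg fun a _ =>
      mul_nonneg (mul_nonneg (ih s') (TabularModel.action_nonneg π t s' a)) (M.trans_nonneg _ _ _ _)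

lemma sum_stateDist (M : MDP 𝒮 𝒜) (π : Policy 𝒮 𝒜) (t : ℕ) :
    ∑ s, M.toModel.stateDist π t s = 1 := by
  induction t with
  | zero => exact M.init.2.2
  | succ t ih =>
    have := TabularModel.sum_stateDist_succ_mul M.toModel π t (fun _ => 1)
    simpa [sum_trans, TabularModel.sum_occupancy, ih] using this

lemma occupancy_nonneg (M : MDP 𝒮 𝒜) (π : Policy 𝒮 𝒜) (t : ℕ) (s : 𝒮) (a : 𝒜) :
    0 ≤ M.toModel.occupancy π t s a :=
  mul_nonneg (M.stateDist_nonneg π t s) (TabularModel.action_nonneg π t s a)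

lemma sum_range_sum_occupancy (M : MDP 𝒮 𝒜) (π : Policy 𝒮 𝒜) (H : ℕ) :
    ∑ t ∈ Finset.range H, ∑ s, ∑ a, M.toModel.occupancy π t s a = H := by
  simp [TabularModel.sum_occupancy, sum_stateDist]

/-- The law of total variance with drift: along the true model, the accumulated one-step
variances of a process with values in `[0, H]` are controlled by the accumulated drift. -/
lemma sum_occupancy_mul_wvar_le (M : MDP 𝒮 𝒜) (π : Policy 𝒮 𝒜) (H : ℕ) (F : ℕ → 𝒮 → ℝ)
    (y : ℕ → 𝒮 → 𝒜 → ℝ)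
    (hF0 : ∀ t s, 0 ≤ F t s) (hFH : ∀ t s, F t s ≤ H) (hlast : ∀ s, F H s = 0)
    (hF : ∀ t < H, ∀ s, F t s = ∑ a, (π t s).1 a *
      (y t s a + ∑ s', M.toModel.trans t s a s' * F (t + 1) s')) :
    ∑ t ∈ Finset.range H, ∑ s, ∑ a, M.toModel.occupancy π t s a *
        wvar (M.toModel.trans t s a) (F (t + 1)) ≤
      2 * H * ∑ t ∈ Finset.range H, ∑ s, ∑ a, M.toModel.occupancy π t s a * |y t s a| := by
  -- the second moments of `F t` along the model telescope
  have hstep : ∀ t ∈ Finset.range H, ∑ s, ∑ a, M.toModel.occupancy π t s a *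
        wvar (M.toModel.trans t s a) (F (t + 1)) ≤
      (2 * H * ∑ s, ∑ a, M.toModel.occupancy π t s a * |y t s a|) -
        (∑ s, M.toModel.stateDist π t s * F t s ^ 2 -
          ∑ s, M.toModel.stateDist π (t + 1) s * F (t + 1) s ^ 2) := by
    intro t ht
    rw [TabularModel.sum_stateDist_succ_mul, Finset.mul_sum, ← Finset.sum_sub_distrib,
      ← Finset.sum_sub_distrib]
    refine Finset.sum_le_sum fun s _ => ?_
    set q : 𝒜 → ℝ := fun a => ∑ s', M.toModel.trans t s a s' * F (t + 1) s' with hq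
    have hq0 : ∀ a, 0 ≤ q a := fun a =>
      Finset.sum_nonneg fun s' _ => mul_nonneg (M.trans_nonneg _ _ _ _) (hF0 _ _)
    have hqH : ∀ a, q a ≤ H := fun a =>
      sum_mul_le_of_le (M.trans_nonneg t s a) (M.sum_trans t s a).le (Nat.cast_nonneg H) (hFH _)
    have hπ0 := TabularModel.action_nonneg π t s
    have hπ1 := TabularModel.sum_action π t s
    have hy0 : 0 ≤ ∑ a, (π t s).1 a * q a :=
      Finset.sum_nonneg fun a _ => mul_nonneg (hπ0 a) (hq0 a)
    have hyH : ∑ a, (π t s).1 a * q a ≤ H := sum_mul_le_of_le hπ0 hπ1.le (Nat.cast_nonneg H) hqH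
    have hdiff : F t s - ∑ a, (π t s).1 a * q a = ∑ a, (π t s).1 a * y t s a := by
      rw [hF t (Finset.mem_range.1 ht) s, ← Finset.sum_sub_distrib]
      exact Finset.sum_congr rfl fun a _ => by ring
    have habs : F t s - ∑ a, (π t s).1 a * q a ≤ ∑ a, (π t s).1 a * |y t s a| := by
      rw [hdiff]
      exact Finset.sum_le_sum fun a _ => mul_le_mul_of_nonneg_left (le_abs_self _) (hπ0 a)
    have hpos : 0 ≤ ∑ a, (π t s).1 a * |y t s a| :=
      Finset.sum_nonneg fun a _ => mul_nonneg (hπ0 a) (abs_nonneg _)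
    have hsq : F t s ^ 2 - (∑ a, (π t s).1 a * q a) ^ 2 ≤
        2 * H * ∑ a, (π t s).1 a * |y t s a| := by
      have e : F t s ^ 2 - (∑ a, (π t s).1 a * q a) ^ 2 =
          (F t s + ∑ a, (π t s).1 a * q a) * (F t s - ∑ a, (π t s).1 a * q a) := by ring
      rw [e]
      calc _ ≤ (F t s + ∑ a, (π t s).1 a * q a) * ∑ a, (π t s).1 a * |y t s a| :=
            mul_le_mul_of_nonneg_left habs (add_nonneg (hF0 t s) hy0)
        _ ≤ _ := mul_le_mul_of_nonneg_right (by linarith [hFH t s]) hpos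
    have hjen := sq_sum_mul_le_sum_mul_sq hπ0 hπ1 q
    have hw : ∀ a, M.toModel.occupancy π t s a * wvar (M.toModel.trans t s a) (F (t + 1)) =
        M.toModel.occupancy π t s a * ∑ s', M.toModel.trans t s a s' * F (t + 1) s' ^ 2 -
          M.toModel.stateDist π t s * ((π t s).1 a * q a ^ 2) := by
      intro a
      rw [wvar_eq (M.sum_trans t s a)]
      simp only [TabularModel.occupancy, hq]
      ring
    have hocc : ∑ a, M.toModel.occupancy π t s a * |y t s a| =
        M.toModel.stateDist π t s * ∑ a, (π t s).1 a * |y t s a| := by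
      simp only [TabularModel.occupancy, Finset.mul_sum, mul_assoc]
    simp only [hw]
    rw [Finset.sum_sub_distrib, ← Finset.mul_sum, hocc]
    have := mul_le_mul_of_nonneg_left
      (show F t s ^ 2 - ∑ a, (π t s).1 a * q a ^ 2 ≤ 2 * H * ∑ a, (π t s).1 a * |y t s a| by
        linarith) (M.stateDist_nonneg π t s)
    linarith
  refine (Finset.sum_le_sum hstep).trans ?_
  rw [Finset.sum_sub_distrib, ← Finset.mul_sum,
    Finset.sum_range_sub' (fun t => ∑ s, M.toModel.stateDist π t s * F t s ^ 2) H]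
  have h0 : 0 ≤ ∑ s, M.toModel.stateDist π 0 s * F 0 s ^ 2 :=
    Finset.sum_nonneg fun s _ => mul_nonneg (M.stateDist_nonneg π 0 s) (sq_nonneg _)
  simp only [hlast, ne_eq, OfNat.ofNat_ne_zero, not_false_eq_true, zero_pow, mul_zero,
    Finset.sum_const_zero, sub_zero]
  linarith

/-- If the errors of the transition weights, tested against the value function of the
approximate model, are of Bernstein type, then the error of the value of a policy over `H` steps
grows only like `H ^ (3 / 2)`: the one-step variances, taken along the true model, sum to
`O(H ^ 2)`. -/
theorem abs_value_sub_value_le (M : MDP 𝒮 𝒜) {N : TabularModel 𝒮 𝒜} (hN : N.IsSubstochastic)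
    {H : ℕ} (hH : 0 < H) (π : Policy 𝒮 𝒜) {a₁ b₁ e₀ e₁ : ℝ} (ha : 0 ≤ a₁) (haH : a₁ * √H ≤ 1)
    (hinit : |∑ s, (N.init s - M.toModel.init s) * N.valueFunction H π 0 s| ≤ e₀)
    (hr : ∀ t < H, ∀ s a, 0 < M.toModel.occupancy π t s a →
      |N.reward t s a - M.toModel.reward t s a| ≤ e₁)
    (hrow : ∀ t < H, ∀ s a, 0 < M.toModel.occupancy π t s a →
      |∑ s', (N.trans t s a s' - M.toModel.trans t s a s') * N.valueFunction H π (t + 1) s'| ≤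
        a₁ * √(wvar (M.toModel.trans t s a) (N.valueFunction H π (t + 1))) + b₁) :
    |N.value H π - M.toModel.value H π| ≤
      e₀ + H * e₁ + (3 * a₁ * H * √H + 2 * H * b₁) := by
  set F := N.valueFunction H π with hFdef
  set x : ℕ → 𝒮 → 𝒜 → ℝ := fun t s a =>
    ∑ s', (N.trans t s a s' - M.toModel.trans t s a s') * F (t + 1) s' with hx
  set E := ∑ t ∈ Finset.range H, ∑ s, ∑ a, M.toModel.occupancy π t s a * |x t s a| with hE
  set W := ∑ t ∈ Finset.range H, ∑ s, ∑ a, M.toModel.occupancy π t s a *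
        wvar (M.toModel.trans t s a) (F (t + 1)) with hW
  have hH1 : (1 : ℝ) ≤ H := by exact_mod_cast hH
  have hsH : 0 < √(H : ℝ) := Real.sqrt_pos.2 (by linarith)
  have hsq : √(H : ℝ) * √(H : ℝ) = H := Real.mul_self_sqrt (by linarith)
  have hmono : ∀ f g : ℕ → 𝒮 → 𝒜 → ℝ,
      (∀ t < H, ∀ s a, 0 < M.toModel.occupancy π t s a → f t s a ≤ g t s a) →
      ∑ t ∈ Finset.range H, ∑ s, ∑ a, M.toModel.occupancy π t s a * f t s a ≤
        ∑ t ∈ Finset.range H, ∑ s, ∑ a, M.toModel.occupancy π t s a * g t s a := by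
    intro f g hfg
    refine Finset.sum_le_sum fun t ht => Finset.sum_le_sum fun s _ => Finset.sum_le_sum fun a _ => ?_
    rcases (M.occupancy_nonneg π t s a).eq_or_lt with h | h
    · simp [← h]
    · exact mul_le_mul_of_nonneg_left (hfg t (Finset.mem_range.1 ht) s a h) h.le
  have hconst : ∀ c : ℝ, ∑ t ∈ Finset.range H, ∑ s, ∑ a, M.toModel.occupancy π t s a * c =
      H * c := by
    intro c
    simp_rw [← Finset.sum_mul]
    rw [M.sum_range_sum_occupancy]
  -- along the true model, `F` is a value process with the drift `N.reward + x`
  have hWle : W ≤ 2 * H * (H + E) := by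
    refine (M.sum_occupancy_mul_wvar_le π H F (fun t s a => N.reward t s a + x t s a)
      (hN.valueFunction_nonneg H π) (hN.valueFunction_le H π)
      (N.valueFunction_of_le π le_rfl) ?_).trans ?_
    · intro t ht s
      rw [hFdef, N.valueFunction_of_lt π ht]
      refine Finset.sum_congr rfl fun a _ => ?_
      simp only [hx, sub_mul, Finset.sum_sub_distrib]
      ring
    · gcongr
      calc _ ≤ ∑ t ∈ Finset.range H, ∑ s, ∑ a, M.toModel.occupancy π t s a * (1 + |x t s a|) := by
            refine hmono _ _ fun t _ s a _ => (abs_add_le _ _).trans ?_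
            rw [abs_of_nonneg (hN.reward_nonneg t s a)]
            linarith [hN.reward_le t s a]
        _ = H + E := by
            simp only [mul_add, Finset.sum_add_distrib, hE]
            rw [hconst, mul_one]
  -- `√w ≤ √H + w / (4√H)` replaces the Cauchy–Schwarz inequality
  have hEle : E ≤ H * (a₁ * √H + b₁) + a₁ / (4 * √H) * W := by
    calc E ≤ ∑ t ∈ Finset.range H, ∑ s, ∑ a, M.toModel.occupancy π t s a *
            ((a₁ * √H + b₁) +
              a₁ / (4 * √H) * wvar (M.toModel.trans t s a) (F (t + 1))) := by
          refine hmono _ _ fun t ht s a hpos => (hrow t ht s a hpos).trans ?_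
          set w := wvar (M.toModel.trans t s a) (F (t + 1))
          have hw0 : 0 ≤ w := wvar_nonneg (M.trans_nonneg t s a) _
          have hws : √w ^ 2 = w := Real.sq_sqrt hw0
          have : √w ≤ √H + w / (4 * √H) := by
            have h4 : √H + w / (4 * √H) - √w = (2 * √H - √w) ^ 2 / (4 * √H) := by
              rw [← hws]
              field_simp
              rw [Real.sqrt_sq (Real.sqrt_nonneg w)]
              ring
            have : 0 ≤ (2 * √H - √w) ^ 2 / (4 * √(H : ℝ)) := by positivity
            linarith
          have := mul_le_mul_of_nonneg_left this ha
          have e : a₁ * (√H + w / (4 * √H)) = a₁ * √H + a₁ / (4 * √H) * w := by ring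
          linarith
      _ = _ := by
          simp only [mul_add (M.toModel.occupancy π _ _ _), Finset.sum_add_distrib]
          have : ∀ t s a, M.toModel.occupancy π t s a *
              (a₁ / (4 * √H) * wvar (M.toModel.trans t s a) (F (t + 1))) =
              a₁ / (4 * √H) * (M.toModel.occupancy π t s a *
                wvar (M.toModel.trans t s a) (F (t + 1))) := fun t s a => by ring
          simp only [this, ← Finset.mul_sum]
          rw [← hW]
          have h2 := hconst (a₁ * √H + b₁)
          simp only [mul_add, Finset.sum_add_distrib] at h2
          rw [h2]
          ring
  have hE0 : 0 ≤ E := Finset.sum_nonneg fun t _ => Finset.sum_nonneg fun s _ =>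
    Finset.sum_nonneg fun a _ => mul_nonneg (M.occupancy_nonneg π t s a) (abs_nonneg _)
  have hEfin : E ≤ 3 * a₁ * H * √H + 2 * H * b₁ := by
    have h1 : a₁ / (4 * √H) * W ≤ a₁ * √H / 2 * (H + E) := by
      calc a₁ / (4 * √H) * W ≤ a₁ / (4 * √H) * (2 * H * (H + E)) := by gcongr
        _ = a₁ / (4 * √H) * (2 * (√H * √H) * (H + E)) := by rw [hsq]
        _ = _ := by field_simp; ring
    -- this term is absorbed by the left-hand side
    have h2 : a₁ * √H / 2 * E ≤ 1 / 2 * E := by gcongr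
    nlinarith
  have hsim := TabularModel.sum_init_mul_valueFunction_sub_value M.toModel N H π
  have hval := N.value_eq_sum_init H π
  -- the simulation lemma
  have hdec : N.value H π - M.toModel.value H π =
      ∑ s, (N.init s - M.toModel.init s) * F 0 s +
      ∑ t ∈ Finset.range H, ∑ s, ∑ a, M.toModel.occupancy π t s a *
        ((N.reward t s a - M.toModel.reward t s a) + x t s a) := by
    rw [← hsim, hval]
    simp only [sub_mul, Finset.sum_sub_distrib]
    ring
  rw [hdec]
  have hsum : |∑ t ∈ Finset.range H, ∑ s, ∑ a, M.toModel.occupancy π t s a *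
      ((N.reward t s a - M.toModel.reward t s a) + x t s a)| ≤ H * e₁ + E := by
    calc _ ≤ ∑ t ∈ Finset.range H, ∑ s, ∑ a, M.toModel.occupancy π t s a *
            |(N.reward t s a - M.toModel.reward t s a) + x t s a| := by
          refine (Finset.abs_sum_le_sum_abs _ _).trans (Finset.sum_le_sum fun t _ => ?_)
          refine (Finset.abs_sum_le_sum_abs _ _).trans (Finset.sum_le_sum fun s _ => ?_)
          refine (Finset.abs_sum_le_sum_abs _ _).trans (Finset.sum_le_sum fun a _ => ?_)
          rw [abs_mul, abs_of_nonneg (M.occupancy_nonneg π t s a)]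
      _ ≤ ∑ t ∈ Finset.range H, ∑ s, ∑ a, M.toModel.occupancy π t s a * (e₁ + |x t s a|) :=
          hmono _ _ fun t ht s a hpos =>
            (abs_add_le _ _).trans (add_le_add_left (hr t ht s a hpos) _)
      _ = H * e₁ + E := by
          simp only [mul_add, Finset.sum_add_distrib, hE]
          rw [hconst]
  linarith [abs_add_le (∑ s, (N.init s - M.toModel.init s) * F 0 s)
    (∑ t ∈ Finset.range H, ∑ s, ∑ a, M.toModel.occupancy π t s a *
      ((N.reward t s a - M.toModel.reward t s a) + x t s a))]

end MDP

/-! ### Sums over paths -/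

section Chain

variable {R 𝒮 𝒜 : Type*} [CommSemiring R] [Fintype 𝒮] [Fintype 𝒜]

/-- Propagation of the weights `φ` on the initial state through the step weights `f`. -/
def chainVec (φ : 𝒮 → R) (f : ℕ → 𝒮 → 𝒜 → 𝒮 → R) : ℕ → 𝒮 → R
  | 0 => φ
  | t + 1 => fun s' => ∑ s, ∑ a, chainVec φ f t s * f t s a s'

lemma sum_path_eq (φ : 𝒮 → R) (f : ℕ → 𝒮 → 𝒜 → 𝒮 → R) (H : ℕ) (ψ : 𝒮 → R) :
    ∑ σ : Fin (H + 1) → 𝒮, ∑ α : Fin H → 𝒜,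
      φ (σ 0) * (∏ t : Fin H, f t (σ t.castSucc) (α t) (σ t.succ)) * ψ (σ (Fin.last H)) =
    ∑ s, chainVec φ f H s * ψ s := by
  induction H generalizing ψ with
  | zero =>
    rw [← (Equiv.funUnique (Fin 1) 𝒮).symm.sum_comp]
    simp [chainVec]
  | succ H ih =>
    rw [← (Fin.snocEquiv (fun _ : Fin (H + 2) => 𝒮)).sum_comp, Fintype.sum_prod_type_right]
    simp_rw [← (Fin.snocEquiv (fun _ : Fin (H + 1) => 𝒜)).sum_comp, Fintype.sum_prod_type_right]
    have h := ih (fun s => ∑ a, ∑ s', f H s a s' * ψ s')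
    have hR : ∑ s, chainVec φ f (H + 1) s * ψ s =
        ∑ s, chainVec φ f H s * ∑ a, ∑ s', f H s a s' * ψ s' := by
      simp only [chainVec, Finset.sum_mul, Finset.mul_sum]
      rw [Finset.sum_comm]
      refine Finset.sum_congr rfl fun s _ => ?_
      rw [Finset.sum_comm]
      refine Finset.sum_congr rfl fun a _ => Finset.sum_congr rfl fun s' _ => by ring
    rw [hR, ← h]
    refine Finset.sum_congr rfl fun σ _ => ?_
    rw [Finset.sum_comm]
    refine Finset.sum_congr rfl fun α _ => ?_
    rw [Finset.sum_comm, Finset.mul_sum]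
    refine Finset.sum_congr rfl fun a _ => ?_
    rw [Finset.mul_sum]
    refine Finset.sum_congr rfl fun s' _ => ?_
    have h0 : (0 : Fin (H + 2)) = (0 : Fin (H + 1)).castSucc := rfl
    rw [Fin.prod_univ_castSucc]
    simp only [Fin.snocEquiv_apply, h0, Fin.succ_castSucc, Fin.succ_last, Fin.snoc_castSucc,
      Fin.snoc_last, Fin.val_castSucc, Fin.val_last]
    ring

lemma sum_chainVec_of_le (φ : 𝒮 → R) (f : ℕ → 𝒮 → 𝒜 → 𝒮 → R) {k : ℕ}
    (hf : ∀ u, k ≤ u → ∀ s, ∑ a, ∑ s', f u s a s' = 1) {H : ℕ} (h : k ≤ H) :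
    ∑ s, chainVec φ f H s = ∑ s, chainVec φ f k s := by
  induction H, h using Nat.le_induction with
  | base => rfl
  | succ H hk ih =>
    rw [← ih]
    simp only [chainVec]
    rw [Finset.sum_comm]
    refine Finset.sum_congr rfl fun s _ => ?_
    rw [Finset.sum_comm]
    simp_rw [← Finset.mul_sum]
    rw [hf H hk, mul_one]

lemma chainVec_congr (φ : 𝒮 → R) {f g : ℕ → 𝒮 → 𝒜 → 𝒮 → R} {t : ℕ} (h : ∀ u < t, f u = g u) :
    chainVec φ f t = chainVec φ g t := by
  induction t with
  | zero => rfl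
  | succ t ih =>
    simp only [chainVec]
    rw [ih fun u hu => h u (by omega), h t (by omega)]

end Chain

/-! ### The law of an episode -/

namespace MDP

variable {𝒮 𝒜 : Type*} [Fintype 𝒮] [Fintype 𝒜]

/-- The weight of a step from `s` to `s'` by the action `a`, the action being drawn from `μ`. -/
noncomputable def stepWeight (M : MDP 𝒮 𝒜) (μ : Policy 𝒮 𝒜) (t : ℕ) (s : 𝒮) (a : 𝒜) (s' : 𝒮) : ℝ :=
  (μ t s).1 a * (M.trans t s a).1 s'

/-- The probability of the states `σ` and the actions `α`. -/
noncomputable def pathWeight (M : MDP 𝒮 𝒜) (μ : Policy 𝒮 𝒜) {H : ℕ} (σ : Fin (H + 1) → 𝒮)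
    (α : Fin H → 𝒜) : ℝ :=
  M.init.1 (σ 0) * ∏ t : Fin H, M.stepWeight μ t (σ t.castSucc) (α t) (σ t.succ)

/-- The law of the rewards given the states `σ` and the actions `α`. -/
noncomputable def pathRewardLaw (M : MDP 𝒮 𝒜) {H : ℕ} (σ : Fin (H + 1) → 𝒮) (α : Fin H → 𝒜) :
    Measure (Fin H → ℝ) :=
  Measure.pi fun t : Fin H => (M.rewardLaw t (σ t.castSucc) (α t) (σ t.succ) : Measure ℝ)

lemma stepWeight_nonneg (M : MDP 𝒮 𝒜) (μ : Policy 𝒮 𝒜) (t : ℕ) (s : 𝒮) (a : 𝒜) (s' : 𝒮) :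
    0 ≤ M.stepWeight μ t s a s' :=
  mul_nonneg ((μ t s).2.1 a) ((M.trans t s a).2.1 s')

lemma sum_stepWeight (M : MDP 𝒮 𝒜) (μ : Policy 𝒮 𝒜) (t : ℕ) (s : 𝒮) :
    ∑ a, ∑ s', ENNReal.ofReal (M.stepWeight μ t s a s') = 1 := by
  simp_rw [← ENNReal.ofReal_sum_of_nonneg fun s' _ => M.stepWeight_nonneg μ t s _ s']
  rw [← ENNReal.ofReal_sum_of_nonneg fun a _ => Finset.sum_nonneg fun s' _ =>
    M.stepWeight_nonneg μ t s a s']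
  have h : ∀ a, ∑ s', (M.trans t s a).1 s' = 1 := fun a => (M.trans t s a).2.2
  have h2 : ∑ a, (μ t s).1 a = 1 := (μ t s).2.2
  simp only [stepWeight, ← Finset.mul_sum, h, mul_one, h2, ENNReal.ofReal_one]

lemma chainVec_stepWeight (M : MDP 𝒮 𝒜) (μ : Policy 𝒮 𝒜) (t : ℕ) (s : 𝒮) :
    chainVec (fun s => ENNReal.ofReal (M.init.1 s))
      (fun u s a s' => ENNReal.ofReal (M.stepWeight μ u s a s')) t s =
      ENNReal.ofReal (M.toModel.stateDist μ t s) := by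
  induction t generalizing s with
  | zero => rfl
  | succ t ih =>
    simp only [chainVec, ih]
    change _ = ENNReal.ofReal
      (∑ s', ∑ a, M.toModel.occupancy μ t s' a * M.toModel.trans t s' a s)
    rw [ENNReal.ofReal_sum_of_nonneg fun s' _ => Finset.sum_nonneg fun a _ =>
      mul_nonneg (M.occupancy_nonneg μ t s' a) (M.trans_nonneg t s' a s)]
    refine Finset.sum_congr rfl fun s' _ => ?_
    rw [ENNReal.ofReal_sum_of_nonneg fun a _ =>
      mul_nonneg (M.occupancy_nonneg μ t s' a) (M.trans_nonneg t s' a s)]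
    refine Finset.sum_congr rfl fun a _ => ?_
    rw [← ENNReal.ofReal_mul (M.stateDist_nonneg μ t s')]
    simp only [stepWeight, TabularModel.occupancy, toModel, mul_assoc]

lemma ofReal_pathWeight (M : MDP 𝒮 𝒜) (μ : Policy 𝒮 𝒜) {H : ℕ} (σ : Fin (H + 1) → 𝒮)
    (α : Fin H → 𝒜) : ENNReal.ofReal (M.pathWeight μ σ α) =
      ENNReal.ofReal (M.init.1 (σ 0)) *
        ∏ t : Fin H, ENNReal.ofReal (M.stepWeight μ t (σ t.castSucc) (α t) (σ t.succ)) := by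
  rw [pathWeight, ENNReal.ofReal_mul (M.init.2.1 _),
    ENNReal.ofReal_prod_of_nonneg fun t _ => M.stepWeight_nonneg μ _ _ _ _]

lemma sum_pathWeight (M : MDP 𝒮 𝒜) (μ : Policy 𝒮 𝒜) (H : ℕ) :
    ∑ σ : Fin (H + 1) → 𝒮, ∑ α : Fin H → 𝒜, ENNReal.ofReal (M.pathWeight μ σ α) = 1 := by
  have h := sum_path_eq (fun s => ENNReal.ofReal (M.init.1 s))
    (fun u s a s' => ENNReal.ofReal (M.stepWeight μ u s a s')) H (fun _ => 1)
  simp only [mul_one] at h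
  simp_rw [ofReal_pathWeight]
  rw [h, sum_chainVec_of_le _ _ (fun u _ s => M.sum_stepWeight μ u s) (Nat.zero_le H)]
  simp only [chainVec]
  rw [← ENNReal.ofReal_sum_of_nonneg fun s _ => M.init.2.1 s]
  have : ∑ s, M.init.1 s = 1 := M.init.2.2
  rw [this, ENNReal.ofReal_one]

/-- The joint law of the state, the action and the next state at step `t`. -/
lemma sum_pathWeight_mul (M : MDP 𝒮 𝒜) (μ : Policy 𝒮 𝒜) {H : ℕ} (t : Fin H)
    (G : 𝒮 → 𝒜 → 𝒮 → ENNReal) :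
    ∑ σ : Fin (H + 1) → 𝒮, ∑ α : Fin H → 𝒜, ENNReal.ofReal (M.pathWeight μ σ α) *
        G (σ t.castSucc) (α t) (σ t.succ) =
      ∑ s, ∑ a, ∑ s', ENNReal.ofReal (M.toModel.occupancy μ t s a * M.toModel.trans t s a s') *
        G s a s' := by
  set f : ℕ → 𝒮 → 𝒜 → 𝒮 → ENNReal := fun u s a s' =>
    ENNReal.ofReal (M.stepWeight μ u s a s') * (if u = (t : ℕ) then G s a s' else 1) with hf
  have h := sum_path_eq (fun s => ENNReal.ofReal (M.init.1 s)) f H (fun _ => 1)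
  simp only [mul_one] at h
  have hpath : ∀ (σ : Fin (H + 1) → 𝒮) (α : Fin H → 𝒜), ENNReal.ofReal (M.pathWeight μ σ α) *
      G (σ t.castSucc) (α t) (σ t.succ) = ENNReal.ofReal (M.init.1 (σ 0)) *
        ∏ u : Fin H, f u (σ u.castSucc) (α u) (σ u.succ) := by
    intro σ α
    rw [ofReal_pathWeight, mul_assoc]
    congr 1
    simp only [hf, Finset.prod_mul_distrib]
    congr 1
    rw [Finset.prod_eq_single t]
    · simp
    · intro u _ hu
      rw [if_neg fun h' => hu (Fin.ext h')]
    · simp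
  simp_rw [hpath]
  rw [h, sum_chainVec_of_le _ _ (k := t + 1) _ t.isLt]
  · simp only [chainVec]
    rw [Finset.sum_comm]
    refine Finset.sum_congr rfl fun s _ => ?_
    rw [Finset.sum_comm]
    refine Finset.sum_congr rfl fun a _ => Finset.sum_congr rfl fun s' _ => ?_
    have hc : chainVec (fun s => ENNReal.ofReal (M.init.1 s)) f t s =
        ENNReal.ofReal (M.toModel.stateDist μ t s) := by
      rw [← chainVec_stepWeight]
      refine congrFun (chainVec_congr _ fun u hu => ?_) s
      ext s a s'
      simp [hf, hu.ne]
    rw [hc]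
    simp only [hf, if_true]
    rw [← mul_assoc, ← ENNReal.ofReal_mul (M.stateDist_nonneg μ t s)]
    simp only [stepWeight, TabularModel.occupancy, toModel, mul_assoc]
  · intro u hu s
    have hne : u ≠ (t : ℕ) := by omega
    simp only [hf, hne, if_false, mul_one]
    exact M.sum_stepWeight μ u s

variable [MeasurableSpace 𝒮] [MeasurableSpace 𝒜]

instance (M : MDP 𝒮 𝒜) {H : ℕ} (σ : Fin (H + 1) → 𝒮) (α : Fin H → 𝒜) :
    IsProbabilityMeasure (M.pathRewardLaw σ α) := by
  unfold pathRewardLaw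
  infer_instance

lemma lintegral_trajectoryLaw (M : MDP 𝒮 𝒜) (μ : Policy 𝒮 𝒜) {H : ℕ}
    {f : Trajectory 𝒮 𝒜 H → ENNReal} (hf : Measurable f) :
    ∫⁻ τ, f τ ∂M.trajectoryLaw μ H =
      ∑ σ : Fin (H + 1) → 𝒮, ∑ α : Fin H → 𝒜, ENNReal.ofReal (M.pathWeight μ σ α) *
        ∫⁻ r, f ((σ, α), r) ∂M.pathRewardLaw σ α := by
  rw [trajectoryLaw, lintegral_finsetSum_measure]
  refine Finset.sum_congr rfl fun σ _ => ?_
  rw [lintegral_finsetSum_measure]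
  refine Finset.sum_congr rfl fun α _ => ?_
  rw [lintegral_smul_measure, Measure.dirac_prod, lintegral_map hf (by fun_prop)]
  rfl

instance (M : MDP 𝒮 𝒜) (μ : Policy 𝒮 𝒜) (H : ℕ) :
    IsProbabilityMeasure (M.trajectoryLaw μ H) := by
  constructor
  have h := M.lintegral_trajectoryLaw μ (H := H) (f := fun _ => 1) measurable_const
  simpa [sum_pathWeight] using h

variable [DiscreteMeasurableSpace 𝒮] [DiscreteMeasurableSpace 𝒜]

lemma measurable_state {H : ℕ} (u : Fin (H + 1)) :
    Measurable fun τ : Trajectory 𝒮 𝒜 H => τ.state u :=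
  (measurable_pi_apply u).comp (measurable_fst.comp measurable_fst)

lemma measurable_action {H : ℕ} (u : Fin H) :
    Measurable fun τ : Trajectory 𝒮 𝒜 H => τ.action u :=
  (measurable_pi_apply u).comp (measurable_snd.comp measurable_fst)

lemma measurable_reward {H : ℕ} (u : Fin H) :
    Measurable fun τ : Trajectory 𝒮 𝒜 H => τ.reward u :=
  (measurable_pi_apply u).comp measurable_snd

/-- State, action, next state and reward of an episode at step `t`. -/
def step {H : ℕ} (t : Fin H) (τ : Trajectory 𝒮 𝒜 H) : (𝒮 × 𝒜 × 𝒮) × ℝ :=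
  ((τ.state t.castSucc, τ.action t, τ.state t.succ), τ.reward t)

lemma measurable_step {H : ℕ} (t : Fin H) : Measurable (step (𝒮 := 𝒮) (𝒜 := 𝒜) t) :=
  ((measurable_state _).prodMk ((measurable_action _).prodMk (measurable_state _))).prodMk
    (measurable_reward _)

/-- The law of one step of an episode. -/
lemma map_step_trajectoryLaw (M : MDP 𝒮 𝒜) (μ : Policy 𝒮 𝒜) {H : ℕ} (t : Fin H) :
    (M.trajectoryLaw μ H).map (step t) = ∑ p : 𝒮 × 𝒜 × 𝒮,
      ENNReal.ofReal (M.toModel.occupancy μ t p.1 p.2.1 * M.toModel.trans t p.1 p.2.1 p.2.2) •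
        (Measure.dirac p).prod (M.rewardLaw t p.1 p.2.1 p.2.2 : Measure ℝ) := by
  refine Measure.ext_of_lintegral _ fun f hf => ?_
  rw [lintegral_map hf (measurable_step t),
    M.lintegral_trajectoryLaw μ (f := fun τ => f (step t τ)) (hf.comp (measurable_step t)),
    lintegral_finsetSum_measure]
  have h1 : ∀ (σ : Fin (H + 1) → 𝒮) (α : Fin H → 𝒜),
      ∫⁻ r, f (step t ((σ, α), r)) ∂M.pathRewardLaw σ α =
        ∫⁻ x, f ((σ t.castSucc, α t, σ t.succ), x)
          ∂(M.rewardLaw t (σ t.castSucc) (α t) (σ t.succ) : Measure ℝ) := by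
    intro σ α
    have := measurePreserving_eval
      (fun t : Fin H => (M.rewardLaw t (σ t.castSucc) (α t) (σ t.succ) : Measure ℝ)) t
    rw [← this.lintegral_comp (f := fun x => f ((σ t.castSucc, α t, σ t.succ), x))
      (hf.comp (by fun_prop))]
    rfl
  simp_rw [h1]
  rw [M.sum_pathWeight_mul μ t fun s a s' =>
    ∫⁻ x, f ((s, a, s'), x) ∂(M.rewardLaw t s a s' : Measure ℝ)]
  simp_rw [Fintype.sum_prod_type]
  refine Finset.sum_congr rfl fun s _ => Finset.sum_congr rfl fun a _ =>
    Finset.sum_congr rfl fun s' _ => ?_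
  rw [lintegral_smul_measure, Measure.dirac_prod, lintegral_map hf (by fun_prop)]
  rfl

lemma integral_step (M : MDP 𝒮 𝒜) (μ : Policy 𝒮 𝒜) {H : ℕ} (t : Fin H)
    {g : (𝒮 × 𝒜 × 𝒮) × ℝ → ℝ} (hg : Measurable g) {b : ℝ}
    (hb : ∀ p, ∀ r ∈ Set.Icc (0 : ℝ) 1, |g (p, r)| ≤ b) :
    ∫ τ, g (step t τ) ∂M.trajectoryLaw μ H =
      ∑ s, ∑ a, ∑ s', M.toModel.occupancy μ t s a * M.toModel.trans t s a s' *
        ∫ r, g ((s, a, s'), r) ∂(M.rewardLaw t s a s' : Measure ℝ) := by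
  have hgp : ∀ p : 𝒮 × 𝒜 × 𝒮, Integrable (fun r => g (p, r))
      (M.rewardLaw t p.1 p.2.1 p.2.2 : Measure ℝ) := by
    intro p
    refine integrable_of_ae_abs_le (hg.comp (by fun_prop)) (b := b) ?_
    filter_upwards [M.reward_mem t p.1 p.2.1 p.2.2] with r hr using hb p r hr
  rw [← integral_map (measurable_step t).aemeasurable hg.aestronglyMeasurable,
    M.map_step_trajectoryLaw, integral_finsetSum_measure]
  · simp_rw [Fintype.sum_prod_type]
    refine Finset.sum_congr rfl fun s _ => Finset.sum_congr rfl fun a _ =>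
      Finset.sum_congr rfl fun s' _ => ?_
    rw [integral_smul_measure, Measure.dirac_prod,
      integral_map (by fun_prop) hg.aestronglyMeasurable, ENNReal.toReal_ofReal, smul_eq_mul]
    exact mul_nonneg (M.occupancy_nonneg _ _ _ _) (M.trans_nonneg _ _ _ _)
  · intro p _
    refine Integrable.smul_measure ?_ ENNReal.ofReal_ne_top
    rw [Measure.dirac_prod, integrable_map_measure hg.aestronglyMeasurable (by fun_prop)]
    exact hgp p

lemma ae_reward_mem (M : MDP 𝒮 𝒜) (μ : Policy 𝒮 𝒜) (H : ℕ) :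
    ∀ᵐ τ ∂M.trajectoryLaw μ H, ∀ t, τ.reward t ∈ Set.Icc (0 : ℝ) 1 := by
  rw [ae_all_iff]
  intro t
  have hms : MeasurableSet {z : (𝒮 × 𝒜 × 𝒮) × ℝ | z.2 ∈ Set.Icc (0 : ℝ) 1} :=
    measurable_snd measurableSet_Icc
  have h : ∀ᵐ z ∂(M.trajectoryLaw μ H).map (step t), z.2 ∈ Set.Icc (0 : ℝ) 1 := by
    rw [M.map_step_trajectoryLaw, ae_iff, Measure.finsetSum_apply]
    refine Finset.sum_eq_zero fun p _ => ?_
    change (_ : ENNReal) • ((Measure.dirac p).prod _) {z : (𝒮 × 𝒜 × 𝒮) × ℝ | z.2 ∈ Set.Icc (0 : ℝ) 1}ᶜ = 0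
    rw [Measure.dirac_prod, Measure.map_apply (by fun_prop) hms.compl]
    have := M.reward_mem t p.1 p.2.1 p.2.2
    rw [ae_iff] at this
    have e : Prod.mk p ⁻¹' {z : (𝒮 × 𝒜 × 𝒮) × ℝ | z.2 ∈ Set.Icc (0 : ℝ) 1}ᶜ =
      {r : ℝ | r ∉ Set.Icc (0 : ℝ) 1} := rfl
    rw [e, this, smul_zero]
  exact ae_of_ae_map (measurable_step t).aemeasurable h

end MDP

/-! ### Episodes backwards in time -/

namespace Trajectory

variable {𝒮 𝒜 : Type*} {H : ℕ}

/-- Erases the part of an episode up to step `t`: the states and actions are replaced by the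
dummies `s₀`, `a₀`, the rewards by `0`. The state at step `t + 1` is kept. -/
def future (t : Fin H) (s₀ : 𝒮) (a₀ : 𝒜) (τ : Trajectory 𝒮 𝒜 H) : Trajectory 𝒮 𝒜 H :=
  ((fun u => if (t : ℕ) < u then τ.state u else s₀,
    fun u => if (t : ℕ) < u then τ.action u else a₀),
    fun u => if (t : ℕ) < u then τ.reward u else 0)

@[simp] lemma state_future_succ (t : Fin H) (s₀ : 𝒮) (a₀ : 𝒜) (τ : Trajectory 𝒮 𝒜 H) :
    (future t s₀ a₀ τ).state t.succ = τ.state t.succ := by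
  simp [-Fin.val_fin_lt, future, state]

end Trajectory

section Crossing

variable {𝒮 𝒜 : Type*} {H : ℕ}

/-- The path that follows `p` up to step `t` and `q` from the state at step `t + 1` on. -/
def splice (t : Fin H) (p q : (Fin (H + 1) → 𝒮) × (Fin H → 𝒜)) :
    (Fin (H + 1) → 𝒮) × (Fin H → 𝒜) :=
  (fun u => if (t : ℕ) < u then q.1 u else p.1 u, fun u => if (t : ℕ) < u then q.2 u else p.2 u)

lemma splice_splice (t : Fin H) (p q : (Fin (H + 1) → 𝒮) × (Fin H → 𝒜)) :
    splice t (splice t p q) (splice t q p) = p := by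
  ext u <;> by_cases h : (t : ℕ) < u <;> simp [-Fin.val_fin_lt, splice, h]

/-- Two paths exchange what happens up to step `t`. -/
def crossing (t : Fin H) :
    ((Fin (H + 1) → 𝒮) × (Fin H → 𝒜)) × ((Fin (H + 1) → 𝒮) × (Fin H → 𝒜)) ≃
      ((Fin (H + 1) → 𝒮) × (Fin H → 𝒜)) × ((Fin (H + 1) → 𝒮) × (Fin H → 𝒜)) where
  toFun z := (splice t z.2 z.1, splice t z.1 z.2)
  invFun z := (splice t z.2 z.1, splice t z.1 z.2)
  left_inv z := by simp [-Fin.val_fin_lt, splice_splice]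
  right_inv z := by simp [-Fin.val_fin_lt, splice_splice]

end Crossing

namespace MDP

variable {𝒮 𝒜 : Type*} [Fintype 𝒮] [Fintype 𝒜] {H : ℕ}

/-- Two paths that meet at step `t + 1` can exchange their pasts. -/
lemma pathWeight_splice_mul (M : MDP 𝒮 𝒜) (μ : Policy 𝒮 𝒜) (t : Fin H)
    (p q : (Fin (H + 1) → 𝒮) × (Fin H → 𝒜)) (h : p.1 t.succ = q.1 t.succ) :
    M.pathWeight μ (splice t q p).1 (splice t q p).2 *
        M.pathWeight μ (splice t p q).1 (splice t p q).2 =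
      M.pathWeight μ p.1 p.2 * M.pathWeight μ q.1 q.2 := by
  simp only [pathWeight]
  rw [mul_mul_mul_comm, mul_mul_mul_comm (M.init.1 (p.1 0)), ← Finset.prod_mul_distrib,
    ← Finset.prod_mul_distrib]
  congr 1
  · simp [-Fin.val_fin_lt, splice, mul_comm]
  · refine Finset.prod_congr rfl fun u _ => ?_
    rcases lt_trichotomy (u : ℕ) t with hu | hu | hu
    · have h1 : ¬ (t : ℕ) < u := by omega
      have h2 : ¬ (t : ℕ) < (u : ℕ) + 1 := by omega
      simp [-Fin.val_fin_lt, splice, h1, h2, mul_comm]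
    · obtain rfl : u = t := Fin.ext hu
      simp [-Fin.val_fin_lt, splice, h, mul_comm]
    · have h2 : (t : ℕ) < (u : ℕ) + 1 := by omega
      simp [-Fin.val_fin_lt, splice, hu, h2]

variable [MeasurableSpace 𝒮] [MeasurableSpace 𝒜]

/-- The conditional mean of a function of the future given the whole path depends on the future
of the path only. -/
lemma lintegral_future_eq (M : MDP 𝒮 𝒜) (t : Fin H) (s₀ : 𝒮) (a₀ : 𝒜)
    {ψ : Trajectory 𝒮 𝒜 H → ENNReal} (hψ : Measurable ψ)
    (p q : (Fin (H + 1) → 𝒮) × (Fin H → 𝒜)) (hs : ∀ u : Fin (H + 1), (t : ℕ) < u → p.1 u = q.1 u)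
    (ha : ∀ u : Fin H, (t : ℕ) < u → p.2 u = q.2 u) :
    ∫⁻ r, ψ (Trajectory.future t s₀ a₀ (p, r)) ∂M.pathRewardLaw p.1 p.2 =
      ∫⁻ r, ψ (Trajectory.future t s₀ a₀ (q, r)) ∂M.pathRewardLaw q.1 q.2 := by
  classical
  set c : Fin H → ℝ → ℝ := fun u x => if (t : ℕ) < u then x else 0 with hc
  have hcm : ∀ u, Measurable (c u) := by
    intro u
    by_cases h : (t : ℕ) < u
    · simpa [-Fin.val_fin_lt, hc, h] using measurable_id'
    · simp [-Fin.val_fin_lt, hc, h]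
  set z : (Fin (H + 1) → 𝒮) × (Fin H → 𝒜) :=
    (fun u => if (t : ℕ) < u then p.1 u else s₀, fun u => if (t : ℕ) < u then p.2 u else a₀)
    with hz
  have key : ∀ w : (Fin (H + 1) → 𝒮) × (Fin H → 𝒜),
      (∀ u : Fin (H + 1), (t : ℕ) < u → p.1 u = w.1 u) →
      (∀ u : Fin H, (t : ℕ) < u → p.2 u = w.2 u) →
      ∫⁻ r, ψ (Trajectory.future t s₀ a₀ (w, r)) ∂M.pathRewardLaw w.1 w.2 =
        ∫⁻ r, ψ (z, r) ∂Measure.pi fun u : Fin H =>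
          ((M.rewardLaw u (p.1 u.castSucc) (p.2 u) (p.1 u.succ) : Measure ℝ).map (c u)) := by
    intro w hws hwa
    have hmap : (Measure.pi fun u : Fin H =>
        ((M.rewardLaw u (p.1 u.castSucc) (p.2 u) (p.1 u.succ) : Measure ℝ).map (c u))) =
        (M.pathRewardLaw w.1 w.2).map fun r u => c u (r u) := by
      unfold pathRewardLaw
      have : ∀ u : Fin H, IsProbabilityMeasure ((M.rewardLaw u (w.1 u.castSucc) (w.2 u)
          (w.1 u.succ) : Measure ℝ).map (c u)) := fun u =>
        Measure.isProbabilityMeasure_map (hcm u).aemeasurable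
      rw [Measure.pi_map_pi fun u => (hcm u).aemeasurable]
      congr 1
      ext1 u
      by_cases h : (t : ℕ) < u
      · rw [hws u.castSucc (by simpa using h), hwa u h, hws u.succ (by simp; omega)]
      · have : c u = fun _ => (0 : ℝ) := by
          ext x
          simp [-Fin.val_fin_lt, hc, h]
        rw [this, Measure.map_const, Measure.map_const]
        simp
    have hcm' : Measurable fun (r : Fin H → ℝ) u => c u (r u) :=
      measurable_pi_lambda _ fun u => (hcm u).comp (measurable_pi_apply u)
    rw [hmap, lintegral_map (f := fun r => ψ (z, r)) (hψ.comp measurable_prodMk_left) hcm']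
    refine lintegral_congr fun r => ?_
    congr 1
    refine Prod.ext (Prod.ext ?_ ?_) ?_
    · funext u
      by_cases h : (t : ℕ) < u <;> simp [-Fin.val_fin_lt, Trajectory.future, Trajectory.state, hz, h, hws]
    · funext u
      by_cases h : (t : ℕ) < u <;> simp [-Fin.val_fin_lt, Trajectory.future, Trajectory.action, hz, h, hwa]
    · funext u
      by_cases h : (t : ℕ) < u <;> simp [-Fin.val_fin_lt, Trajectory.future, Trajectory.reward, hc, h]
  rw [key p (fun _ _ => rfl) fun _ _ => rfl, key q hs ha]

variable [DiscreteMeasurableSpace 𝒮] [DiscreteMeasurableSpace 𝒜]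

lemma measurable_future (t : Fin H) (s₀ : 𝒮) (a₀ : 𝒜) :
    Measurable (Trajectory.future (𝒮 := 𝒮) (𝒜 := 𝒜) t s₀ a₀) := by
  refine ((measurable_pi_lambda _ fun u => ?_).prodMk
    (measurable_pi_lambda _ fun u => ?_)).prodMk (measurable_pi_lambda _ fun u => ?_)
  · by_cases h : (t : ℕ) < u
    · simpa [-Fin.val_fin_lt, h] using measurable_state u
    · simp [-Fin.val_fin_lt, h]
  · by_cases h : (t : ℕ) < u
    · simpa [-Fin.val_fin_lt, h] using measurable_action u
    · simp [-Fin.val_fin_lt, h]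
  · by_cases h : (t : ℕ) < u
    · simpa [-Fin.val_fin_lt, h] using measurable_reward u
    · simp [-Fin.val_fin_lt, h]

open Classical in
/-- Given the state `x` at step `t + 1`, the state and the action at step `t` are independent of
the future. The two sides are equal because a pair of paths that meet in `x` may exchange their
pasts. -/
lemma lintegral_past_mul_future (M : MDP 𝒮 𝒜) (μ : Policy 𝒮 𝒜) (t : Fin H) (s₀ : 𝒮) (a₀ : 𝒜)
    (ρ : 𝒮 → 𝒜 → ENNReal) {ψ : Trajectory 𝒮 𝒜 H → ENNReal} (hψ : Measurable ψ) (x : 𝒮) :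
    (∫⁻ τ, ρ (τ.state t.castSucc) (τ.action t) * (if τ.state t.succ = x then 1 else 0) *
        ψ (τ.future t s₀ a₀) ∂M.trajectoryLaw μ H) *
      (∑ s, ∑ a, ENNReal.ofReal (M.toModel.occupancy μ t s a * M.toModel.trans t s a x)) =
    (∫⁻ τ, (if τ.state t.succ = x then 1 else 0) *
        ψ (τ.future t s₀ a₀) ∂M.trajectoryLaw μ H) *
      (∑ s, ∑ a, ENNReal.ofReal (M.toModel.occupancy μ t s a * M.toModel.trans t s a x) *
        ρ s a) := by
  have hψ' : Measurable fun τ : Trajectory 𝒮 𝒜 H => ψ (τ.future t s₀ a₀) :=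
    hψ.comp (measurable_future t s₀ a₀)
  have hx : Measurable fun τ : Trajectory 𝒮 𝒜 H =>
      if τ.state t.succ = x then (1 : ENNReal) else 0 :=
    (Measurable.of_discrete (f := fun y => if y = x then (1 : ENNReal) else 0)).comp
      (measurable_state t.succ)
  have hρ : Measurable fun τ : Trajectory 𝒮 𝒜 H => ρ (τ.state t.castSucc) (τ.action t) :=
    (Measurable.of_discrete (f := fun y : 𝒮 × 𝒜 => ρ y.1 y.2)).comp
      ((measurable_state _).prodMk (measurable_action _))
  set Ψ : (Fin (H + 1) → 𝒮) × (Fin H → 𝒜) → ENNReal := fun p =>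
    ∫⁻ r, ψ (Trajectory.future t s₀ a₀ (p, r)) ∂M.pathRewardLaw p.1 p.2 with hΨ
  set W : (Fin (H + 1) → 𝒮) × (Fin H → 𝒜) → ENNReal := fun p =>
    ENNReal.ofReal (M.pathWeight μ p.1 p.2) with hW
  set X : (Fin (H + 1) → 𝒮) × (Fin H → 𝒜) → ENNReal := fun p =>
    if p.1 t.succ = x then 1 else 0 with hX
  set Y : (Fin (H + 1) → 𝒮) × (Fin H → 𝒜) → ENNReal := fun p =>
    ρ (p.1 t.castSucc) (p.2 t) with hY
  have e1 : ∫⁻ τ, ρ (τ.state t.castSucc) (τ.action t) * (if τ.state t.succ = x then 1 else 0) *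
        ψ (τ.future t s₀ a₀) ∂M.trajectoryLaw μ H = ∑ p, W p * (Y p * X p * Ψ p) := by
    have hm : Measurable fun τ : Trajectory 𝒮 𝒜 H => ρ (τ.state t.castSucc) (τ.action t) *
        (if τ.state t.succ = x then 1 else 0) * ψ (τ.future t s₀ a₀) := (hρ.mul hx).mul hψ'
    rw [M.lintegral_trajectoryLaw μ hm, Fintype.sum_prod_type]
    refine Finset.sum_congr rfl fun σ _ => Finset.sum_congr rfl fun α _ => ?_
    congr 1
    have hm' : Measurable fun r => ψ (Trajectory.future t s₀ a₀ ((σ, α), r)) :=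
      hψ'.comp measurable_prodMk_left
    exact lintegral_const_mul (Y (σ, α) * X (σ, α)) hm'
  have e2 : ∫⁻ τ, (if τ.state t.succ = x then 1 else 0) *
        ψ (τ.future t s₀ a₀) ∂M.trajectoryLaw μ H = ∑ p, W p * (X p * Ψ p) := by
    have hm : Measurable fun τ : Trajectory 𝒮 𝒜 H =>
        (if τ.state t.succ = x then 1 else 0) * ψ (τ.future t s₀ a₀) := hx.mul hψ'
    rw [M.lintegral_trajectoryLaw μ hm, Fintype.sum_prod_type]
    refine Finset.sum_congr rfl fun σ _ => Finset.sum_congr rfl fun α _ => ?_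
    congr 1
    have hm' : Measurable fun r => ψ (Trajectory.future t s₀ a₀ ((σ, α), r)) :=
      hψ'.comp measurable_prodMk_left
    exact lintegral_const_mul (X (σ, α)) hm'
  have e3 : ∑ s, ∑ a, ENNReal.ofReal (M.toModel.occupancy μ t s a * M.toModel.trans t s a x) *
        ρ s a = ∑ p, W p * (Y p * X p) := by
    rw [Fintype.sum_prod_type]
    have := M.sum_pathWeight_mul μ t fun s a s' => ρ s a * if s' = x then 1 else 0
    refine Eq.trans ?_ this.symm
    refine Finset.sum_congr rfl fun s _ => Finset.sum_congr rfl fun a _ => ?_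
    simp
  have e4 : ∑ s, ∑ a, ENNReal.ofReal (M.toModel.occupancy μ t s a * M.toModel.trans t s a x) =
      ∑ p, W p * X p := by
    rw [Fintype.sum_prod_type]
    have := M.sum_pathWeight_mul μ t fun s a s' => if s' = x then 1 else 0
    refine Eq.trans ?_ this.symm
    refine Finset.sum_congr rfl fun s _ => Finset.sum_congr rfl fun a _ => ?_
    simp
  rw [e1, e2, e3, e4, Finset.sum_mul_sum, Finset.sum_mul_sum, ← Fintype.sum_prod_type',
    ← Fintype.sum_prod_type', ← (crossing (𝒮 := 𝒮) (𝒜 := 𝒜) t).sum_comp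
      fun z => W z.1 * (X z.1 * Ψ z.1) * (W z.2 * (Y z.2 * X z.2))]
  refine Finset.sum_congr rfl fun z _ => ?_
  obtain ⟨p, q⟩ := z
  have hXp : X (splice t q p) = X p := by simp [-Fin.val_fin_lt, hX, splice]
  have hXq : X (splice t p q) = X q := by simp [-Fin.val_fin_lt, hX, splice]
  have hYp : Y (splice t p q) = Y p := by simp [-Fin.val_fin_lt, hY, splice]
  have hΨp : Ψ (splice t q p) = Ψ p :=
    M.lintegral_future_eq t s₀ a₀ hψ _ _ (fun u hu => by simp [-Fin.val_fin_lt, splice, hu])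
      (fun u hu => by simp [-Fin.val_fin_lt, splice, hu])
  change W p * (Y p * X p * Ψ p) * (W q * X q) =
    W (splice t q p) * (X (splice t q p) * Ψ (splice t q p)) *
      (W (splice t p q) * (Y (splice t p q) * X (splice t p q)))
  rw [hXp, hXq, hYp, hΨp]
  by_cases hp : p.1 t.succ = x
  · by_cases hq : q.1 t.succ = x
    · have hw : W (splice t q p) * W (splice t p q) = W p * W q := by
        have hn : ∀ p : (Fin (H + 1) → 𝒮) × (Fin H → 𝒜), 0 ≤ M.pathWeight μ p.1 p.2 := fun p =>
          mul_nonneg (M.init.2.1 _) (Finset.prod_nonneg fun u _ => M.stepWeight_nonneg _ _ _ _ _)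
        simp only [hW]
        rw [← ENNReal.ofReal_mul (hn _), ← ENNReal.ofReal_mul (hn _),
          M.pathWeight_splice_mul μ t p q (hp.trans hq.symm)]
      calc _ = W p * W q * (Y p * X p * Ψ p * X q) := by ring
        _ = W (splice t q p) * W (splice t p q) * (Y p * X p * Ψ p * X q) := by rw [hw]
        _ = _ := by ring
    · simp [-Fin.val_fin_lt, hX, hq]
  · simp [-Fin.val_fin_lt, hX, hp]

end MDP

namespace MDP

variable {𝒮 𝒜 : Type*} [Fintype 𝒮] [Fintype 𝒜] {H : ℕ}

/-- The conditional probability of the pair `(s, a)` at step `t` given the state `x` at step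
`t + 1` (`0` if `x` is not visited). -/
noncomputable def backwardProb (M : MDP 𝒮 𝒜) (μ : Policy 𝒮 𝒜) (t : ℕ) (s : 𝒮) (a : 𝒜) (x : 𝒮) :
    ℝ :=
  M.toModel.occupancy μ t s a * M.toModel.trans t s a x / M.toModel.stateDist μ (t + 1) x

lemma occupancy_mul_trans_nonneg (M : MDP 𝒮 𝒜) (μ : Policy 𝒮 𝒜) (t : ℕ) (s : 𝒮) (a : 𝒜) (x : 𝒮) :
    0 ≤ M.toModel.occupancy μ t s a * M.toModel.trans t s a x :=
  mul_nonneg (M.occupancy_nonneg μ t s a) (M.trans_nonneg t s a x)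

lemma occupancy_mul_trans_le (M : MDP 𝒮 𝒜) (μ : Policy 𝒮 𝒜) (t : ℕ) (s : 𝒮) (a : 𝒜) (x : 𝒮) :
    M.toModel.occupancy μ t s a * M.toModel.trans t s a x ≤ M.toModel.stateDist μ (t + 1) x := by
  have h0 := fun s a => M.occupancy_mul_trans_nonneg μ t s a x
  calc _ ≤ ∑ a, M.toModel.occupancy μ t s a * M.toModel.trans t s a x :=
        Finset.single_le_sum (fun a _ => h0 s a) (Finset.mem_univ a)
    _ ≤ ∑ s, ∑ a, M.toModel.occupancy μ t s a * M.toModel.trans t s a x :=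
        Finset.single_le_sum
          (f := fun s => ∑ a, M.toModel.occupancy μ t s a * M.toModel.trans t s a x)
          (fun s _ => Finset.sum_nonneg fun a _ => h0 s a) (Finset.mem_univ s)
    _ = _ := rfl

lemma backwardProb_nonneg (M : MDP 𝒮 𝒜) (μ : Policy 𝒮 𝒜) (t : ℕ) (s : 𝒮) (a : 𝒜) (x : 𝒮) :
    0 ≤ M.backwardProb μ t s a x :=
  div_nonneg (M.occupancy_mul_trans_nonneg μ t s a x) (M.stateDist_nonneg μ _ _)

lemma backwardProb_le_one (M : MDP 𝒮 𝒜) (μ : Policy 𝒮 𝒜) (t : ℕ) (s : 𝒮) (a : 𝒜) (x : 𝒮) :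
    M.backwardProb μ t s a x ≤ 1 :=
  div_le_one_of_le₀ (M.occupancy_mul_trans_le μ t s a x) (M.stateDist_nonneg μ _ _)

lemma backwardProb_mul_stateDist (M : MDP 𝒮 𝒜) (μ : Policy 𝒮 𝒜) (t : ℕ) (s : 𝒮) (a : 𝒜) (x : 𝒮) :
    M.backwardProb μ t s a x * M.toModel.stateDist μ (t + 1) x =
      M.toModel.occupancy μ t s a * M.toModel.trans t s a x := by
  rcases eq_or_ne (M.toModel.stateDist μ (t + 1) x) 0 with h | h
  · have := M.occupancy_mul_trans_le μ t s a x
    have h2 := M.occupancy_mul_trans_nonneg μ t s a x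
    rw [h, mul_zero]
    linarith
  · rw [backwardProb, div_mul_cancel₀ _ h]

lemma sum_ofReal_occupancy_mul_trans (M : MDP 𝒮 𝒜) (μ : Policy 𝒮 𝒜) (t : ℕ) (x : 𝒮) :
    ∑ s, ∑ a, ENNReal.ofReal (M.toModel.occupancy μ t s a * M.toModel.trans t s a x) =
      ENNReal.ofReal (M.toModel.stateDist μ (t + 1) x) := by
  have h0 := fun s a => M.occupancy_mul_trans_nonneg μ t s a x
  simp_rw [← ENNReal.ofReal_sum_of_nonneg fun a _ => h0 _ a]
  rw [← ENNReal.ofReal_sum_of_nonneg fun s _ => Finset.sum_nonneg fun a _ => h0 s a]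
  rfl

variable [MeasurableSpace 𝒮] [MeasurableSpace 𝒜]
variable [DiscreteMeasurableSpace 𝒮] [DiscreteMeasurableSpace 𝒜]

open Classical in
/-- A function of the pair at step `t` may be replaced by its conditional mean given the state at
step `t + 1`, under an integral against a function of the future. -/
lemma lintegral_past_eq (M : MDP 𝒮 𝒜) (μ : Policy 𝒮 𝒜) (t : Fin H) (s₀ : 𝒮) (a₀ : 𝒜)
    (ρ : 𝒮 → 𝒜 → ENNReal) (c : 𝒮 → ℝ)
    (hc : ∀ x, ∑ s, ∑ a, ENNReal.ofReal (M.toModel.occupancy μ t s a * M.toModel.trans t s a x) *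
        ρ s a = ENNReal.ofReal (c x) * ENNReal.ofReal (M.toModel.stateDist μ (t + 1) x))
    {ψ : Trajectory 𝒮 𝒜 H → ENNReal} (hψ : Measurable ψ) :
    ∫⁻ τ, ρ (τ.state t.castSucc) (τ.action t) * ψ (τ.future t s₀ a₀) ∂M.trajectoryLaw μ H =
      ∫⁻ τ, ENNReal.ofReal (c (τ.state t.succ)) * ψ (τ.future t s₀ a₀)
        ∂M.trajectoryLaw μ H := by
  have hψ' : Measurable fun τ : Trajectory 𝒮 𝒜 H => ψ (τ.future t s₀ a₀) :=
    hψ.comp (measurable_future t s₀ a₀)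
  have hx : ∀ x, Measurable fun τ : Trajectory 𝒮 𝒜 H =>
      if τ.state t.succ = x then (1 : ENNReal) else 0 := fun x =>
    (Measurable.of_discrete (f := fun y => if y = x then (1 : ENNReal) else 0)).comp
      (measurable_state t.succ)
  have hρ : Measurable fun τ : Trajectory 𝒮 𝒜 H => ρ (τ.state t.castSucc) (τ.action t) :=
    (Measurable.of_discrete (f := fun y : 𝒮 × 𝒜 => ρ y.1 y.2)).comp
      ((measurable_state _).prodMk (measurable_action _))
  have hl : ∀ τ : Trajectory 𝒮 𝒜 H, ρ (τ.state t.castSucc) (τ.action t) * ψ (τ.future t s₀ a₀) =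
      ∑ x, ρ (τ.state t.castSucc) (τ.action t) * (if τ.state t.succ = x then 1 else 0) *
        ψ (τ.future t s₀ a₀) := by
    intro τ
    simp
  have hr : ∀ τ : Trajectory 𝒮 𝒜 H,
      ENNReal.ofReal (c (τ.state t.succ)) * ψ (τ.future t s₀ a₀) =
      ∑ x, ENNReal.ofReal (c x) * ((if τ.state t.succ = x then 1 else 0) *
        ψ (τ.future t s₀ a₀)) := by
    intro τ
    simp
  have hm1 : ∀ x, Measurable fun τ : Trajectory 𝒮 𝒜 H => ρ (τ.state t.castSucc) (τ.action t) *
      (if τ.state t.succ = x then 1 else 0) * ψ (τ.future t s₀ a₀) :=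
    fun x => (hρ.mul (hx x)).mul hψ'
  have hm2 : ∀ x, Measurable fun τ : Trajectory 𝒮 𝒜 H =>
      (if τ.state t.succ = x then 1 else 0) * ψ (τ.future t s₀ a₀) := fun x => (hx x).mul hψ'
  simp_rw [hl, hr]
  rw [lintegral_finsetSum _ fun x _ => hm1 x,
    lintegral_finsetSum _ fun x _ => (hm2 x).const_mul _]
  refine Finset.sum_congr rfl fun x _ => ?_
  rw [lintegral_const_mul _ (hm2 x)]
  have hmain := M.lintegral_past_mul_future μ t s₀ a₀ ρ hψ x
  rw [hc, sum_ofReal_occupancy_mul_trans] at hmain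
  rcases eq_or_ne (ENNReal.ofReal (M.toModel.stateDist μ (t + 1) x)) 0 with h0 | h0
  · -- the state `x` is almost surely not visited at step `t + 1`
    have h1 : ∫⁻ τ, (if τ.state t.succ = x then (1 : ENNReal) else 0) ∂M.trajectoryLaw μ H = 0 := by
      have h2 := M.sum_pathWeight_mul μ t fun _ _ s' => if s' = x then 1 else 0
      simp only [mul_ite, mul_one, mul_zero, Finset.sum_ite_eq', Finset.mem_univ, if_true] at h2
      rw [sum_ofReal_occupancy_mul_trans, h0] at h2
      rw [M.lintegral_trajectoryLaw μ (hx x)]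
      refine Eq.trans ?_ h2
      refine Finset.sum_congr rfl fun σ _ => Finset.sum_congr rfl fun α _ => ?_
      by_cases h : σ t.succ = x <;> simp [Trajectory.state, h]
    rw [lintegral_eq_zero_iff (hx x)] at h1
    have e1 : ∫⁻ τ, ρ (τ.state t.castSucc) (τ.action t) *
        (if τ.state t.succ = x then 1 else 0) * ψ (τ.future t s₀ a₀) ∂M.trajectoryLaw μ H = 0 := by
      rw [lintegral_eq_zero_iff (hm1 x)]
      filter_upwards [h1] with τ hτ
      simp only [Pi.zero_apply] at hτ ⊢
      rw [hτ]
      simp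
    have e2 : ∫⁻ τ, (if τ.state t.succ = x then 1 else 0) * ψ (τ.future t s₀ a₀)
        ∂M.trajectoryLaw μ H = 0 := by
      rw [lintegral_eq_zero_iff (hm2 x)]
      filter_upwards [h1] with τ hτ
      simp only [Pi.zero_apply] at hτ ⊢
      rw [hτ]
      simp
    rw [e1, e2, mul_zero]
  · rw [← mul_assoc] at hmain
    rw [(ENNReal.mul_left_inj h0 ENNReal.ofReal_ne_top).1 hmain, mul_comm]

/-- The uniform distribution on `(0, 1]`, used to simulate a Bernoulli variable. -/
noncomputable def unifMeasure : Measure ℝ := volume.restrict (Set.Ioc (0 : ℝ) 1)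

instance : IsProbabilityMeasure unifMeasure := ⟨by simp [unifMeasure]⟩

lemma lintegral_unif {q : ℝ} (h0 : 0 ≤ q) (h1 : q ≤ 1) (φ : Bool → ENNReal) :
    ∫⁻ u, φ (decide (u ≤ q)) ∂unifMeasure =
      ENNReal.ofReal q * φ true + ENNReal.ofReal (1 - q) * φ false := by
  rw [← lintegral_add_compl _ (measurableSet_Iic (a := q))]
  have e1 : ∫⁻ u in Set.Iic q, φ (decide (u ≤ q)) ∂unifMeasure =
      ∫⁻ _ in Set.Iic q, φ true ∂unifMeasure :=
    setLIntegral_congr_fun measurableSet_Iic fun u hu => by simp [Set.mem_Iic.1 hu]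
  have e2 : ∫⁻ u in (Set.Iic q)ᶜ, φ (decide (u ≤ q)) ∂unifMeasure =
      ∫⁻ _ in (Set.Iic q)ᶜ, φ false ∂unifMeasure :=
    setLIntegral_congr_fun measurableSet_Iic.compl fun u hu => by
      have : ¬ u ≤ q := hu
      simp [this]
  have m1 : unifMeasure (Set.Iic q) = ENNReal.ofReal q := by
    rw [unifMeasure, Measure.restrict_apply measurableSet_Iic]
    have : Set.Iic q ∩ Set.Ioc 0 1 = Set.Ioc 0 q := by
      ext u; simp only [Set.mem_inter_iff, Set.mem_Iic, Set.mem_Ioc]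
      constructor
      · rintro ⟨h, h', -⟩; exact ⟨h', h⟩
      · rintro ⟨h, h'⟩; exact ⟨h', h, h'.trans h1⟩
    rw [this, Real.volume_Ioc, sub_zero]
  have m2 : unifMeasure (Set.Iic q)ᶜ = ENNReal.ofReal (1 - q) := by
    rw [unifMeasure, Measure.restrict_apply measurableSet_Iic.compl]
    have : (Set.Iic q)ᶜ ∩ Set.Ioc 0 1 = Set.Ioc q 1 := by
      ext u; simp only [Set.mem_inter_iff, Set.compl_Iic, Set.mem_Ioi, Set.mem_Ioc]
      constructor
      · rintro ⟨h, -, h'⟩; exact ⟨h, h'⟩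
      · rintro ⟨h, h'⟩; exact ⟨h, h0.trans_lt h, h'⟩
    rw [this, Real.volume_Ioc]
  rw [e1, e2, lintegral_const, lintegral_const, Measure.restrict_apply_univ,
    Measure.restrict_apply_univ, m1, m2, mul_comm, mul_comm (φ false)]

open Classical in
/-- Whether an episode visits the pair `(s, a)` at step `t`. -/
noncomputable def inRow (t : Fin H) (s : 𝒮) (a : 𝒜) (τ : Trajectory 𝒮 𝒜 H) : Bool :=
  decide (τ.state t.castSucc = s ∧ τ.action t = a)

lemma measurable_inRow (t : Fin H) (s : 𝒮) (a : 𝒜) :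
    Measurable (inRow (H := H) t s a) := by
  classical
  exact (Measurable.of_discrete (f := fun y : 𝒮 × 𝒜 => decide (y.1 = s ∧ y.2 = a))).comp
    ((measurable_state _).prodMk (measurable_action _))

/-- Simulation of an episode backwards: given the future, the visit of the pair `(s, a)` at step
`t` is a Bernoulli variable with parameter `backwardProb`. -/
lemma map_inRow_future (M : MDP 𝒮 𝒜) (μ : Policy 𝒮 𝒜) (t : Fin H) (s : 𝒮) (a : 𝒜) :
    (M.trajectoryLaw μ H).map (fun τ => (inRow t s a τ, τ.future t s a)) =
      ((M.trajectoryLaw μ H).prod unifMeasure).map fun z =>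
        (decide (z.2 ≤ M.backwardProb μ t s a (z.1.state t.succ)), z.1.future t s a) := by
  classical
  have hq : Measurable fun τ : Trajectory 𝒮 𝒜 H => M.backwardProb μ t s a (τ.state t.succ) :=
    (Measurable.of_discrete (f := M.backwardProb μ t s a)).comp (measurable_state t.succ)
  have hmeas : Measurable fun z : Trajectory 𝒮 𝒜 H × ℝ =>
      (decide (z.2 ≤ M.backwardProb μ t s a (z.1.state t.succ)), z.1.future t s a) := by
    refine Measurable.prodMk ?_ ((measurable_future t s a).comp measurable_fst)
    refine measurable_to_bool ?_
    simpa [Set.preimage] using measurableSet_le measurable_snd (hq.comp measurable_fst)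
  refine Measure.ext_of_lintegral _ fun f hf => ?_
  rw [lintegral_map hf ((measurable_inRow t s a).prodMk (measurable_future t s a)),
    lintegral_map hf hmeas]
  have hfm : Measurable fun z : Trajectory 𝒮 𝒜 H × ℝ =>
      f (decide (z.2 ≤ M.backwardProb μ t s a (z.1.state t.succ)), z.1.future t s a) :=
    hf.comp hmeas
  rw [lintegral_prod _ hfm.aemeasurable]
  have hR : ∀ τ : Trajectory 𝒮 𝒜 H, ∫⁻ u, f (decide (u ≤ M.backwardProb μ t s a (τ.state t.succ)),
      τ.future t s a) ∂unifMeasure =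
      ENNReal.ofReal (M.backwardProb μ t s a (τ.state t.succ)) * f (true, τ.future t s a) +
      ENNReal.ofReal (1 - M.backwardProb μ t s a (τ.state t.succ)) * f (false, τ.future t s a) :=
    fun τ => lintegral_unif (M.backwardProb_nonneg _ _ _ _ _) (M.backwardProb_le_one _ _ _ _ _)
      fun b => f (b, τ.future t s a)
  simp_rw [hR]
  have hf' : ∀ b, Measurable fun τ : Trajectory 𝒮 𝒜 H => f (b, τ) := fun b =>
    hf.comp measurable_prodMk_left
  have hf1 : ∀ b, Measurable fun τ : Trajectory 𝒮 𝒜 H => f (b, τ.future t s a) := fun b =>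
    (hf' b).comp (measurable_future t s a)
  have hL : ∀ τ : Trajectory 𝒮 𝒜 H, f (inRow t s a τ, τ.future t s a) =
      (if τ.state t.castSucc = s ∧ τ.action t = a then 1 else 0) * f (true, τ.future t s a) +
      (if τ.state t.castSucc = s ∧ τ.action t = a then 0 else 1) * f (false, τ.future t s a) := by
    intro τ
    by_cases h : τ.state t.castSucc = s ∧ τ.action t = a <;> simp [inRow, h]
  have hcond : Measurable fun τ : Trajectory 𝒮 𝒜 H =>
      (if τ.state t.castSucc = s ∧ τ.action t = a then (1 : ENNReal) else 0) :=
    (Measurable.of_discrete (f := fun y : 𝒮 × 𝒜 => if y.1 = s ∧ y.2 = a then (1 : ENNReal)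
      else 0)).comp ((measurable_state _).prodMk (measurable_action _))
  simp_rw [hL]
  have hm1 : Measurable fun τ : Trajectory 𝒮 𝒜 H =>
      (if τ.state t.castSucc = s ∧ τ.action t = a then (1 : ENNReal) else 0) *
        f (true, τ.future t s a) := hcond.mul (hf1 true)
  have hm2 : Measurable fun τ : Trajectory 𝒮 𝒜 H =>
      ENNReal.ofReal (M.backwardProb μ t s a (τ.state t.succ)) * f (true, τ.future t s a) :=
    hq.ennreal_ofReal.mul (hf1 true)
  rw [lintegral_add_left hm1, lintegral_add_left hm2]
  have hsum : ∀ (x : 𝒮), ∑ s', ∑ a', ENNReal.ofReal (M.toModel.occupancy μ t s' a' *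
      M.toModel.trans t s' a' x) * (if s' = s ∧ a' = a then 1 else 0) =
      ENNReal.ofReal (M.toModel.occupancy μ t s a * M.toModel.trans t s a x) := by
    intro x
    rw [Finset.sum_eq_single s, Finset.sum_eq_single a] <;> simp +contextual
  congr 1
  · refine M.lintegral_past_eq μ t s a (fun s' a' => if s' = s ∧ a' = a then 1 else 0)
      (M.backwardProb μ t s a) (fun x => ?_) (hf' true)
    rw [hsum, ← ENNReal.ofReal_mul (M.backwardProb_nonneg _ _ _ _ _),
      M.backwardProb_mul_stateDist]
  · refine M.lintegral_past_eq μ t s a (fun s' a' => if s' = s ∧ a' = a then 0 else 1)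
      (fun x => 1 - M.backwardProb μ t s a x) (fun x => ?_) (hf' false)
    rw [← ENNReal.ofReal_mul (by linarith [M.backwardProb_le_one μ t s a x]), sub_mul, one_mul,
      M.backwardProb_mul_stateDist, ENNReal.ofReal_sub _ (M.occupancy_mul_trans_nonneg _ _ _ _ _),
      ← sum_ofReal_occupancy_mul_trans, ← hsum]
    refine ENNReal.eq_sub_of_add_eq ?_ ?_
    · rw [hsum]
      exact ENNReal.ofReal_ne_top
    · simp_rw [← Finset.sum_add_distrib, ← mul_add]
      refine Finset.sum_congr rfl fun s' _ => Finset.sum_congr rfl fun a' _ => ?_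
      by_cases h : s' = s ∧ a' = a <;> simp [h]

/-- Bernstein's inequality backwards in time. The function `V` depends on the data after step
`t` only; given these data the visits of `(s, a)` at step `t` are independent, although `V` and
the empirical transition weights at step `t` are not. -/
theorem backward_bernstein (M : MDP 𝒮 𝒜) (μ : Policy 𝒮 𝒜) {n : ℕ} (t : Fin H) (s : 𝒮) (a : 𝒜)
    {V : (Fin n → Trajectory 𝒮 𝒜 H) → 𝒮 → ℝ} (hV : ∀ y, Measurable fun D => V D y) {b : ℝ}
    (hb : 0 < b) (hVb : ∀ D y, |V D y| ≤ b)
    (hVf : ∀ D, V (fun i => (D i).future t s a) = V D) {x : ℝ} (hx : 0 < x) :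
    (Measure.pi fun _ : Fin n => M.trajectoryLaw μ H) {D |
        2 * √((∑ i, M.backwardProb μ t s a ((D i).state t.succ) * V D ((D i).state t.succ) ^ 2) * x)
          + 2 * b * x < |∑ i, ((if inRow t s a (D i) then 1 else 0) -
            M.backwardProb μ t s a ((D i).state t.succ)) * V D ((D i).state t.succ)|}
      ≤ 2 * ENNReal.ofReal (Real.exp (-x)) := by
  classical
  set ν := M.trajectoryLaw μ H with hν
  set q : 𝒮 → ℝ := M.backwardProb μ t s a with hq
  -- the event, expressed by the visits and the futures of the episodes
  set E : Set (Fin n → Bool × Trajectory 𝒮 𝒜 H) := {z |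
    2 * √((∑ i, q ((z i).2.state t.succ) * V (fun i => (z i).2) ((z i).2.state t.succ) ^ 2) * x)
      + 2 * b * x < |∑ i, ((if (z i).1 then 1 else 0) - q ((z i).2.state t.succ)) *
        V (fun i => (z i).2) ((z i).2.state t.succ)|} with hE
  have hsm : ∀ i, Measurable fun z : Fin n → Bool × Trajectory 𝒮 𝒜 H =>
      (z i).2.state t.succ := fun i =>
    (measurable_state t.succ).comp (measurable_snd.comp (measurable_pi_apply i))
  have hqm : ∀ i, Measurable fun z : Fin n → Bool × Trajectory 𝒮 𝒜 H =>
      q ((z i).2.state t.succ) := fun i => (Measurable.of_discrete (f := q)).comp (hsm i)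
  have hbm : ∀ i, Measurable fun z : Fin n → Bool × Trajectory 𝒮 𝒜 H =>
      (if (z i).1 then (1 : ℝ) else 0) := fun i =>
    (Measurable.of_discrete (f := fun y : Bool => if y then (1 : ℝ) else 0)).comp
      (measurable_fst.comp (measurable_pi_apply i))
  have hVm : ∀ i, Measurable fun z : Fin n → Bool × Trajectory 𝒮 𝒜 H =>
      V (fun i => (z i).2) ((z i).2.state t.succ) := by
    intro i
    have h1 : Measurable fun p : (Fin n → Trajectory 𝒮 𝒜 H) × 𝒮 => V p.1 p.2 :=
      measurable_from_prod_countable_left hV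
    exact h1.comp ((measurable_pi_lambda _ fun j =>
      measurable_snd.comp (measurable_pi_apply j)).prodMk (hsm i))
  have hEm : MeasurableSet E := by
    refine measurableSet_lt ?_ ?_
    · exact ((((Finset.measurable_sum _ fun i _ =>
        (hqm i).mul ((hVm i).pow_const 2)).mul_const x).sqrt).const_mul 2).add_const _
    · exact (Finset.measurable_sum _ fun i _ => ((hbm i).sub (hqm i)).mul (hVm i)).abs
  have hg₁ : Measurable fun τ : Trajectory 𝒮 𝒜 H => (inRow t s a τ, τ.future t s a) :=
    (measurable_inRow t s a).prodMk (measurable_future t s a)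
  have hg₂ : Measurable fun z : Trajectory 𝒮 𝒜 H × ℝ =>
      (decide (z.2 ≤ q (z.1.state t.succ)), z.1.future t s a) := by
    refine Measurable.prodMk ?_ ((measurable_future t s a).comp measurable_fst)
    refine measurable_to_bool ?_
    simpa [Set.preimage] using measurableSet_le measurable_snd
      (((Measurable.of_discrete (f := q)).comp (measurable_state t.succ)).comp measurable_fst)
  have hmap := M.map_inRow_future μ t s a
  rw [← hν, ← hq] at hmap
  have : IsProbabilityMeasure (ν.map fun τ => (inRow t s a τ, τ.future t s a)) :=
    Measure.isProbabilityMeasure_map hg₁.aemeasurable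
  have : IsProbabilityMeasure ((ν.prod unifMeasure).map fun z =>
      (decide (z.2 ≤ q (z.1.state t.succ)), z.1.future t s a)) :=
    Measure.isProbabilityMeasure_map hg₂.aemeasurable
  have hG₁ : Measurable fun (D : Fin n → Trajectory 𝒮 𝒜 H) i =>
      (inRow t s a (D i), (D i).future t s a) :=
    measurable_pi_lambda _ fun i => hg₁.comp (measurable_pi_apply i)
  have hG₂ : Measurable fun (z : Fin n → Trajectory 𝒮 𝒜 H × ℝ) i =>
      (decide ((z i).2 ≤ q ((z i).1.state t.succ)), (z i).1.future t s a) :=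
    measurable_pi_lambda _ fun i => hg₂.comp (measurable_pi_apply i)
  have hsplit := measurePreserving_arrowProdEquivProdArrow (Trajectory 𝒮 𝒜 H) ℝ (Fin n)
    (fun _ => ν) (fun _ => unifMeasure)
  -- the same event after the visits have been simulated by uniform variables `w.2`
  set F : Set ((Fin n → Trajectory 𝒮 𝒜 H) × (Fin n → ℝ)) := {w |
    2 * √((∑ i, q ((w.1 i).state t.succ) * V w.1 ((w.1 i).state t.succ) ^ 2) * x)
      + 2 * b * x < |∑ i, ((if w.2 i ≤ q ((w.1 i).state t.succ) then 1 else 0) -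
        q ((w.1 i).state t.succ)) * V w.1 ((w.1 i).state t.succ)|} with hF
  have hpre₁ : (fun (D : Fin n → Trajectory 𝒮 𝒜 H) i =>
      (inRow t s a (D i), (D i).future t s a)) ⁻¹' E = {D |
        2 * √((∑ i, q ((D i).state t.succ) * V D ((D i).state t.succ) ^ 2) * x)
          + 2 * b * x < |∑ i, ((if inRow t s a (D i) then 1 else 0) -
            q ((D i).state t.succ)) * V D ((D i).state t.succ)|} := by
    ext D
    simp [hE, hVf D]
  have hpre₂ : (fun (z : Fin n → Trajectory 𝒮 𝒜 H × ℝ) i =>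
      (decide ((z i).2 ≤ q ((z i).1.state t.succ)), (z i).1.future t s a)) ⁻¹' E =
      MeasurableEquiv.arrowProdEquivProdArrow (Trajectory 𝒮 𝒜 H) ℝ (Fin n) ⁻¹' F := by
    ext z
    have := hVf fun i => (z i).1
    simp [hE, hF, this, MeasurableEquiv.arrowProdEquivProdArrow, Equiv.arrowProdEquivProdArrow]
  have hFm : MeasurableSet F := by
    rw [← MeasurableEquiv.measurableSet_preimage
      (MeasurableEquiv.arrowProdEquivProdArrow (Trajectory 𝒮 𝒜 H) ℝ (Fin n)), ← hpre₂]
    exact hG₂ hEm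
  rw [← hpre₁, ← Measure.map_apply hG₁ hEm, Measure.pi_map_pi fun _ => hg₁.aemeasurable]
  simp_rw [hmap]
  rw [← Measure.pi_map_pi fun _ => hg₂.aemeasurable, Measure.map_apply hG₂ hEm, hpre₂,
    hsplit.measure_preimage hFm.nullMeasurableSet, Measure.prod_apply hFm]
  -- Bernstein's inequality for the uniform variables, with the episodes fixed
  calc _ ≤ ∫⁻ _, 2 * ENNReal.ofReal (Real.exp (-x)) ∂(Measure.pi fun _ : Fin n => ν) := by
        refine lintegral_mono fun D => ?_
        set f : Fin n → ℝ → ℝ := fun i u =>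
          ((if u ≤ q ((D i).state t.succ) then 1 else 0) - q ((D i).state t.succ)) *
            V D ((D i).state t.succ) with hf
        have hq0 : ∀ y, 0 ≤ q y := M.backwardProb_nonneg μ t s a
        have hq1 : ∀ y, q y ≤ 1 := M.backwardProb_le_one μ t s a
        have hind : ∀ i, Measurable fun u : ℝ =>
            (if u ≤ q ((D i).state t.succ) then (1 : ℝ) else 0) := fun i =>
          Measurable.ite measurableSet_Iic measurable_const measurable_const
        have hfm : ∀ i, Measurable (f i) := fun i => ((hind i).sub_const _).mul_const _
        have habs : ∀ i u, |(if u ≤ q ((D i).state t.succ) then (1 : ℝ) else 0) -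
            q ((D i).state t.succ)| ≤ 1 := by
          intro i u
          have h0 := hq0 ((D i).state t.succ)
          have h1 := hq1 ((D i).state t.succ)
          split_ifs <;> rw [abs_le] <;> constructor <;> linarith
        have hmean : ∀ i, ∫ u, (if u ≤ q ((D i).state t.succ) then (1 : ℝ) else 0) ∂unifMeasure =
            q ((D i).state t.succ) := by
          intro i
          rw [integral_eq_lintegral_of_nonneg_ae (ae_of_all _ fun u => by split_ifs <;> norm_num)
            (hind i).aestronglyMeasurable]
          have := lintegral_unif (hq0 ((D i).state t.succ)) (hq1 ((D i).state t.succ))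
            fun b => if b then 1 else 0
          simp only [decide_eq_true_eq, if_true, mul_one, Bool.false_eq_true, if_false, mul_zero,
            add_zero] at this
          have e : ∀ u : ℝ, ENNReal.ofReal (if u ≤ q ((D i).state t.succ) then (1 : ℝ) else 0) =
              if u ≤ q ((D i).state t.succ) then 1 else 0 := by
            intro u; split_ifs <;> simp
          simp_rw [e]
          rw [this, ENNReal.toReal_ofReal (hq0 _)]
        have hint : ∀ i, Integrable (fun u : ℝ =>
            (if u ≤ q ((D i).state t.succ) then (1 : ℝ) else 0)) unifMeasure := fun i =>
          integrable_of_ae_abs_le (hind i) (b := 1)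
            (ae_of_all _ fun u => by split_ifs <;> simp)
        refine bernstein_pi (fun _ : Fin n => unifMeasure) (f := f) hfm hb
          (fun i => ae_of_all _ fun u => ?_) (fun i => ?_)
          (v := fun i => q ((D i).state t.succ) * V D ((D i).state t.succ) ^ 2) (fun i => ?_) hx
        · rw [hf, abs_mul]
          calc _ ≤ 1 * b := mul_le_mul (habs i u) (hVb D _) (abs_nonneg _) zero_le_one
            _ = b := one_mul b
        · simp only [hf]
          rw [integral_mul_const, integral_sub (hint i) (integrable_const _), hmean i]
          simp
        · simp only [hf, mul_pow]
          rw [integral_mul_const]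
          refine mul_le_mul_of_nonneg_right ?_ (sq_nonneg _)
          have e : ∀ u : ℝ, ((if u ≤ q ((D i).state t.succ) then (1 : ℝ) else 0) -
              q ((D i).state t.succ)) ^ 2 = (1 - 2 * q ((D i).state t.succ)) *
              (if u ≤ q ((D i).state t.succ) then (1 : ℝ) else 0) + q ((D i).state t.succ) ^ 2 := by
            intro u
            split_ifs <;> ring
          simp_rw [e]
          rw [integral_add ((hint i).const_mul _) (integrable_const _), integral_const_mul, hmean]
          simp only [integral_const, probReal_univ, smul_eq_mul, one_mul]
          nlinarith [sq_nonneg (q ((D i).state t.succ))]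
    _ = _ := by simp

end MDP

/-! ### The empirical model -/

section EmpiricalModel

variable {𝒮 𝒜 : Type*} {H n : ℕ}

lemma mem_visits {D : Fin n → Trajectory 𝒮 𝒜 H} {t : Fin H} {s : 𝒮} {a : 𝒜} {i : Fin n} :
    i ∈ visits D t s a ↔ MDP.inRow t s a (D i) = true := by
  simp [visits, MDP.inRow]

lemma sum_visits (D : Fin n → Trajectory 𝒮 𝒜 H) (t : Fin H) (s : 𝒮) (a : 𝒜) (g : Fin n → ℝ) :
    ∑ i ∈ visits D t s a, g i = ∑ i, (if MDP.inRow t s a (D i) then 1 else 0) * g i := by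
  have h : visits D t s a = Finset.univ.filter fun i => MDP.inRow t s a (D i) = true := by
    ext i
    simp [mem_visits]
  rw [h, Finset.sum_filter]
  exact Finset.sum_congr rfl fun i _ => by split_ifs <;> simp

lemma card_visits (D : Fin n → Trajectory 𝒮 𝒜 H) (t : Fin H) (s : 𝒮) (a : 𝒜) :
    ((visits D t s a).card : ℝ) = ∑ i, (if MDP.inRow t s a (D i) then 1 else 0) := by
  have := sum_visits D t s a fun _ => 1
  simpa using this

open Classical in
lemma empiricalModel_trans (D : Fin n → Trajectory 𝒮 𝒜 H) (t : Fin H) (s : 𝒮) (a : 𝒜) (s' : 𝒮) :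
    (empiricalModel D).trans t s a s' =
      (∑ i ∈ visits D t s a, if (D i).state t.succ = s' then (1 : ℝ) else 0) /
        (visits D t s a).card := by
  simp only [empiricalModel, t.isLt, dite_true, Finset.sum_boole]

lemma empiricalModel_reward (D : Fin n → Trajectory 𝒮 𝒜 H) (t : Fin H) (s : 𝒮) (a : 𝒜) :
    (empiricalModel D).reward t s a =
      (∑ i ∈ visits D t s a, (D i).reward t) / (visits D t s a).card := by
  simp [empiricalModel, t.isLt]

open Classical in
lemma empiricalModel_init (D : Fin n → Trajectory 𝒮 𝒜 H) (s : 𝒮) :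
    (empiricalModel D).init s = (∑ i, if (D i).state 0 = s then (1 : ℝ) else 0) / n := by
  simp [empiricalModel, Finset.sum_boole]

lemma visits_future (D : Fin n → Trajectory 𝒮 𝒜 H) {t u : Fin H} (h : t < u) (s₀ s : 𝒮)
    (a₀ a : 𝒜) : visits (fun i => (D i).future t s₀ a₀) u s a = visits D u s a := by
  have h' : (t : ℕ) < u := h
  ext i
  have h1 : ((D i).future t s₀ a₀).state u.castSucc = (D i).state u.castSucc := by
    simp [-Fin.val_fin_lt, Trajectory.future, Trajectory.state, h']
  have h2 : ((D i).future t s₀ a₀).action u = (D i).action u := by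
    simp [-Fin.val_fin_lt, Trajectory.future, Trajectory.action, h']
  rw [mem_visits, mem_visits, MDP.inRow, MDP.inRow, h1, h2]

lemma empiricalModel_trans_future (D : Fin n → Trajectory 𝒮 𝒜 H) (t : Fin H) {u : ℕ}
    (h : (t : ℕ) < u) (s₀ : 𝒮) (a₀ : 𝒜) :
    (empiricalModel fun i => (D i).future t s₀ a₀).trans u = (empiricalModel D).trans u := by
  classical
  ext s a s'
  by_cases hu : u < H
  · have h1 := empiricalModel_trans (fun i => (D i).future t s₀ a₀) ⟨u, hu⟩ s a s'
    have h2 := empiricalModel_trans D ⟨u, hu⟩ s a s'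
    simp only at h1 h2
    rw [h1, h2, visits_future D (u := ⟨u, hu⟩) h]
    congr 1
    refine Finset.sum_congr rfl fun i _ => ?_
    have h' : (t : ℕ) < u + 1 := by omega
    have : ((D i).future t s₀ a₀).state (Fin.succ ⟨u, hu⟩) = (D i).state (Fin.succ ⟨u, hu⟩) := by
      simp [Trajectory.future, Trajectory.state, h']
    rw [this]
  · simp [empiricalModel, hu]

lemma empiricalModel_reward_future (D : Fin n → Trajectory 𝒮 𝒜 H) (t : Fin H) {u : ℕ}
    (h : (t : ℕ) < u) (s₀ : 𝒮) (a₀ : 𝒜) :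
    (empiricalModel fun i => (D i).future t s₀ a₀).reward u = (empiricalModel D).reward u := by
  ext s a
  by_cases hu : u < H
  · have h1 := empiricalModel_reward (fun i => (D i).future t s₀ a₀) ⟨u, hu⟩ s a
    have h2 := empiricalModel_reward D ⟨u, hu⟩ s a
    simp only at h1 h2
    rw [h1, h2, visits_future D (u := ⟨u, hu⟩) h]
    congr 1
    refine Finset.sum_congr rfl fun i _ => ?_
    simp [-Fin.val_fin_lt, Trajectory.future, Trajectory.reward, h]
  · simp [empiricalModel, hu]

lemma empiricalModel_trans_nonneg (D : Fin n → Trajectory 𝒮 𝒜 H) (t : ℕ) (s : 𝒮) (a : 𝒜)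
    (s' : 𝒮) : 0 ≤ (empiricalModel D).trans t s a s' := by
  simp only [empiricalModel]
  split_ifs <;> positivity

lemma empiricalModel_init_nonneg (D : Fin n → Trajectory 𝒮 𝒜 H) (s : 𝒮) :
    0 ≤ (empiricalModel D).init s := by
  simp only [empiricalModel]
  positivity

variable [Fintype 𝒮]

/-- The sum of a function of the next state over the visits of a pair, in terms of the empirical
transition weights. -/
lemma sum_visits_next (D : Fin n → Trajectory 𝒮 𝒜 H) (t : Fin H) (s : 𝒮) (a : 𝒜) (f : 𝒮 → ℝ) :
    ∑ i ∈ visits D t s a, f ((D i).state t.succ) =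
      (visits D t s a).card * ∑ s', (empiricalModel D).trans t s a s' * f s' := by
  classical
  rcases (visits D t s a).eq_empty_or_nonempty with h | h
  · simp [h]
  have hc : ((visits D t s a).card : ℝ) ≠ 0 := by
    exact_mod_cast h.card_pos.ne'
  simp_rw [empiricalModel_trans, Finset.mul_sum, Finset.sum_div, Finset.sum_mul, Finset.mul_sum]
  rw [Finset.sum_comm]
  refine Finset.sum_congr rfl fun i _ => ?_
  rw [Finset.sum_eq_single ((D i).state t.succ)]
  · simp
    field_simp
  · intro s' _ hs'
    simp [hs'.symm]
  · simp

lemma sum_visits_reward (D : Fin n → Trajectory 𝒮 𝒜 H) (t : Fin H) (s : 𝒮) (a : 𝒜) :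
    ∑ i ∈ visits D t s a, (D i).reward t =
      (visits D t s a).card * (empiricalModel D).reward t s a := by
  rw [empiricalModel_reward]
  rcases (visits D t s a).eq_empty_or_nonempty with h | h
  · simp [h]
  have hc : ((visits D t s a).card : ℝ) ≠ 0 := by
    exact_mod_cast h.card_pos.ne'
  field_simp

lemma sum_empiricalModel_trans {D : Fin n → Trajectory 𝒮 𝒜 H} {t : Fin H} {s : 𝒮} {a : 𝒜}
    (h : 0 < ((visits D t s a).card : ℝ)) : ∑ s', (empiricalModel D).trans t s a s' = 1 := by
  have := sum_visits_next D t s a fun _ => 1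
  simp only [Finset.sum_const, nsmul_eq_mul, mul_one] at this
  exact (mul_left_cancel₀ h.ne' (by rw [mul_one]; exact this)).symm

lemma empiricalModel_isSubstochastic [Fintype 𝒜] {D : Fin n → Trajectory 𝒮 𝒜 H}
    (hr : ∀ i t, (D i).reward t ∈ Set.Icc (0 : ℝ) 1) : (empiricalModel D).IsSubstochastic where
  trans_nonneg := empiricalModel_trans_nonneg D
  sum_trans_le t s a := by
    by_cases ht : t < H
    · rcases (Nat.cast_nonneg (α := ℝ) (visits D ⟨t, ht⟩ s a).card).eq_or_lt with h | h
      · simp [empiricalModel, ht, ← h]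
      · exact (sum_empiricalModel_trans h).le
    · simp [empiricalModel, ht]
  reward_nonneg t s a := by
    by_cases ht : t < H
    · have := empiricalModel_reward D ⟨t, ht⟩ s a
      simp only at this
      rw [this]
      exact div_nonneg (Finset.sum_nonneg fun i _ => (hr i _).1) (Nat.cast_nonneg _)
    · simp [empiricalModel, ht]
  reward_le t s a := by
    by_cases ht : t < H
    · have := empiricalModel_reward D ⟨t, ht⟩ s a
      simp only at this
      rw [this]
      refine div_le_one_of_le₀ ?_ (Nat.cast_nonneg _)
      calc _ ≤ ∑ i ∈ visits D ⟨t, ht⟩ s a, (1 : ℝ) := Finset.sum_le_sum fun i _ => (hr i _).2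
        _ = _ := by simp
    · simp [empiricalModel, ht]

variable [Fintype 𝒜] [MeasurableSpace 𝒮] [MeasurableSpace 𝒜]
variable [DiscreteMeasurableSpace 𝒮] [DiscreteMeasurableSpace 𝒜]

lemma measurable_sum_visits (t : Fin H) (s : 𝒮) (a : 𝒜) {g : Trajectory 𝒮 𝒜 H → ℝ}
    (hg : Measurable g) :
    Measurable fun D : Fin n → Trajectory 𝒮 𝒜 H => ∑ i ∈ visits D t s a, g (D i) := by
  simp_rw [sum_visits]
  refine Finset.measurable_sum _ fun i _ => Measurable.mul ?_ (hg.comp (measurable_pi_apply i))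
  exact (Measurable.of_discrete (f := fun y : Bool => if y then (1 : ℝ) else 0)).comp
    ((MDP.measurable_inRow t s a).comp (measurable_pi_apply i))

lemma measurable_card_visits (t : Fin H) (s : 𝒮) (a : 𝒜) :
    Measurable fun D : Fin n → Trajectory 𝒮 𝒜 H => ((visits D t s a).card : ℝ) := by
  have := measurable_sum_visits (n := n) t s a (measurable_const (a := (1 : ℝ)))
  simpa using this

lemma measurable_empiricalModel_trans (t : ℕ) (s : 𝒮) (a : 𝒜) (s' : 𝒮) :
    Measurable fun D : Fin n → Trajectory 𝒮 𝒜 H => (empiricalModel D).trans t s a s' := by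
  classical
  by_cases ht : t < H
  · have h := fun D : Fin n → Trajectory 𝒮 𝒜 H => empiricalModel_trans D ⟨t, ht⟩ s a s'
    simp only at h
    simp_rw [h]
    refine (measurable_sum_visits ⟨t, ht⟩ s a (g := fun τ =>
      if τ.state (Fin.succ ⟨t, ht⟩) = s' then (1 : ℝ) else 0) ?_).div
      (measurable_card_visits ⟨t, ht⟩ s a)
    exact (Measurable.of_discrete (f := fun y => if y = s' then (1 : ℝ) else 0)).comp
      (MDP.measurable_state _)
  · simp [empiricalModel, ht]

lemma measurable_empiricalModel_reward (t : ℕ) (s : 𝒮) (a : 𝒜) :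
    Measurable fun D : Fin n → Trajectory 𝒮 𝒜 H => (empiricalModel D).reward t s a := by
  by_cases ht : t < H
  · have h := fun D : Fin n → Trajectory 𝒮 𝒜 H => empiricalModel_reward D ⟨t, ht⟩ s a
    simp only at h
    simp_rw [h]
    exact (measurable_sum_visits ⟨t, ht⟩ s a (MDP.measurable_reward _)).div
      (measurable_card_visits ⟨t, ht⟩ s a)
  · simp [empiricalModel, ht]

lemma measurable_optimalToGo (k t : ℕ) (s : 𝒮) :
    Measurable fun D : Fin n → Trajectory 𝒮 𝒜 H => (empiricalModel D).optimalToGo k t s := by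
  induction k generalizing t s with
  | zero => simp [TabularModel.optimalToGo]
  | succ k ih =>
    simp only [TabularModel.optimalToGo]
    exact Measurable.iSup fun a => (measurable_empiricalModel_reward t s a).add
      (Finset.measurable_sum _ fun s' _ => (measurable_empiricalModel_trans t s a s').mul (ih _ _))

lemma measurable_valueToGo (π : Policy 𝒮 𝒜) (k t : ℕ) (s : 𝒮) :
    Measurable fun D : Fin n → Trajectory 𝒮 𝒜 H => (empiricalModel D).valueToGo π k t s := by
  induction k generalizing t s with
  | zero => simp [TabularModel.valueToGo]
  | succ k ih =>
    simp only [TabularModel.valueToGo]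
    exact Finset.measurable_sum _ fun a _ => ((measurable_empiricalModel_reward t s a).add
      (Finset.measurable_sum _ fun s' _ =>
        (measurable_empiricalModel_trans t s a s').mul (ih _ _))).const_mul _

end EmpiricalModel

/-! ### Facts about the true model -/

namespace MDP

variable {𝒮 𝒜 : Type*} [Fintype 𝒮] [Fintype 𝒜]

lemma integral_reward_mem (M : MDP 𝒮 𝒜) (t : ℕ) (s : 𝒮) (a : 𝒜) (s' : 𝒮) :
    ∫ r, r ∂(M.rewardLaw t s a s' : Measure ℝ) ∈ Set.Icc (0 : ℝ) 1 := by
  have h := M.reward_mem t s a s'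
  have hint : Integrable (fun r : ℝ => r) (M.rewardLaw t s a s' : Measure ℝ) := by
    refine integrable_of_ae_abs_le measurable_id' (b := 1) ?_
    filter_upwards [h] with r hr
    rw [abs_of_nonneg hr.1]
    exact hr.2
  constructor
  · refine integral_nonneg_of_ae ?_
    filter_upwards [h] with r hr using hr.1
  · calc _ ≤ ∫ _, (1 : ℝ) ∂(M.rewardLaw t s a s' : Measure ℝ) := by
          refine integral_mono_ae hint (integrable_const _) ?_
          filter_upwards [h] with r hr using hr.2
      _ = 1 := by simp

lemma toModel_isSubstochastic (M : MDP 𝒮 𝒜) : M.toModel.IsSubstochastic where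
  trans_nonneg := M.trans_nonneg
  sum_trans_le t s a := (M.sum_trans t s a).le
  reward_nonneg t s a := Finset.sum_nonneg fun s' _ =>
    mul_nonneg (M.trans_nonneg t s a s') (M.integral_reward_mem t s a s').1
  reward_le t s a := sum_mul_le_of_le (M.trans_nonneg t s a) (M.sum_trans t s a).le zero_le_one
    fun s' => (M.integral_reward_mem t s a s').2

lemma value_nonneg (M : MDP 𝒮 𝒜) (H : ℕ) (π : Policy 𝒮 𝒜) : 0 ≤ M.toModel.value H π := by
  rw [TabularModel.value_eq_sum_init]
  exact Finset.sum_nonneg fun s _ => mul_nonneg (M.init.2.1 s)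
    (M.toModel_isSubstochastic.valueFunction_nonneg H π 0 s)

lemma value_le (M : MDP 𝒮 𝒜) (H : ℕ) (π : Policy 𝒮 𝒜) : M.toModel.value H π ≤ H := by
  rw [TabularModel.value_eq_sum_init]
  exact sum_mul_le_of_le M.init.2.1 M.init.2.2.le (Nat.cast_nonneg H)
    (M.toModel_isSubstochastic.valueFunction_le H π 0)

lemma finite_setOf_occupancy (M : MDP 𝒮 𝒜) (H : ℕ) (μ : Policy 𝒮 𝒜) :
    {x : ℝ | 0 < x ∧ ∃ t < H, ∃ s a, M.toModel.occupancy μ t s a = x}.Finite := by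
  refine (Set.finite_range fun z : Fin H × 𝒮 × 𝒜 =>
    M.toModel.occupancy μ z.1 z.2.1 z.2.2).subset ?_
  rintro x ⟨-, t, ht, s, a, h⟩
  exact ⟨(⟨t, ht⟩, s, a), h⟩

lemma minOccupancy_le (M : MDP 𝒮 𝒜) {H : ℕ} (μ : Policy 𝒮 𝒜) {t : ℕ} (ht : t < H) {s : 𝒮} {a : 𝒜}
    (h : 0 < M.toModel.occupancy μ t s a) :
    M.toModel.minOccupancy H μ ≤ M.toModel.occupancy μ t s a :=
  csInf_le (M.finite_setOf_occupancy H μ).bddBelow ⟨h, t, ht, s, a, rfl⟩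

lemma minOccupancy_pos (M : MDP 𝒮 𝒜) {H : ℕ} (hH : 0 < H) (μ : Policy 𝒮 𝒜) :
    0 < M.toModel.minOccupancy H μ := by
  have hne : {x : ℝ | 0 < x ∧ ∃ t < H, ∃ s a, M.toModel.occupancy μ t s a = x}.Nonempty := by
    have h1 : ∑ s, ∑ a, M.toModel.occupancy μ 0 s a = 1 := by
      simp only [TabularModel.sum_occupancy, sum_stateDist]
    have h2 : ∑ s, ∑ a, M.toModel.occupancy μ 0 s a ≠ 0 := by rw [h1]; exact one_ne_zero
    obtain ⟨s, -, hs⟩ := Finset.exists_ne_zero_of_sum_ne_zero h2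
    obtain ⟨a, -, ha⟩ := Finset.exists_ne_zero_of_sum_ne_zero hs
    exact ⟨_, lt_of_le_of_ne (M.occupancy_nonneg μ 0 s a) ha.symm, 0, hH, s, a, rfl⟩
  exact (hne.csInf_mem (M.finite_setOf_occupancy H μ)).1

lemma minOccupancy_le_stateDist (M : MDP 𝒮 𝒜) {H : ℕ} (μ : Policy 𝒮 𝒜) {t : ℕ} (ht : t < H) {s : 𝒮}
    (h : 0 < M.toModel.stateDist μ t s) :
    M.toModel.minOccupancy H μ ≤ M.toModel.stateDist μ t s := by
  rw [← TabularModel.sum_occupancy] at h ⊢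
  obtain ⟨a, -, ha⟩ := Finset.exists_ne_zero_of_sum_ne_zero h.ne'
  exact (M.minOccupancy_le μ ht (lt_of_le_of_ne (M.occupancy_nonneg μ t s a) ha.symm)).trans
    (Finset.single_le_sum (fun a _ => M.occupancy_nonneg μ t s a) (Finset.mem_univ a))

lemma occupancy_pos_of_isExploratory (M : MDP 𝒮 𝒜) {H : ℕ} {μ π : Policy 𝒮 𝒜}
    (hμ : M.toModel.IsExploratory H μ) {t : ℕ} (ht : t < H) {s : 𝒮} {a : 𝒜}
    (h : 0 < M.toModel.occupancy π t s a) : 0 < M.toModel.occupancy μ t s a := by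
  refine hμ t ht s ⟨π, ?_⟩ a
  rw [← TabularModel.sum_occupancy]
  exact lt_of_lt_of_le h
    (Finset.single_le_sum (fun a _ => M.occupancy_nonneg π t s a) (Finset.mem_univ a))

end MDP

/-! ### Concentration of the empirical quantities -/

namespace MDP

variable {𝒮 𝒜 : Type*} [Fintype 𝒮] [Fintype 𝒜] {H n : ℕ}
variable [MeasurableSpace 𝒮] [MeasurableSpace 𝒜]
variable [DiscreteMeasurableSpace 𝒮] [DiscreteMeasurableSpace 𝒜]

/-- The law of `n` independent episodes. -/
noncomputable def dataLaw (M : MDP 𝒮 𝒜) (μ : Policy 𝒮 𝒜) (H n : ℕ) :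
    Measure (Fin n → Trajectory 𝒮 𝒜 H) :=
  Measure.pi fun _ => M.trajectoryLaw μ H

/-- Bernstein's inequality for the sum over the episodes of a centred function of step `t`. -/
lemma dataLaw_step_le (M : MDP 𝒮 𝒜) (μ : Policy 𝒮 𝒜) (t : Fin H)
    {g : (𝒮 × 𝒜 × 𝒮) × ℝ → ℝ} (hg : Measurable g)
    (hb : ∀ p, ∀ r ∈ Set.Icc (0 : ℝ) 1, |g (p, r)| ≤ 1)
    (hmean : ∑ s, ∑ a, ∑ s', M.toModel.occupancy μ t s a * M.toModel.trans t s a s' *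
        ∫ r, g ((s, a, s'), r) ∂(M.rewardLaw t s a s' : Measure ℝ) = 0) {v : ℝ}
    (hv : ∑ s, ∑ a, ∑ s', M.toModel.occupancy μ t s a * M.toModel.trans t s a s' *
        ∫ r, g ((s, a, s'), r) ^ 2 ∂(M.rewardLaw t s a s' : Measure ℝ) ≤ v) {x : ℝ} (hx : 0 < x) :
    M.dataLaw μ H n {D | 2 * √(n * v * x) + 2 * x < |∑ i, g (step t (D i))|} ≤
      2 * ENNReal.ofReal (Real.exp (-x)) := by
  have h := bernstein_pi (fun _ : Fin n => M.trajectoryLaw μ H)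
    (f := fun _ τ => g (step t τ)) (fun _ => hg.comp (measurable_step t)) one_pos
    (fun _ => ?_) (fun _ => ?_) (v := fun _ => v) (fun _ => ?_) hx
  · simpa [dataLaw] using h
  · filter_upwards [M.ae_reward_mem μ H] with τ hτ using hb _ _ (hτ t)
  · rw [M.integral_step μ t hg hb, hmean]
  · rw [M.integral_step μ t (hg.pow_const 2) (b := 1)]
    · exact hv
    · intro p r hr
      rw [abs_pow]
      exact pow_le_one₀ (abs_nonneg _) (hb p r hr)

/-- Concentration of the sum over the visits of a pair of a function that is centred given the
pair. -/
lemma dataLaw_visits_le (M : MDP 𝒮 𝒜) (μ : Policy 𝒮 𝒜) (t : Fin H) (s : 𝒮) (a : 𝒜)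
    {h : 𝒮 → ℝ → ℝ} (hm : ∀ y, Measurable (h y))
    (hb : ∀ y, ∀ r ∈ Set.Icc (0 : ℝ) 1, |h y r| ≤ 1)
    (hmean : ∑ s', M.toModel.trans t s a s' *
        ∫ r, h s' r ∂(M.rewardLaw t s a s' : Measure ℝ) = 0) {w : ℝ}
    (hw : ∑ s', M.toModel.trans t s a s' *
        ∫ r, h s' r ^ 2 ∂(M.rewardLaw t s a s' : Measure ℝ) ≤ w) {x : ℝ} (hx : 0 < x) :
    M.dataLaw μ H n {D | 2 * √(n * (M.toModel.occupancy μ t s a * w) * x) + 2 * x <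
        |∑ i ∈ visits D t s a, h ((D i).state t.succ) ((D i).reward t)|} ≤
      2 * ENNReal.ofReal (Real.exp (-x)) := by
  classical
  set k : 𝒮 → 𝒜 → ℝ := fun s₁ a₁ => if s₁ = s ∧ a₁ = a then 1 else 0 with hk
  have hk0 : ∀ s₁ a₁, ¬ (s₁ = s ∧ a₁ = a) → k s₁ a₁ = 0 := fun s₁ a₁ h' => if_neg h'
  have hk1 : k s a = 1 := if_pos ⟨rfl, rfl⟩
  set g : (𝒮 × 𝒜 × 𝒮) × ℝ → ℝ := fun z => k z.1.1 z.1.2.1 * h z.1.2.2 z.2 with hg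
  have hsum : ∀ D : Fin n → Trajectory 𝒮 𝒜 H,
      ∑ i ∈ visits D t s a, h ((D i).state t.succ) ((D i).reward t) =
        ∑ i, g (step t (D i)) := by
    intro D
    rw [sum_visits]
    refine Finset.sum_congr rfl fun i _ => ?_
    simp [hg, hk, step, inRow]
  have hgm : Measurable g := by
    refine measurable_from_prod_countable_right fun p => ?_
    exact (hm p.2.2).const_mul (k p.1 p.2.1)
  have hpick : ∀ G : 𝒮 → 𝒜 → 𝒮 → ℝ, (∀ s₁ a₁ s', ¬ (s₁ = s ∧ a₁ = a) → G s₁ a₁ s' = 0) →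
      ∑ s₁, ∑ a₁, ∑ s', M.toModel.occupancy μ t s₁ a₁ *
        M.toModel.trans t s₁ a₁ s' * G s₁ a₁ s' =
      M.toModel.occupancy μ t s a * ∑ s', M.toModel.trans t s a s' * G s a s' := by
    intro G hG
    rw [Finset.sum_eq_single s, Finset.sum_eq_single a]
    · simp [Finset.mul_sum, mul_assoc]
    · intro b _ hb
      refine Finset.sum_eq_zero fun s' _ => ?_
      rw [hG _ _ _ fun h' => hb h'.2, mul_zero]
    · simp
    · intro b _ hb
      refine Finset.sum_eq_zero fun a₁ _ => Finset.sum_eq_zero fun s' _ => ?_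
      rw [hG _ _ _ fun h' => hb h'.1, mul_zero]
    · simp
  simp_rw [hsum]
  refine M.dataLaw_step_le μ t hgm ?_ ?_ ?_ hx
  · intro p r hr
    by_cases hp : p.1 = s ∧ p.2.1 = a
    · simp only [hg]
      rw [hp.1, hp.2, hk1, one_mul]
      exact hb _ r hr
    · simp only [hg]
      rw [hk0 _ _ hp]
      simp
  · rw [hpick]
    · simp only [hg, hk1, one_mul, hmean, mul_zero]
    · intro s₁ a₁ s' h'
      simp [hg, hk0 _ _ h']
  · rw [hpick]
    · simp only [hg, hk1, one_mul]
      exact mul_le_mul_of_nonneg_left hw (M.occupancy_nonneg μ t s a)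
    · intro s₁ a₁ s' h'
      simp [hg, hk0 _ _ h']

lemma dataLaw_visits_next_le (M : MDP 𝒮 𝒜) (μ : Policy 𝒮 𝒜) (t : Fin H) (s : 𝒮) (a : 𝒜)
    {f : 𝒮 → ℝ} (h0 : ∀ y, 0 ≤ f y) (h1 : ∀ y, f y ≤ 1) {w : ℝ}
    (hw : ∑ s', M.toModel.trans t s a s' * f s' ≤ w) {x : ℝ} (hx : 0 < x) :
    M.dataLaw μ H n {D | 2 * √(n * (M.toModel.occupancy μ t s a * w) * x) + 2 * x <
        |∑ i ∈ visits D t s a,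
          (f ((D i).state t.succ) - ∑ s', M.toModel.trans t s a s' * f s')|} ≤
      2 * ENNReal.ofReal (Real.exp (-x)) := by
  have hp0 := M.trans_nonneg t s a
  have hp1 := M.sum_trans t s a
  set c := ∑ s', M.toModel.trans t s a s' * f s' with hc
  have hc0 : 0 ≤ c := Finset.sum_nonneg fun s' _ => mul_nonneg (hp0 s') (h0 s')
  have hc1 : c ≤ 1 := sum_mul_le_of_le hp0 hp1.le zero_le_one h1
  refine M.dataLaw_visits_le μ t s a (h := fun y _ => f y - c) (fun y => measurable_const)
    ?_ ?_ ?_ hx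
  · intro y r _
    rw [abs_le]
    constructor <;> linarith [h0 y, h1 y]
  · simp only [integral_const, probReal_univ, smul_eq_mul, one_mul, mul_sub,
      Finset.sum_sub_distrib]
    rw [← Finset.sum_mul, hp1, ← hc]
    ring
  · simp only [integral_const, probReal_univ, smul_eq_mul, one_mul]
    have e : ∑ s', M.toModel.trans t s a s' * (f s' - c) ^ 2 =
        wvar (M.toModel.trans t s a) f := rfl
    rw [e, wvar_eq hp1]
    have h2 : ∑ s', M.toModel.trans t s a s' * f s' ^ 2 ≤
        ∑ s', M.toModel.trans t s a s' * f s' := by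
      refine Finset.sum_le_sum fun s' _ => mul_le_mul_of_nonneg_left ?_ (hp0 s')
      nlinarith [h0 s', h1 s']
    nlinarith [sq_nonneg (∑ s', M.toModel.trans t s a s' * f s')]

lemma dataLaw_visits_reward_le (M : MDP 𝒮 𝒜) (μ : Policy 𝒮 𝒜) (t : Fin H) (s : 𝒮) (a : 𝒜)
    {x : ℝ} (hx : 0 < x) :
    M.dataLaw μ H n {D | 2 * √(n * (M.toModel.occupancy μ t s a * 1) * x) + 2 * x <
        |∑ i ∈ visits D t s a, ((D i).reward t - M.toModel.reward t s a)|} ≤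
      2 * ENNReal.ofReal (Real.exp (-x)) := by
  have hp0 := M.trans_nonneg t s a
  have hp1 := M.sum_trans t s a
  have hr0 := M.toModel_isSubstochastic.reward_nonneg t s a
  have hr1 := M.toModel_isSubstochastic.reward_le t s a
  set c := M.toModel.reward t s a with hc
  have hb : ∀ r ∈ Set.Icc (0 : ℝ) 1, |r - c| ≤ 1 := by
    intro r hr
    rw [abs_le]
    constructor <;> linarith [hr.1, hr.2]
  have hint : ∀ s', Integrable (fun r : ℝ => r) (M.rewardLaw t s a s' : Measure ℝ) := by
    intro s'
    refine integrable_of_ae_abs_le measurable_id' (b := 1) ?_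
    filter_upwards [M.reward_mem t s a s'] with r hr
    rw [abs_of_nonneg hr.1]
    exact hr.2
  refine M.dataLaw_visits_le μ t s a (h := fun _ r => r - c) (fun y => by fun_prop)
    (fun _ r hr => hb r hr) ?_ ?_ hx
  · have e : ∀ s', ∫ r, (r - c) ∂(M.rewardLaw t s a s' : Measure ℝ) =
        ∫ r, r ∂(M.rewardLaw t s a s' : Measure ℝ) - c := by
      intro s'
      rw [integral_sub (hint s') (integrable_const _)]
      simp
    simp only [e, mul_sub, Finset.sum_sub_distrib, ← Finset.sum_mul, hp1]
    rw [one_mul, sub_eq_zero, hc]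
    rfl
  · refine sum_mul_le_of_le hp0 hp1.le zero_le_one fun s' => ?_
    calc _ ≤ ∫ _, (1 : ℝ) ∂(M.rewardLaw t s a s' : Measure ℝ) := by
          refine integral_mono_of_nonneg (ae_of_all _ fun r => sq_nonneg _)
            (integrable_const _) ?_
          filter_upwards [M.reward_mem t s a s'] with r hr
          rw [← sq_abs]
          exact pow_le_one₀ (abs_nonneg _) (hb r hr)
      _ = 1 := by simp

lemma sum_occupancy_mul_trans (M : MDP 𝒮 𝒜) (μ : Policy 𝒮 𝒜) (t : ℕ) (f : 𝒮 → 𝒜 → ℝ) :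
    ∑ s, ∑ a, ∑ s', M.toModel.occupancy μ t s a * M.toModel.trans t s a s' * f s a =
      ∑ s, ∑ a, M.toModel.occupancy μ t s a * f s a := by
  refine Finset.sum_congr rfl fun s _ => Finset.sum_congr rfl fun a _ => ?_
  rw [← Finset.sum_mul, ← Finset.mul_sum, M.sum_trans, mul_one]

/-- Concentration of the number of episodes whose pair at step `t` lies in the set with
indicator function `k`. -/
lemma dataLaw_count_le (M : MDP 𝒮 𝒜) (μ : Policy 𝒮 𝒜) (t : Fin H) {k : 𝒮 → 𝒜 → ℝ}
    (hk : ∀ s a, k s a = 0 ∨ k s a = 1) {q : ℝ}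
    (hq : ∑ s, ∑ a, M.toModel.occupancy μ t s a * k s a = q) {x : ℝ} (hx : 0 < x) :
    M.dataLaw μ H n {D | 2 * √(n * q * x) + 2 * x <
        |∑ i, k ((D i).state t.castSucc) ((D i).action t) - n * q|} ≤
      2 * ENNReal.ofReal (Real.exp (-x)) := by
  have hk0 : ∀ s a, 0 ≤ k s a := fun s a => by rcases hk s a with h | h <;> simp [h]
  have hk1 : ∀ s a, k s a ≤ 1 := fun s a => by rcases hk s a with h | h <;> simp [h]
  have hocc : ∑ s, ∑ a, M.toModel.occupancy μ t s a = 1 := by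
    simp_rw [TabularModel.sum_occupancy, M.sum_stateDist]
  have hq0 : 0 ≤ q := hq ▸ Finset.sum_nonneg fun s _ => Finset.sum_nonneg fun a _ =>
    mul_nonneg (M.occupancy_nonneg μ t s a) (hk0 s a)
  have hq1 : q ≤ 1 := by
    rw [← hq, ← hocc]
    exact Finset.sum_le_sum fun s _ => Finset.sum_le_sum fun a _ =>
      mul_le_of_le_one_right (M.occupancy_nonneg μ t s a) (hk1 s a)
  have hsum : ∀ D : Fin n → Trajectory 𝒮 𝒜 H,
      ∑ i, k ((D i).state t.castSucc) ((D i).action t) - n * q =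
        ∑ i, (fun z : (𝒮 × 𝒜 × 𝒮) × ℝ => k z.1.1 z.1.2.1 - q) (step t (D i)) := by
    intro D
    simp [step]
  simp_rw [hsum]
  refine M.dataLaw_step_le μ t (g := fun z => k z.1.1 z.1.2.1 - q) ?_ ?_ ?_ ?_ hx
  · refine measurable_from_prod_countable_right fun p => ?_
    exact (measurable_const : Measurable fun _ : ℝ => k p.1 p.2.1 - q)
  · intro p r _
    rw [abs_le]
    constructor <;> linarith [hk0 p.1 p.2.1, hk1 p.1 p.2.1]
  · simp only [integral_const, probReal_univ, smul_eq_mul, one_mul]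
    rw [M.sum_occupancy_mul_trans μ t fun s a => k s a - q]
    simp only [mul_sub, Finset.sum_sub_distrib, ← Finset.sum_mul]
    rw [hq, hocc]
    ring
  · simp only [integral_const, probReal_univ, smul_eq_mul, one_mul]
    rw [M.sum_occupancy_mul_trans μ t fun s a => (k s a - q) ^ 2]
    have e : ∀ s a, M.toModel.occupancy μ t s a * (k s a - q) ^ 2 =
        M.toModel.occupancy μ t s a * k s a * (1 - 2 * q) +
          M.toModel.occupancy μ t s a * q ^ 2 := by
      intro s a
      rcases hk s a with h | h <;> rw [h] <;> ring
    simp only [e, Finset.sum_add_distrib, ← Finset.sum_mul]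
    rw [hq, hocc]
    nlinarith

lemma dataLaw_card_visits_le (M : MDP 𝒮 𝒜) (μ : Policy 𝒮 𝒜) (t : Fin H) (s : 𝒮) (a : 𝒜)
    {x : ℝ} (hx : 0 < x) :
    M.dataLaw μ H n {D | 2 * √(n * M.toModel.occupancy μ t s a * x) + 2 * x <
        |((visits D t s a).card : ℝ) - n * M.toModel.occupancy μ t s a|} ≤
      2 * ENNReal.ofReal (Real.exp (-x)) := by
  classical
  have h := M.dataLaw_count_le (n := n) μ t
    (k := fun s₁ a₁ => if s₁ = s ∧ a₁ = a then 1 else 0)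
    (fun s₁ a₁ => by split_ifs <;> simp) (q := M.toModel.occupancy μ t s a) ?_ hx
  · simp_rw [card_visits]
    simpa [inRow] using h
  · simp [ite_and]

open Classical in
lemma dataLaw_state_le (M : MDP 𝒮 𝒜) (μ : Policy 𝒮 𝒜) (t : Fin H) (s : 𝒮) {x : ℝ} (hx : 0 < x) :
    M.dataLaw μ H n {D | 2 * √(n * M.toModel.stateDist μ t s * x) + 2 * x <
        |(∑ i, if (D i).state t.castSucc = s then (1 : ℝ) else 0) -
          n * M.toModel.stateDist μ t s|} ≤
      2 * ENNReal.ofReal (Real.exp (-x)) := by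
  refine M.dataLaw_count_le (n := n) μ t (k := fun s₁ _ => if s₁ = s then 1 else 0)
    (fun s₁ a₁ => by split_ifs <;> simp) (q := M.toModel.stateDist μ t s) ?_ hx
  simp_rw [← Finset.sum_mul, TabularModel.sum_occupancy]
  simp

/-- The conclusion of the backward Bernstein inequality for a function `W` of the next state. -/
def BackwardBound (M : MDP 𝒮 𝒜) (μ : Policy 𝒮 𝒜) (x : ℝ) (D : Fin n → Trajectory 𝒮 𝒜 H)
    (t : Fin H) (s : 𝒮) (a : 𝒜) (W : 𝒮 → ℝ) : Prop :=
  |∑ i, ((if inRow t s a (D i) then 1 else 0) - M.backwardProb μ t s a ((D i).state t.succ)) *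
      (W ((D i).state t.succ) - ∑ s', M.toModel.trans t s a s' * W s')| ≤
    2 * √((∑ i, M.backwardProb μ t s a ((D i).state t.succ) *
      (W ((D i).state t.succ) - ∑ s', M.toModel.trans t s a s' * W s') ^ 2) * x) + 2 * H * x

lemma dataLaw_backwardBound_le (M : MDP 𝒮 𝒜) (μ : Policy 𝒮 𝒜) (hH : 0 < H) (t : Fin H) (s : 𝒮)
    (a : 𝒜) {W : (Fin n → Trajectory 𝒮 𝒜 H) → 𝒮 → ℝ} (hW : ∀ y, Measurable fun D => W D y)
    (hW0 : ∀ D : Fin n → Trajectory 𝒮 𝒜 H, (∀ i t, (D i).reward t ∈ Set.Icc (0 : ℝ) 1) →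
      ∀ y, W D y ∈ Set.Icc (0 : ℝ) H)
    (hWf : ∀ D, W (fun i => (D i).future t s a) = W D) {x : ℝ} (hx : 0 < x) :
    M.dataLaw μ H n {D | (∀ i t, (D i).reward t ∈ Set.Icc (0 : ℝ) 1) ∧
      ¬ M.BackwardBound μ x D t s a (W D)} ≤ 2 * ENNReal.ofReal (Real.exp (-x)) := by
  have hH' : (0 : ℝ) < H := by exact_mod_cast hH
  -- `W` is clipped, since it is bounded for almost all data only
  set C : (Fin n → Trajectory 𝒮 𝒜 H) → 𝒮 → ℝ := fun D y => max 0 (min H (W D y)) with hC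
  have hC0 : ∀ D y, 0 ≤ C D y := fun D y => le_max_left _ _
  have hCH : ∀ D y, C D y ≤ H := fun D y => max_le hH'.le (min_le_left _ _)
  have hp0 := M.trans_nonneg t s a
  have hp1 := M.sum_trans t s a
  have h := M.backward_bernstein μ t s a (n := n)
    (V := fun D y => C D y - ∑ s', M.toModel.trans t s a s' * C D s') ?_ hH' ?_ ?_ hx
  · refine (measure_mono ?_).trans h
    rintro D ⟨hr, hD⟩
    have hCW : C D = W D := by
      funext y
      have := hW0 D hr y
      simp only [hC]
      rw [min_eq_right this.2, max_eq_right this.1]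
    rw [Set.mem_ofPred_eq, hCW]
    exact not_le.1 hD
  · intro y
    have hCm : ∀ y, Measurable fun D => C D y := fun y =>
      measurable_const.max (measurable_const.min (hW y))
    exact (hCm y).sub (Finset.measurable_sum _ fun s' _ => (hCm s').const_mul _)
  · intro D y
    have h1 : 0 ≤ ∑ s', M.toModel.trans t s a s' * C D s' :=
      Finset.sum_nonneg fun s' _ => mul_nonneg (hp0 s') (hC0 D s')
    have h2 : ∑ s', M.toModel.trans t s a s' * C D s' ≤ H :=
      sum_mul_le_of_le hp0 hp1.le hH'.le (hCH D)
    rw [abs_le]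
    constructor <;> linarith [hC0 D y, hCH D y]
  · intro D
    simp only [hC, hWf]

end MDP

/-! ### Bounds on the rows of the empirical model -/

namespace MDP

variable {𝒮 𝒜 : Type*} [Fintype 𝒮] [Fintype 𝒜] {H n : ℕ}

open Classical in
/-- The deviation bounds, at level `x`, that hold with high probability for the data collected
with the policy `μ`. The two backward bounds concern the optimal value function of the empirical
model and the empirical value function of the fixed policy `π`; both are functions of the data
after the step in question. -/
structure GoodData (M : MDP 𝒮 𝒜) (μ π : Policy 𝒮 𝒜) (x : ℝ) (D : Fin n → Trajectory 𝒮 𝒜 H) :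
    Prop where
  reward_mem : ∀ i t, (D i).reward t ∈ Set.Icc (0 : ℝ) 1
  init_pos : ∀ i, 0 < M.init.1 ((D i).state 0)
  state : ∀ (t : Fin H) s, |(∑ i, if (D i).state t.castSucc = s then (1 : ℝ) else 0) -
    n * M.toModel.stateDist μ t s| ≤ 2 * √(n * M.toModel.stateDist μ t s * x) + 2 * x
  card : ∀ (t : Fin H) s a, |((visits D t s a).card : ℝ) - n * M.toModel.occupancy μ t s a| ≤
    2 * √(n * M.toModel.occupancy μ t s a * x) + 2 * x
  next : ∀ (t : Fin H) s a s', |∑ i ∈ visits D t s a,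
      ((if (D i).state t.succ = s' then 1 else 0) - M.toModel.trans t s a s')| ≤
    2 * √(n * (M.toModel.occupancy μ t s a * M.toModel.trans t s a s') * x) + 2 * x
  reward : ∀ (t : Fin H) s a, |∑ i ∈ visits D t s a,
      ((D i).reward t - M.toModel.reward t s a)| ≤
    2 * √(n * (M.toModel.occupancy μ t s a * 1) * x) + 2 * x
  backward_optimal : ∀ (t : Fin H) s a, M.BackwardBound μ x D t s a
    ((empiricalModel D).optimalToGo (H - (t + 1)) (t + 1))
  backward_policy : ∀ (t : Fin H) s a, M.BackwardBound μ x D t s a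
    ((empiricalModel D).valueToGo π (H - (t + 1)) (t + 1))

/-- The deviation bounds for the empirical probabilities of all sets of next states. -/
def SubsetBound (M : MDP 𝒮 𝒜) (μ : Policy 𝒮 𝒜) (x : ℝ) (D : Fin n → Trajectory 𝒮 𝒜 H) : Prop :=
  ∀ (t : Fin H) s a (k : 𝒮 → Bool), |∑ i ∈ visits D t s a,
      ((if k ((D i).state t.succ) then 1 else 0) -
        ∑ s', M.toModel.trans t s a s' * if k s' then 1 else 0)| ≤
    2 * √(n * (M.toModel.occupancy μ t s a * 1) * x) + 2 * x

/-- A Bernstein bound for a count of mean `m ≥ N₀` is a relative bound. -/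
lemma count_bound {N m N₀ ε : ℝ} (hN₀ : 0 ≤ N₀) (hm : N₀ ≤ m) (hε : 0 ≤ ε) (hε' : ε ≤ 1 / 25)
    (h : |N - m| ≤ 2 * √(m * (ε ^ 2 * N₀)) + 2 * (ε ^ 2 * N₀)) : |N - m| ≤ 4 * ε * m := by
  have hm0 : 0 ≤ m := hN₀.trans hm
  have h1 : √(m * (ε ^ 2 * N₀)) ≤ ε * m := by
    refine Real.sqrt_le_iff.2 ⟨by positivity, ?_⟩
    nlinarith [mul_le_mul_of_nonneg_left hm (mul_nonneg hm0 (sq_nonneg ε))]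
  have h2 : ε ^ 2 * N₀ ≤ ε * m := by
    nlinarith [mul_le_mul_of_nonneg_left hm (sq_nonneg ε), mul_nonneg hε hm0]
  linarith

/-- A Bernstein bound for the sum of `N ≥ m / 2` deviations with mean `y`, normalised. -/
lemma mean_bound {N m N₀ ε w y : ℝ} (hN₀ : 0 < N₀) (hm : N₀ ≤ m) (hε : 0 ≤ ε) (hN : m / 2 ≤ N)
    (hw : 0 ≤ w) (h : |N * y| ≤ 2 * √(m * w * (ε ^ 2 * N₀)) + 2 * (ε ^ 2 * N₀)) :
    |y| ≤ 4 * ε * √w + 4 * ε ^ 2 := by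
  have hm0 : 0 < m := hN₀.trans_le hm
  have h1 : √(m * w * (ε ^ 2 * N₀)) ≤ m * (ε * √w) := by
    refine Real.sqrt_le_iff.2 ⟨by positivity, ?_⟩
    have : (m * (ε * √w)) ^ 2 = m * w * (ε ^ 2 * m) := by
      rw [mul_pow, mul_pow, Real.sq_sqrt hw]
      ring
    rw [this]
    gcongr
  have h2 : ε ^ 2 * N₀ ≤ m * ε ^ 2 := by
    rw [mul_comm]
    gcongr
  have h3 : m / 2 * |y| ≤ |N * y| := by
    rw [abs_mul]
    exact mul_le_mul_of_nonneg_right (hN.trans (le_abs_self N)) (abs_nonneg y)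
  have h4 : m * |y| ≤ m * (4 * ε * √w + 4 * ε ^ 2) := by linarith
  exact le_of_mul_le_mul_left h4 hm0

section Rows

variable {M : MDP 𝒮 𝒜} {μ π : Policy 𝒮 𝒜} {D : Fin n → Trajectory 𝒮 𝒜 H} {x ε : ℝ}

lemma GoodData.half_le_card (hD : M.GoodData μ π x D) (hH : 0 < H) (hε : 0 ≤ ε) (hε' : ε ≤ 1 / 25)
    (hx : x = ε ^ 2 * (n * M.toModel.minOccupancy H μ)) (t : Fin H) {s : 𝒮} {a : 𝒜}
    (h : 0 < M.toModel.occupancy μ t s a) :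
    n * M.toModel.occupancy μ t s a / 2 ≤ (visits D t s a).card := by
  have hdm := M.minOccupancy_pos hH μ
  have hle : n * M.toModel.minOccupancy H μ ≤ n * M.toModel.occupancy μ t s a :=
    mul_le_mul_of_nonneg_left (M.minOccupancy_le μ t.isLt h) (Nat.cast_nonneg n)
  have h1 := count_bound (by positivity) hle hε hε' (hx ▸ hD.card t s a)
  have h2 := (abs_le.1 h1).1
  have h3 : 0 ≤ n * M.toModel.occupancy μ t s a := by positivity
  nlinarith

lemma GoodData.sum_trans_eq_one (hD : M.GoodData μ π x D) (hH : 0 < H) (hn : 0 < n) (hε : 0 ≤ ε)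
    (hε' : ε ≤ 1 / 25) (hx : x = ε ^ 2 * (n * M.toModel.minOccupancy H μ)) (t : Fin H) {s : 𝒮}
    {a : 𝒜} (h : 0 < M.toModel.occupancy μ t s a) :
    ∑ s', (empiricalModel D).trans t s a s' = 1 := by
  refine sum_empiricalModel_trans (lt_of_lt_of_le ?_ (hD.half_le_card hH hε hε' hx t h))
  have : (0 : ℝ) < n := by exact_mod_cast hn
  positivity

lemma sum_visits_sub (D : Fin n → Trajectory 𝒮 𝒜 H) (p : 𝒮 → ℝ) (t : Fin H) (s : 𝒮) (a : 𝒜)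
    (f : 𝒮 → ℝ) :
    ∑ i ∈ visits D t s a, (f ((D i).state t.succ) - ∑ s', p s' * f s') =
      (visits D t s a).card * ∑ s', ((empiricalModel D).trans t s a s' - p s') * f s' := by
  rw [Finset.sum_sub_distrib, sum_visits_next]
  simp only [Finset.sum_const, nsmul_eq_mul, sub_mul, Finset.sum_sub_distrib]
  ring

/-- The error of a single empirical transition probability. -/
lemma GoodData.abs_trans_sub_le (hD : M.GoodData μ π x D) (hH : 0 < H) (hn : 0 < n) (hε : 0 ≤ ε)
    (hε' : ε ≤ 1 / 25) (hx : x = ε ^ 2 * (n * M.toModel.minOccupancy H μ)) (t : Fin H) {s : 𝒮}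
    {a : 𝒜} (h : 0 < M.toModel.occupancy μ t s a) (s' : 𝒮) :
    |(empiricalModel D).trans t s a s' - M.toModel.trans t s a s'| ≤
      4 * ε * √(M.toModel.trans t s a s') + 4 * ε ^ 2 := by
  classical
  have hn' : (0 : ℝ) < n := by exact_mod_cast hn
  have hdm := M.minOccupancy_pos hH μ
  have hle : n * M.toModel.minOccupancy H μ ≤ n * M.toModel.occupancy μ t s a :=
    mul_le_mul_of_nonneg_left (M.minOccupancy_le μ t.isLt h) hn'.le
  refine mean_bound (mul_pos hn' hdm) hle hε (hD.half_le_card hH hε hε' hx t h)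
    (M.trans_nonneg t s a s') ?_
  have h1 := hD.next t s a s'
  have h2 := sum_visits_sub D (M.toModel.trans t s a) t s a fun y => if y = s' then 1 else 0
  simp only [mul_ite, mul_one, mul_zero, Finset.sum_ite_eq', Finset.mem_univ, if_true] at h2
  rw [← h2, ← hx, mul_assoc (n : ℝ)]
  convert h1 using 4

lemma GoodData.abs_reward_sub_le (hD : M.GoodData μ π x D) (hH : 0 < H) (hn : 0 < n) (hε : 0 ≤ ε)
    (hε' : ε ≤ 1 / 25) (hx : x = ε ^ 2 * (n * M.toModel.minOccupancy H μ)) (t : Fin H) {s : 𝒮}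
    {a : 𝒜} (h : 0 < M.toModel.occupancy μ t s a) :
    |(empiricalModel D).reward t s a - M.toModel.reward t s a| ≤ 8 * ε := by
  have hn' : (0 : ℝ) < n := by exact_mod_cast hn
  have hdm := M.minOccupancy_pos hH μ
  have hle : n * M.toModel.minOccupancy H μ ≤ n * M.toModel.occupancy μ t s a :=
    mul_le_mul_of_nonneg_left (M.minOccupancy_le μ t.isLt h) hn'.le
  have h1 := hD.reward t s a
  rw [Finset.sum_sub_distrib, sum_visits_reward, Finset.sum_const, nsmul_eq_mul, ← mul_sub,
    ← mul_assoc, hx] at h1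
  have h2 := mean_bound (mul_pos hn' hdm) hle hε (hD.half_le_card hH hε hε' hx t h) zero_le_one h1
  rw [Real.sqrt_one] at h2
  nlinarith

/-- The error of the mean of a function with values in `[0, H]` that may depend on the data, when
the probabilities of all sets of next states are controlled. -/
lemma GoodData.abs_sum_trans_sub_le_of_subsetBound (hD : M.GoodData μ π x D)
    (hS : M.SubsetBound μ x D) (hH : 0 < H) (hn : 0 < n) (hε : 0 ≤ ε)
    (hε' : ε ≤ 1 / 25) (hx : x = ε ^ 2 * (n * M.toModel.minOccupancy H μ)) (t : Fin H) {s : 𝒮}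
    {a : 𝒜} (h : 0 < M.toModel.occupancy μ t s a) {V : 𝒮 → ℝ} (hV0 : ∀ y, 0 ≤ V y)
    (hVH : ∀ y, V y ≤ H) :
    |∑ s', ((empiricalModel D).trans t s a s' - M.toModel.trans t s a s') * V s'| ≤
      8 * H * ε := by
  classical
  have hn' : (0 : ℝ) < n := by exact_mod_cast hn
  have hdm := M.minOccupancy_pos hH μ
  have hle : n * M.toModel.minOccupancy H μ ≤ n * M.toModel.occupancy μ t s a :=
    mul_le_mul_of_nonneg_left (M.minOccupancy_le μ t.isLt h) hn'.le
  set z : 𝒮 → ℝ := fun s' => (empiricalModel D).trans t s a s' - M.toModel.trans t s a s' with hz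
  have hk : ∀ k : 𝒮 → Bool, |∑ s', z s' * if k s' then 1 else 0| ≤ 8 * ε := by
    intro k
    have h1 := hS t s a k
    rw [sum_visits_sub D (M.toModel.trans t s a) t s a fun y => if k y then 1 else 0, ← mul_assoc,
      hx] at h1
    have h2 := mean_bound (mul_pos hn' hdm) hle hε (hD.half_le_card hH hε hε' hx t h)
      zero_le_one h1
    rw [Real.sqrt_one] at h2
    refine h2.trans ?_
    nlinarith
  have hH' : (0 : ℝ) ≤ H := Nat.cast_nonneg H
  -- the worst functions with values in `[0, H]` are the multiples of indicator functions
  have hpos : ∑ s', z s' * V s' ≤ H * ∑ s', z s' * if decide (0 ≤ z s') then 1 else 0 := by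
    rw [Finset.mul_sum]
    refine Finset.sum_le_sum fun s' _ => ?_
    by_cases h0 : 0 ≤ z s'
    · simp only [h0, decide_true, if_true]
      nlinarith [hVH s']
    · simp only [h0, decide_false, Bool.false_eq_true, if_false]
      nlinarith [hV0 s', not_le.1 h0]
  have hneg : H * ∑ s', z s' * (if decide (z s' ≤ 0) then 1 else 0) ≤ ∑ s', z s' * V s' := by
    rw [Finset.mul_sum]
    refine Finset.sum_le_sum fun s' _ => ?_
    by_cases h0 : z s' ≤ 0
    · simp only [h0, decide_true, if_true]
      nlinarith [hVH s']
    · simp only [h0, decide_false, Bool.false_eq_true, if_false]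
      nlinarith [hV0 s', not_le.1 h0]
  have h1 := mul_le_mul_of_nonneg_left (abs_le.1 (hk fun s' => decide (0 ≤ z s'))).2 hH'
  have h2 := mul_le_mul_of_nonneg_left (abs_le.1 (hk fun s' => decide (z s' ≤ 0))).1 hH'
  rw [abs_le]
  constructor <;> linarith

/-- The error of the empirical mean of a function `W` of the next state for which the backward
Bernstein bound holds: it is of the order of the standard deviation of `W`, as if `W` did not
depend on the data. -/
lemma GoodData.abs_sum_trans_sub_le_of_backwardBound (hD : M.GoodData μ π x D)
    (hH : 0 < H) (hn : 0 < n) (hε : 0 ≤ ε)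
    (hε' : ε ≤ 1 / 25) (hx : x = ε ^ 2 * (n * M.toModel.minOccupancy H μ)) (t : Fin H) {s : 𝒮}
    {a : 𝒜} (h : 0 < M.toModel.occupancy μ t s a) {W : 𝒮 → ℝ}
    (hlast : (t : ℕ) + 1 = H → ∀ y, W y = 0) (hW : M.BackwardBound μ x D t s a W) :
    |∑ s', ((empiricalModel D).trans t s a s' - M.toModel.trans t s a s') * W s'| ≤
      14 * ε * √(wvar (M.toModel.trans t s a) W) + 4 * H * ε ^ 2 := by
  classical
  rcases (Nat.succ_le_of_lt t.isLt).eq_or_lt with hl | hl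
  · simp [hlast hl]
    positivity
  have hn' : (0 : ℝ) < n := by exact_mod_cast hn
  have hdm := M.minOccupancy_pos hH μ
  have hle : n * M.toModel.minOccupancy H μ ≤ n * M.toModel.occupancy μ t s a :=
    mul_le_mul_of_nonneg_left (M.minOccupancy_le μ t.isLt h) hn'.le
  set p := M.toModel.trans t s a with hp
  have hp0 : ∀ y, 0 ≤ p y := M.trans_nonneg t s a
  have hp1 : ∑ y, p y = 1 := M.sum_trans t s a
  set c := ∑ y, p y * W y with hc
  set m := n * M.toModel.occupancy μ t s a with hm
  set q := M.backwardProb μ t s a with hq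
  have hm0 : 0 < m := mul_pos hn' h
  set d : 𝒮 → ℝ := M.toModel.stateDist μ (t + 1) with hd
  set cnt : 𝒮 → ℝ := fun y => ∑ i, if (D i).state t.succ = y then (1 : ℝ) else 0 with hcnt
  have hcount : ∀ y, 0 < d y → |cnt y - n * d y| ≤ 4 * ε * (n * d y) := by
    intro y hy
    have h1 := hD.state ⟨t + 1, hl⟩ y
    have h2 : n * M.toModel.minOccupancy H μ ≤ n * d y :=
      mul_le_mul_of_nonneg_left (M.minOccupancy_le_stateDist μ hl hy) hn'.le
    rw [hx] at h1
    exact count_bound (by positivity) h2 hε hε' h1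
  have hqd : ∀ y, q y * (n * d y) = m * p y := by
    intro y
    have := M.backwardProb_mul_stateDist μ t s a y
    rw [hm, mul_assoc, ← this]
    ring
  have hq0 : ∀ y, 0 ≤ q y := M.backwardProb_nonneg μ t s a
  -- states that are never reached have backward probability zero, by the junk value of `0⁻¹`
  have hrel : ∀ y, |q y * cnt y - m * p y| ≤ 4 * ε * (m * p y) := by
    intro y
    rcases (M.stateDist_nonneg μ (t + 1) y).eq_or_lt with h0 | h0
    · have h1 : q y = 0 := by
        simp [hq, backwardProb, ← h0]
      have h2 := hqd y
      rw [h1, zero_mul] at h2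
      simp [h1, ← h2]
    · rw [← hqd y, ← mul_sub, abs_mul, abs_of_nonneg (hq0 y)]
      calc q y * |cnt y - n * d y| ≤ q y * (4 * ε * (n * d y)) :=
            mul_le_mul_of_nonneg_left (hcount y h0) (hq0 y)
        _ = _ := by ring
  have hfiber : ∀ f : 𝒮 → ℝ, ∑ i, q ((D i).state t.succ) * f ((D i).state t.succ) =
      ∑ y, q y * cnt y * f y := by
    intro f
    simp only [hcnt, Finset.mul_sum, Finset.sum_mul]
    rw [Finset.sum_comm]
    refine Finset.sum_congr rfl fun i _ => ?_
    simp
  set σ := √(wvar p W) with hσ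
  have hσ0 : 0 ≤ σ := Real.sqrt_nonneg _
  have hv : wvar p W = σ ^ 2 := (Real.sq_sqrt (wvar_nonneg hp0 W)).symm
  have hmeanzero : ∑ y, m * p y * (W y - c) = 0 := by
    have : ∀ y, m * p y * (W y - c) = m * (p y * W y) - m * c * p y := fun y => by ring
    simp only [this, Finset.sum_sub_distrib, ← Finset.mul_sum]
    rw [hp1, ← hc]
    ring
  -- the conditional mean given the future, small because the counts of the next states are close
  -- to their means
  have hmean : |∑ i, q ((D i).state t.succ) * (W ((D i).state t.succ) - c)| ≤
      4 * ε * m * σ := by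
    rw [hfiber fun y => W y - c, ← sub_zero (∑ y, q y * cnt y * (W y - c)), ← hmeanzero,
      ← Finset.sum_sub_distrib]
    calc _ ≤ ∑ y, |q y * cnt y * (W y - c) - m * p y * (W y - c)| :=
          Finset.abs_sum_le_sum_abs _ _
      _ ≤ ∑ y, 4 * ε * m * (p y * |W y - c|) := by
          refine Finset.sum_le_sum fun y _ => ?_
          rw [← sub_mul, abs_mul]
          calc _ ≤ 4 * ε * (m * p y) * |W y - c| :=
                mul_le_mul_of_nonneg_right (hrel y) (abs_nonneg _)
            _ = _ := by ring
      _ = 4 * ε * m * ∑ y, p y * |W y - c| := by rw [Finset.mul_sum]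
      _ ≤ 4 * ε * m * σ := mul_le_mul_of_nonneg_left
          (sum_mul_abs_sub_le_sqrt_wvar hp0 hp1 W) (by positivity)
  have hsq : ∑ i, q ((D i).state t.succ) * (W ((D i).state t.succ) - c) ^ 2 ≤ 2 * m * σ ^ 2 := by
    rw [hfiber fun y => (W y - c) ^ 2, ← hv]
    unfold wvar
    rw [← hc, Finset.mul_sum]
    refine Finset.sum_le_sum fun y _ => ?_
    have h1 := (abs_le.1 (hrel y)).2
    have h2 : 0 ≤ m * p y := mul_nonneg hm0.le (hp0 y)
    have h3 : q y * cnt y ≤ 2 * m * p y := by nlinarith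
    calc _ ≤ 2 * m * p y * (W y - c) ^ 2 := mul_le_mul_of_nonneg_right h3 (sq_nonneg _)
      _ = _ := by ring
  have hx0 : 0 ≤ x := by
    rw [hx]
    positivity
  have hxm : x ≤ ε ^ 2 * m := by
    rw [hx]
    exact mul_le_mul_of_nonneg_left hle (sq_nonneg ε)
  have hroot : √((∑ i, q ((D i).state t.succ) * (W ((D i).state t.succ) - c) ^ 2) * x) ≤
      3 / 2 * (ε * m * σ) := by
    refine Real.sqrt_le_iff.2 ⟨by positivity, ?_⟩
    calc _ ≤ 2 * m * σ ^ 2 * (ε ^ 2 * m) := mul_le_mul hsq hxm hx0 (by positivity)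
      _ ≤ _ := by nlinarith [sq_nonneg (ε * m * σ)]
  have hcard := hD.half_le_card hH hε hε' hx t h
  -- the fluctuation given the future, and the conditional mean
  have hlin : (visits D t s a).card *
      ∑ s', ((empiricalModel D).trans t s a s' - p s') * W s' =
      ∑ i, ((if inRow t s a (D i) then 1 else 0) - q ((D i).state t.succ)) *
        (W ((D i).state t.succ) - c) +
      ∑ i, q ((D i).state t.succ) * (W ((D i).state t.succ) - c) := by
    rw [← sum_visits_sub, ← Finset.sum_add_distrib, sum_visits]
    exact Finset.sum_congr rfl fun i _ => by ring
  have hmain : |((visits D t s a).card : ℝ) *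
      ∑ s', ((empiricalModel D).trans t s a s' - p s') * W s'| ≤
      7 * ε * m * σ + 2 * H * (ε ^ 2 * m) := by
    have h1 : |∑ i, ((if inRow t s a (D i) then 1 else 0) - q ((D i).state t.succ)) *
        (W ((D i).state t.succ) - c)| ≤
        2 * √((∑ i, q ((D i).state t.succ) * (W ((D i).state t.succ) - c) ^ 2) * x) +
          2 * H * x := hW
    have h2 : 2 * (H : ℝ) * x ≤ 2 * H * (ε ^ 2 * m) :=
      mul_le_mul_of_nonneg_left hxm (by positivity)
    rw [hlin]
    refine (abs_add_le _ _).trans ?_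
    linarith
  set Y := ∑ s', ((empiricalModel D).trans t s a s' - p s') * W s' with hY
  have h3 : m / 2 * |Y| ≤ |((visits D t s a).card : ℝ) * Y| := by
    rw [abs_mul]
    exact mul_le_mul_of_nonneg_right (hcard.trans (le_abs_self _)) (abs_nonneg Y)
  have h4 : m * |Y| ≤ m * (14 * ε * σ + 4 * H * ε ^ 2) := by linarith
  exact le_of_mul_le_mul_left h4 hm0

/-- The error caused by the empirical initial distribution. -/
lemma GoodData.abs_sum_init_sub_le (hD : M.GoodData μ π x D)
    (hH : 0 < H) (hn : 0 < n) (hε : 0 ≤ ε)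
    (hε' : ε ≤ 1 / 25) (hx : x = ε ^ 2 * (n * M.toModel.minOccupancy H μ)) {V : 𝒮 → ℝ}
    (hV0 : ∀ y, 0 ≤ V y) (hVH : ∀ y, V y ≤ H) :
    |∑ s, ((empiricalModel D).init s - M.toModel.init s) * V s| ≤ 4 * H * ε := by
  classical
  have hn' : (0 : ℝ) < n := by exact_mod_cast hn
  have hdm := M.minOccupancy_pos hH μ
  set p : 𝒮 → ℝ := M.toModel.init with hp
  have hp0 : ∀ y, 0 ≤ p y := M.init.2.1
  have hp1 : ∑ y, p y = 1 := M.init.2.2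
  have hrow : ∀ s, |(empiricalModel D).init s - p s| ≤ 4 * ε * p s := by
    intro s
    rw [empiricalModel_init]
    rcases (hp0 s).eq_or_lt with h0 | h0
    · have h1 : ∀ i, (D i).state 0 ≠ s := by
        intro i hi
        have := hD.init_pos i
        rw [hi] at this
        exact this.ne h0
      simp [h1, ← h0]
    · have h1 := hD.state ⟨0, hH⟩ s
      have h2 : n * M.toModel.minOccupancy H μ ≤ n * p s :=
        mul_le_mul_of_nonneg_left (M.minOccupancy_le_stateDist μ hH h0) hn'.le
      rw [hx] at h1
      have h3 := count_bound (by positivity) h2 hε hε' h1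
      have h4 : ∀ c : ℝ, |c - n * p s| ≤ 4 * ε * (n * p s) → |c / n - p s| ≤ 4 * ε * p s := by
        intro c hc
        have e : c / n - p s = (c - n * p s) / n := by field_simp
        rw [e, abs_div, abs_of_pos hn', div_le_iff₀ hn']
        linarith
      exact h4 _ h3
  calc _ ≤ ∑ s, |((empiricalModel D).init s - p s) * V s| := Finset.abs_sum_le_sum_abs _ _
    _ ≤ ∑ s, p s * (4 * ε * H) := by
        refine Finset.sum_le_sum fun s _ => ?_
        rw [abs_mul, abs_of_nonneg (hV0 s)]
        calc _ ≤ 4 * ε * p s * H :=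
              mul_le_mul (hrow s) (hVH s) (hV0 s) (by have := hp0 s; positivity)
          _ = _ := by ring
    _ = 4 * H * ε := by
        rw [← Finset.sum_mul, hp1]
        ring

end Rows

end MDP

/-! ### Errors of the empirical values on the good event -/

namespace MDP

variable {𝒮 𝒜 : Type*} [Fintype 𝒮] [Fintype 𝒜] {H n : ℕ}
variable {M : MDP 𝒮 𝒜} {μ π : Policy 𝒮 𝒜} {D : Fin n → Trajectory 𝒮 𝒜 H} {x ε : ℝ}

lemma GoodData.abs_value_sub_le (hD : M.GoodData μ π x D) (hμ : M.toModel.IsExploratory H μ)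
    (hH : 0 < H) (hn : 0 < n) (hε : 0 ≤ ε) (hε' : ε ≤ 1 / 25)
    (hx : x = ε ^ 2 * (n * M.toModel.minOccupancy H μ)) (π' : Policy 𝒮 𝒜) {a₁ b₁ : ℝ}
    (ha : 0 ≤ a₁) (haH : a₁ * √H ≤ 1)
    (hrow : ∀ (t : Fin H) s a, 0 < M.toModel.occupancy μ t s a →
      |∑ s', ((empiricalModel D).trans t s a s' - M.toModel.trans t s a s') *
          (empiricalModel D).valueFunction H π' (t + 1) s'| ≤
        a₁ * √(wvar (M.toModel.trans t s a) ((empiricalModel D).valueFunction H π' (t + 1))) +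
          b₁) :
    |(empiricalModel D).value H π' - M.toModel.value H π'| ≤
      12 * H * ε + (3 * a₁ * H * √H + 2 * H * b₁) := by
  have hN := empiricalModel_isSubstochastic hD.reward_mem
  have h := M.abs_value_sub_value_le hN hH π' ha haH
    (hD.abs_sum_init_sub_le hH hn hε hε' hx (hN.valueFunction_nonneg H π' 0)
      (hN.valueFunction_le H π' 0))
    (fun t ht s a hp => hD.abs_reward_sub_le hH hn hε hε' hx ⟨t, ht⟩
      (M.occupancy_pos_of_isExploratory hμ ht hp))
    (fun t ht s a hp => hrow ⟨t, ht⟩ s a (M.occupancy_pos_of_isExploratory hμ ht hp))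
  linarith

lemma le_of_mul_sqrt_le {ε k c : ℝ} (hε : 0 ≤ ε) (hk : 1 ≤ k) (h : ε * √k ≤ c) :
    ε ≤ c := by
  have : 1 ≤ √k := Real.one_le_sqrt.2 hk
  nlinarith

/-- The empirical value of the fixed policy for which the backward bound holds. -/
lemma GoodData.abs_value_sub_le_of_backward (hD : M.GoodData μ π x D)
    (hμ : M.toModel.IsExploratory H μ) (hH : 0 < H) (hn : 0 < n) (hε : 0 ≤ ε)
    (hε' : ε * √H ≤ 1 / 25) (hx : x = ε ^ 2 * (n * M.toModel.minOccupancy H μ)) :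
    |(empiricalModel D).value H π - M.toModel.value H π| ≤ 55 * (H * √H * ε) := by
  have hH1 : (1 : ℝ) ≤ H := by exact_mod_cast hH
  have hs1 : 1 ≤ √(H : ℝ) := Real.one_le_sqrt.2 hH1
  have hsq : √(H : ℝ) * √(H : ℝ) = H := Real.mul_self_sqrt (by linarith)
  have hε1 := le_of_mul_sqrt_le hε hH1 hε'
  have h := hD.abs_value_sub_le hμ hH hn hε hε1 hx π (a₁ := 14 * ε) (b₁ := 4 * H * ε ^ 2)
    (by positivity) (by linarith) fun t s a hp =>
      hD.abs_sum_trans_sub_le_of_backwardBound hH hn hε hε1 hx t hp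
        (fun hl y => TabularModel.valueFunction_of_le _ _ hl.ge _) (hD.backward_policy t s a)
  refine h.trans ?_
  have h1 : (H : ℝ) * ε ≤ H * √H * ε := by
    have : 0 ≤ (H : ℝ) * ε := by positivity
    nlinarith
  have h2 : (H : ℝ) * (H * ε ^ 2) ≤ 1 / 25 * (H * √H * ε) := by
    have e : (H : ℝ) * (H * ε ^ 2) = ε * √H * (H * √H * ε) := by
      linear_combination (-(H : ℝ) * ε ^ 2) * hsq
    rw [e]
    exact mul_le_mul_of_nonneg_right hε' (by positivity)
  have h3 : 0 ≤ H * √H * ε := by positivity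
  linarith

lemma sum_sqrt_le {p : 𝒮 → ℝ} (hp : ∀ s, 0 ≤ p s) (hp1 : ∑ s, p s = 1) :
    ∑ s, √(p s) ≤ √(Fintype.card 𝒮) := by
  refine Real.le_sqrt_of_sq_le ?_
  have h := sq_sum_le_card_mul_sum_sq (s := Finset.univ) (f := fun s => √(p s))
  simp only [Real.sq_sqrt (hp _), hp1, mul_one] at h
  exact h

/-- The mean of a function that may depend on the data, from the errors of the individual
transition probabilities: Cauchy–Schwarz costs a factor `√S`. -/
lemma GoodData.abs_sum_trans_sub_le (hD : M.GoodData μ π x D) (hH : 0 < H) (hn : 0 < n)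
    (hε : 0 ≤ ε) (hε' : ε ≤ 1 / 25) (hx : x = ε ^ 2 * (n * M.toModel.minOccupancy H μ))
    (t : Fin H) {s : 𝒮} {a : 𝒜} (h : 0 < M.toModel.occupancy μ t s a) {V : 𝒮 → ℝ}
    (hV0 : ∀ y, 0 ≤ V y) (hVH : ∀ y, V y ≤ H) :
    |∑ s', ((empiricalModel D).trans t s a s' - M.toModel.trans t s a s') * V s'| ≤
      4 * ε * √(Fintype.card 𝒮) * √(wvar (M.toModel.trans t s a) V) +
        4 * H * Fintype.card 𝒮 * ε ^ 2 := by
  set p := M.toModel.trans t s a with hp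
  have hp0 : ∀ y, 0 ≤ p y := M.trans_nonneg t s a
  have hp1 : ∑ y, p y = 1 := M.sum_trans t s a
  set c := ∑ y, p y * V y with hc
  have hc0 : 0 ≤ c := Finset.sum_nonneg fun y _ => mul_nonneg (hp0 y) (hV0 y)
  have hcH : c ≤ H := sum_mul_le_of_le hp0 hp1.le (Nat.cast_nonneg H) hVH
  have hcen : ∑ y, ((empiricalModel D).trans t s a y - p y) * V y =
      ∑ y, ((empiricalModel D).trans t s a y - p y) * (V y - c) := by
    have h1 := hD.sum_trans_eq_one hH hn hε hε' hx t h
    simp only [mul_sub, Finset.sum_sub_distrib, ← Finset.sum_mul]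
    rw [h1, hp1]
    ring
  have hcs : ∑ y, √(p y) * |V y - c| ≤ √(Fintype.card 𝒮) * √(wvar p V) := by
    rw [← Real.sqrt_mul (Nat.cast_nonneg _)]
    refine Real.le_sqrt_of_sq_le ?_
    have h1 := sq_sum_le_card_mul_sum_sq (s := Finset.univ) (f := fun y => √(p y) * |V y - c|)
    simp only [mul_pow, Real.sq_sqrt (hp0 _), sq_abs] at h1
    exact h1
  rw [hcen]
  calc _ ≤ ∑ y, |((empiricalModel D).trans t s a y - p y) * (V y - c)| :=
        Finset.abs_sum_le_sum_abs _ _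
    _ ≤ ∑ y, (4 * ε * (√(p y) * |V y - c|) + 4 * ε ^ 2 * H) := by
        refine Finset.sum_le_sum fun y _ => ?_
        have h1 : |V y - c| ≤ H := by
          rw [abs_le]
          constructor <;> linarith [hV0 y, hVH y]
        have h2 := hD.abs_trans_sub_le hH hn hε hε' hx t h y
        rw [abs_mul]
        calc _ ≤ (4 * ε * √(p y) + 4 * ε ^ 2) * |V y - c| :=
              mul_le_mul_of_nonneg_right h2 (abs_nonneg _)
          _ = 4 * ε * (√(p y) * |V y - c|) + 4 * ε ^ 2 * |V y - c| := by ring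
          _ ≤ _ := by gcongr
    _ = 4 * ε * ∑ y, √(p y) * |V y - c| + 4 * H * Fintype.card 𝒮 * ε ^ 2 := by
        rw [Finset.sum_add_distrib, ← Finset.mul_sum, Finset.sum_const, Finset.card_univ,
          nsmul_eq_mul]
        ring
    _ ≤ 4 * ε * (√(Fintype.card 𝒮) * √(wvar p V)) + 4 * H * Fintype.card 𝒮 * ε ^ 2 := by gcongr
    _ = _ := by ring

/-- The empirical value of any policy, with a factor `√S`. -/
lemma GoodData.abs_value_sub_le_sqrt_card (hD : M.GoodData μ π x D)
    (hμ : M.toModel.IsExploratory H μ) (hH : 0 < H) (hn : 0 < n) (hε : 0 ≤ ε) [Nonempty 𝒮]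
    (hε' : ε * √(H * Fintype.card 𝒮) ≤ 1 / 25)
    (hx : x = ε ^ 2 * (n * M.toModel.minOccupancy H μ)) (π' : Policy 𝒮 𝒜) :
    |(empiricalModel D).value H π' - M.toModel.value H π'| ≤
      25 * (H * √(H * Fintype.card 𝒮) * ε) := by
  have hN := empiricalModel_isSubstochastic hD.reward_mem
  have hH1 : (1 : ℝ) ≤ H := by exact_mod_cast hH
  have hS1 : (1 : ℝ) ≤ Fintype.card 𝒮 := by exact_mod_cast Fintype.card_pos
  have hHS : (1 : ℝ) ≤ H * Fintype.card 𝒮 := by nlinarith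
  set r := √((H : ℝ) * Fintype.card 𝒮) with hr
  have hr1 : 1 ≤ r := Real.one_le_sqrt.2 hHS
  have hsq : r * r = H * Fintype.card 𝒮 := Real.mul_self_sqrt (by linarith)
  have hrr : √(H : ℝ) * √(Fintype.card 𝒮 : ℝ) = r := (Real.sqrt_mul (by linarith) _).symm
  have hε1 := le_of_mul_sqrt_le hε hHS hε'
  have h := hD.abs_value_sub_le hμ hH hn hε hε1 hx π' (a₁ := 4 * ε * √(Fintype.card 𝒮))
    (b₁ := 4 * H * Fintype.card 𝒮 * ε ^ 2) (by positivity)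
    (by
      have e : 4 * ε * √(Fintype.card 𝒮 : ℝ) * √(H : ℝ) = 4 * (ε * r) := by rw [← hrr]; ring
      rw [e]
      linarith)
    fun t s a hp => hD.abs_sum_trans_sub_le hH hn hε hε1 hx t hp
      (hN.valueFunction_nonneg H π' _) (hN.valueFunction_le H π' _)
  refine h.trans ?_
  have h1 : (H : ℝ) * ε ≤ H * r * ε := by
    have : 0 ≤ (H : ℝ) * ε := by positivity
    nlinarith
  have h2 : (H : ℝ) * (H * Fintype.card 𝒮 * ε ^ 2) ≤ 1 / 25 * (H * r * ε) := by
    have e : (H : ℝ) * (H * Fintype.card 𝒮 * ε ^ 2) = ε * r * (H * r * ε) := by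
      linear_combination (-(H : ℝ) * ε ^ 2) * hsq
    rw [e]
    exact mul_le_mul_of_nonneg_right hε' (by positivity)
  have h3 : 3 * (4 * ε * √(Fintype.card 𝒮 : ℝ)) * H * √(H : ℝ) = 12 * (H * r * ε) := by
    rw [← hrr]
    ring
  have h4 : 0 ≤ H * r * ε := by positivity
  linarith

/-- The empirical value of any policy, when the probabilities of all sets are controlled. -/
lemma GoodData.abs_value_sub_le_of_subsetBound (hD : M.GoodData μ π x D)
    (hS : M.SubsetBound μ x D) (hμ : M.toModel.IsExploratory H μ) (hH : 0 < H) (hn : 0 < n)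
    (hε : 0 ≤ ε) (hε' : ε ≤ 1 / 25) (hx : x = ε ^ 2 * (n * M.toModel.minOccupancy H μ))
    (π' : Policy 𝒮 𝒜) :
    |(empiricalModel D).value H π' - M.toModel.value H π'| ≤ 28 * ((H : ℝ) ^ 2 * ε) := by
  have hN := empiricalModel_isSubstochastic hD.reward_mem
  have hH1 : (1 : ℝ) ≤ H := by exact_mod_cast hH
  have h := hD.abs_value_sub_le hμ hH hn hε hε' hx π' (a₁ := 0) (b₁ := 8 * H * ε) le_rfl
    (by simp) fun t s a hp => by
      rw [zero_mul, zero_add]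
      exact hD.abs_sum_trans_sub_le_of_subsetBound hS hH hn hε hε' hx t hp
        (hN.valueFunction_nonneg H π' _) (hN.valueFunction_le H π' _)
  refine h.trans ?_
  have h1 : (H : ℝ) * ε ≤ (H : ℝ) ^ 2 * ε := by
    have : 0 ≤ (H : ℝ) * ε := by positivity
    nlinarith
  linarith

/-- The empirical value of a policy whose empirical value functions are close to the optimal
ones: the backward bound for the optimal value function carries over. -/
lemma GoodData.abs_value_sub_le_of_near_optimal [Nonempty 𝒮] (hD : M.GoodData μ π x D)
    (hμ : M.toModel.IsExploratory H μ) (hH : 0 < H) (hn : 0 < n) (hε : 0 ≤ ε)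
    (hε' : ε * √H ≤ 1 / 25) (hx : x = ε ^ 2 * (n * M.toModel.minOccupancy H μ))
    {π' : Policy 𝒮 𝒜} {e : ℝ} (he0 : 0 ≤ e) (he : e ≤ √H / Fintype.card 𝒮)
    (hclose : ∀ t < H, ∀ s, |(empiricalModel D).valueFunction H π' t s -
      (empiricalModel D).optimalToGo (H - t) t s| ≤ e) :
    |(empiricalModel D).value H π' - M.toModel.value H π'| ≤ 127 * (H * √H * ε) := by
  have hH1 : (1 : ℝ) ≤ H := by exact_mod_cast hH
  have hs1 : 1 ≤ √(H : ℝ) := Real.one_le_sqrt.2 hH1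
  have hsq : √(H : ℝ) * √(H : ℝ) = H := Real.mul_self_sqrt (by linarith)
  have hS1 : (1 : ℝ) ≤ Fintype.card 𝒮 := by exact_mod_cast Fintype.card_pos
  have hε1 := le_of_mul_sqrt_le hε hH1 hε'
  have heS : e * Fintype.card 𝒮 ≤ √H := (le_div_iff₀ (by linarith)).1 he
  have heS' : e * √(Fintype.card 𝒮 : ℝ) ≤ √H := by
    refine le_trans (mul_le_mul_of_nonneg_left ?_ he0) heS
    exact Real.sqrt_le_self_iff.2 (Or.inr hS1)
  have heH : e ≤ √(H : ℝ) := by nlinarith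
  have hrow : ∀ (t : Fin H) s a, 0 < M.toModel.occupancy μ t s a →
      |∑ s', ((empiricalModel D).trans t s a s' - M.toModel.trans t s a s') *
          (empiricalModel D).valueFunction H π' (t + 1) s'| ≤
        21 * ε * √(wvar (M.toModel.trans t s a)
          ((empiricalModel D).valueFunction H π' (t + 1))) + 26 * ε * √H := by
    intro t s a hp
    set p := M.toModel.trans t s a with hpdef
    have hp0 : ∀ y, 0 ≤ p y := M.trans_nonneg t s a
    have hp1 : ∑ y, p y = 1 := M.sum_trans t s a
    set F := (empiricalModel D).valueFunction H π' (t + 1) with hF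
    set G := (empiricalModel D).optimalToGo (H - (t + 1)) (t + 1) with hG
    set z : 𝒮 → ℝ := fun y => (empiricalModel D).trans t s a y - p y with hz
    have hlast : (t : ℕ) + 1 = H → ∀ y, G y = 0 := by
      intro hl y
      simp [hG, hl, TabularModel.optimalToGo]
    have hFG : ∀ y, |F y - G y| ≤ e := by
      intro y
      rcases (Nat.succ_le_of_lt t.isLt).eq_or_lt with hl | hl
      · rw [hlast hl, hF, TabularModel.valueFunction_of_le _ _ hl.ge]
        simpa using he0
      · exact hclose _ hl y
    have h1 : |∑ y, z y * G y| ≤ 14 * ε * √(wvar p G) + 4 * H * ε ^ 2 :=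
      hD.abs_sum_trans_sub_le_of_backwardBound hH hn hε hε1 hx t hp hlast
        (hD.backward_optimal t s a)
    have h2 : √(wvar p G) ≤ 3 / 2 * √(wvar p F) + 3 / 2 * e := by
      refine Real.sqrt_le_iff.2 ⟨by positivity, ?_⟩
      have h3 := wvar_le_of_abs_sub_le hp0 hp1 (f := G) (g := F) (b := e)
        fun y => by rw [abs_sub_comm]; exact hFG y
      have h4 := Real.sq_sqrt (wvar_nonneg hp0 F)
      nlinarith [mul_nonneg (Real.sqrt_nonneg (wvar p F)) he0, sq_nonneg e, wvar_nonneg hp0 F]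
    have h5 : |∑ y, z y * (F y - G y)| ≤
        4 * ε * (e * √(Fintype.card 𝒮 : ℝ)) + 4 * ε ^ 2 * (e * Fintype.card 𝒮) := by
      calc _ ≤ ∑ y, |z y * (F y - G y)| := Finset.abs_sum_le_sum_abs _ _
        _ ≤ ∑ y, (4 * ε * √(p y) + 4 * ε ^ 2) * e := by
            refine Finset.sum_le_sum fun y _ => ?_
            rw [abs_mul]
            exact mul_le_mul (hD.abs_trans_sub_le hH hn hε hε1 hx t hp y) (hFG y) (abs_nonneg _)
              (by positivity)
        _ = 4 * ε * (e * ∑ y, √(p y)) + 4 * ε ^ 2 * (e * Fintype.card 𝒮) := by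
            rw [← Finset.sum_mul, Finset.sum_add_distrib, ← Finset.mul_sum, Finset.sum_const,
              Finset.card_univ, nsmul_eq_mul]
            ring
        _ ≤ _ := by
            have := sum_sqrt_le hp0 hp1
            gcongr
    have h6 : ∑ y, z y * F y = ∑ y, z y * G y + ∑ y, z y * (F y - G y) := by
      rw [← Finset.sum_add_distrib]
      exact Finset.sum_congr rfl fun y _ => by ring
    have h7 : ε * (e * √(Fintype.card 𝒮 : ℝ)) ≤ ε * √H := mul_le_mul_of_nonneg_left heS' hε
    have h8 : ε ^ 2 * (e * Fintype.card 𝒮) ≤ 1 / 25 * (ε * √H) := by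
      calc _ ≤ ε ^ 2 * √H := mul_le_mul_of_nonneg_left heS (sq_nonneg ε)
        _ = ε * (ε * √H) := by ring
        _ ≤ _ := mul_le_mul_of_nonneg_right hε1 (by positivity)
    have h9 : H * ε ^ 2 ≤ 1 / 25 * (ε * √H) := by
      have e1 : H * ε ^ 2 = ε * √H * (ε * √H) := by linear_combination (-ε ^ 2) * hsq
      rw [e1]
      exact mul_le_mul_of_nonneg_right hε' (by positivity)
    have h10 : ε * e ≤ ε * √H := mul_le_mul_of_nonneg_left heH hε
    have h11 : ε * √(wvar p G) ≤ ε * (3 / 2 * √(wvar p F) + 3 / 2 * e) :=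
      mul_le_mul_of_nonneg_left h2 hε
    change |∑ y, z y * F y| ≤ _
    rw [h6]
    have h12 : 0 ≤ ε * √(H : ℝ) := by positivity
    refine (abs_add_le _ _).trans ?_
    linarith
  have h := hD.abs_value_sub_le hμ hH hn hε hε1 hx π' (a₁ := 21 * ε) (b₁ := 26 * ε * √H)
    (by positivity) (by linarith) hrow
  refine h.trans ?_
  have h1 : (H : ℝ) * ε ≤ H * √H * ε := by
    have : 0 ≤ (H : ℝ) * ε := by positivity
    nlinarith
  linarith

end MDP

/-! ### The probability of the good event -/

namespace TabularModel

variable {𝒮 𝒜 : Type*} [Fintype 𝒮] [Fintype 𝒜]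

lemma IsSubstochastic.optimalToGo_mem_Icc [Nonempty 𝒜] {N : TabularModel 𝒮 𝒜}
    (hN : N.IsSubstochastic) {H t : ℕ} (h : t ≤ H) (s : 𝒮) :
    N.optimalToGo (H - t) t s ∈ Set.Icc (0 : ℝ) H := by
  obtain ⟨π, hπ⟩ := N.exists_valueFunction_eq_optimalToGo H
  rw [← hπ t h s]
  exact ⟨hN.valueFunction_nonneg H π t s, hN.valueFunction_le H π t s⟩

end TabularModel

namespace MDP

variable {𝒮 𝒜 : Type*} [Fintype 𝒮] [Fintype 𝒜] {H n : ℕ}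
variable [MeasurableSpace 𝒮] [MeasurableSpace 𝒜]
variable [DiscreteMeasurableSpace 𝒮] [DiscreteMeasurableSpace 𝒜]

lemma ae_init_pos (M : MDP 𝒮 𝒜) (μ : Policy 𝒮 𝒜) (H : ℕ) :
    ∀ᵐ τ ∂M.trajectoryLaw μ H, 0 < M.init.1 (τ.state 0) := by
  rw [ae_iff, trajectoryLaw, Measure.finsetSum_apply]
  refine Finset.sum_eq_zero fun σ _ => ?_
  rw [Measure.finsetSum_apply]
  refine Finset.sum_eq_zero fun α _ => ?_
  rcases (M.init.2.1 (σ 0)).eq_or_lt with h | h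
  · rw [← h]
    simp
  · have hms : MeasurableSet {τ : Trajectory 𝒮 𝒜 H | ¬ 0 < M.init.1 (τ.state 0)} :=
      measurable_state (H := H) (𝒜 := 𝒜) 0
        (MeasurableSet.of_discrete (s := {y : 𝒮 | ¬ 0 < M.init.1 y}))
    rw [Measure.smul_apply, Measure.dirac_prod, Measure.map_apply (by fun_prop) hms]
    have e : Prod.mk (σ, α) ⁻¹' {τ : Trajectory 𝒮 𝒜 H | ¬ 0 < M.init.1 (τ.state 0)} = ∅ := by
      ext r
      simpa [Trajectory.state] using h
    rw [e]
    simp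

lemma ae_dataLaw (M : MDP 𝒮 𝒜) (μ : Policy 𝒮 𝒜) {p : Trajectory 𝒮 𝒜 H → Prop}
    (hp : ∀ᵐ τ ∂M.trajectoryLaw μ H, p τ) : ∀ᵐ D ∂M.dataLaw μ H n, ∀ i, p (D i) := by
  rw [ae_all_iff]
  intro i
  exact (measurePreserving_eval (fun _ : Fin n => M.trajectoryLaw μ H) i).quasiMeasurePreserving.ae
    hp

lemma dataLaw_backward_optimal_le (M : MDP 𝒮 𝒜) (μ : Policy 𝒮 𝒜) (hH : 0 < H) (t : Fin H) (s : 𝒮)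
    (a : 𝒜) {x : ℝ} (hx : 0 < x) :
    M.dataLaw μ H n {D | (∀ i t, (D i).reward t ∈ Set.Icc (0 : ℝ) 1) ∧
      ¬ M.BackwardBound μ x D t s a
        ((empiricalModel D).optimalToGo (H - (t + 1)) (t + 1))} ≤
      2 * ENNReal.ofReal (Real.exp (-x)) := by
  have : Nonempty 𝒜 := ⟨a⟩
  refine M.dataLaw_backwardBound_le μ hH t s a
    (W := fun D => (empiricalModel D).optimalToGo (H - (t + 1)) (t + 1))
    (fun y => measurable_optimalToGo _ _ _) (fun D hD y => ?_) (fun D => ?_) hx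
  · exact (empiricalModel_isSubstochastic hD).optimalToGo_mem_Icc t.isLt y
  · funext y
    exact TabularModel.optimalToGo_congr (t := t + 1)
      (fun u hu => empiricalModel_trans_future D t hu s a)
      (fun u hu => empiricalModel_reward_future D t hu s a) _ _ le_rfl y

lemma dataLaw_backward_policy_le (M : MDP 𝒮 𝒜) (μ π : Policy 𝒮 𝒜) (hH : 0 < H) (t : Fin H) (s : 𝒮)
    (a : 𝒜) {x : ℝ} (hx : 0 < x) :
    M.dataLaw μ H n {D | (∀ i t, (D i).reward t ∈ Set.Icc (0 : ℝ) 1) ∧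
      ¬ M.BackwardBound μ x D t s a
        ((empiricalModel D).valueToGo π (H - (t + 1)) (t + 1))} ≤
      2 * ENNReal.ofReal (Real.exp (-x)) := by
  refine M.dataLaw_backwardBound_le μ hH t s a
    (W := fun D => (empiricalModel D).valueToGo π (H - (t + 1)) (t + 1))
    (fun y => measurable_valueToGo _ _ _ _) (fun D hD y => ?_) (fun D => ?_) hx
  · have hN := empiricalModel_isSubstochastic hD
    exact ⟨hN.valueFunction_nonneg H π _ y, hN.valueFunction_le H π _ y⟩
  · funext y
    exact TabularModel.valueToGo_congr (t := t + 1)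
      (fun u hu => empiricalModel_trans_future D t hu s a)
      (fun u hu => empiricalModel_reward_future D t hu s a) _ _ le_rfl y

/-- The union bound for events with Bernstein tails. -/
lemma measure_iUnion_le_card_mul {α ι : Type*} [MeasurableSpace α] [Fintype ι] (ν : Measure α)
    (B : ι → Set α) {x : ℝ} (h : ∀ i, ν (B i) ≤ 2 * ENNReal.ofReal (Real.exp (-x))) :
    ν (⋃ i, B i) ≤ ENNReal.ofReal (2 * Fintype.card ι * Real.exp (-x)) := by
  calc ν (⋃ i, B i) ≤ ∑ i, ν (B i) := measure_iUnion_fintype_le ν B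
    _ ≤ ∑ _i : ι, 2 * ENNReal.ofReal (Real.exp (-x)) := Finset.sum_le_sum fun i _ => h i
    _ = _ := by
        rw [Finset.sum_const, Finset.card_univ, nsmul_eq_mul, ENNReal.ofReal_mul (by positivity),
          ENNReal.ofReal_mul (by norm_num), ENNReal.ofReal_natCast, ENNReal.ofReal_ofNat]
        ring

lemma dataLaw_not_goodData_le (M : MDP 𝒮 𝒜) (μ π : Policy 𝒮 𝒜) (hH : 0 < H) {x : ℝ} (hx : 0 < x) :
    M.dataLaw μ H n {D | ¬ M.GoodData μ π x D} ≤ ENNReal.ofReal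
      (12 * (H * Fintype.card 𝒮 * Fintype.card 𝒜 * Fintype.card 𝒮) * Real.exp (-x)) := by
  classical
  set R : Set (Fin n → Trajectory 𝒮 𝒜 H) :=
    {D | ∀ i t, (D i).reward t ∈ Set.Icc (0 : ℝ) 1} with hR
  -- one index set for the six kinds of deviation bounds, at the price of some repetition
  set B : Fin H × 𝒮 × 𝒜 × 𝒮 × Fin 6 → Set (Fin n → Trajectory 𝒮 𝒜 H) := fun z =>
    ![{D | 2 * √(n * M.toModel.stateDist μ z.1 z.2.1 * x) + 2 * x <
        |(∑ i, if (D i).state z.1.castSucc = z.2.1 then (1 : ℝ) else 0) -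
          n * M.toModel.stateDist μ z.1 z.2.1|},
      {D | 2 * √(n * M.toModel.occupancy μ z.1 z.2.1 z.2.2.1 * x) + 2 * x <
        |((visits D z.1 z.2.1 z.2.2.1).card : ℝ) -
          n * M.toModel.occupancy μ z.1 z.2.1 z.2.2.1|},
      {D | 2 * √(n * (M.toModel.occupancy μ z.1 z.2.1 z.2.2.1 *
          M.toModel.trans z.1 z.2.1 z.2.2.1 z.2.2.2.1) * x) + 2 * x <
        |∑ i ∈ visits D z.1 z.2.1 z.2.2.1,
          ((if (D i).state z.1.succ = z.2.2.2.1 then 1 else 0) -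
            M.toModel.trans z.1 z.2.1 z.2.2.1 z.2.2.2.1)|},
      {D | 2 * √(n * (M.toModel.occupancy μ z.1 z.2.1 z.2.2.1 * 1) * x) + 2 * x <
        |∑ i ∈ visits D z.1 z.2.1 z.2.2.1,
          ((D i).reward z.1 - M.toModel.reward z.1 z.2.1 z.2.2.1)|},
      {D | D ∈ R ∧ ¬ M.BackwardBound μ x D z.1 z.2.1 z.2.2.1
        ((empiricalModel D).optimalToGo (H - (z.1 + 1)) (z.1 + 1))},
      {D | D ∈ R ∧ ¬ M.BackwardBound μ x D z.1 z.2.1 z.2.2.1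
        ((empiricalModel D).valueToGo π (H - (z.1 + 1)) (z.1 + 1))}] z.2.2.2.2 with hB
  have hBle : ∀ z, M.dataLaw μ H n (B z) ≤ 2 * ENNReal.ofReal (Real.exp (-x)) := by
    rintro ⟨t, s, a, s', j⟩
    fin_cases j
    · exact M.dataLaw_state_le μ t s hx
    · exact M.dataLaw_card_visits_le μ t s a hx
    · have h := M.dataLaw_visits_next_le (n := n) μ t s a (f := fun y => if y = s' then 1 else 0)
        (fun y => by positivity) (fun y => by split_ifs <;> norm_num)
        (w := M.toModel.trans t s a s') (by simp) hx
      simp only [mul_ite, mul_one, mul_zero, Finset.sum_ite_eq', Finset.mem_univ, if_true] at h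
      exact h
    · exact M.dataLaw_visits_reward_le μ t s a hx
    · exact M.dataLaw_backward_optimal_le μ hH t s a hx
    · exact M.dataLaw_backward_policy_le μ π hH t s a hx
  have hsub : {D | ¬ M.GoodData μ π x D} ≤ᵐ[M.dataLaw μ H n] ⋃ z, B z := by
    filter_upwards [M.ae_dataLaw (n := n) μ (M.ae_reward_mem μ H),
      M.ae_dataLaw (n := n) μ (M.ae_init_pos μ H)] with D hr hi hD
    by_contra hcon
    have hnot : ∀ t s a s' j, D ∉ B (t, s, a, s', j) := fun t s a s' j h =>
      hcon (Set.mem_iUnion.2 ⟨_, h⟩)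
    refine hD ⟨hr, hi, fun t s => ?_, fun t s a => not_lt.1 (hnot t s a s 1),
      fun t s a s' => ?_, fun t s a => not_lt.1 (hnot t s a s 3),
      fun t s a => ?_, fun t s a => ?_⟩
    · have : Nonempty 𝒜 := by
        by_contra hne
        rw [not_nonempty_iff] at hne
        have := (μ t s).2.2
        simp at this
      exact not_lt.1 (hnot t s (Classical.arbitrary 𝒜) s 0)
    · exact not_lt.1 (hnot t s a s' 2)
    · exact not_not.1 fun h => hnot t s a s 4 ⟨hr, h⟩
    · exact not_not.1 fun h => hnot t s a s 5 ⟨hr, h⟩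
  refine (measure_mono_ae hsub).trans ((measure_iUnion_le_card_mul _ B hBle).trans_eq ?_)
  congr 1
  simp only [Fintype.card_prod, Fintype.card_fin]
  push_cast
  ring

lemma dataLaw_not_subsetBound_le (M : MDP 𝒮 𝒜) (μ : Policy 𝒮 𝒜) {x : ℝ} (hx : 0 < x) :
    M.dataLaw μ H n {D | ¬ M.SubsetBound μ x D} ≤ ENNReal.ofReal
      (2 * (H * Fintype.card 𝒮 * Fintype.card 𝒜 * 2 ^ Fintype.card 𝒮) * Real.exp (-x)) := by
  classical
  set B : Fin H × 𝒮 × 𝒜 × (𝒮 → Bool) → Set (Fin n → Trajectory 𝒮 𝒜 H) := fun z =>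
    {D | 2 * √(n * (M.toModel.occupancy μ z.1 z.2.1 z.2.2.1 * 1) * x) + 2 * x <
      |∑ i ∈ visits D z.1 z.2.1 z.2.2.1, ((if z.2.2.2 ((D i).state z.1.succ) then 1 else 0) -
        ∑ s', M.toModel.trans z.1 z.2.1 z.2.2.1 s' * if z.2.2.2 s' then 1 else 0)|} with hB
  have hBle : ∀ z, M.dataLaw μ H n (B z) ≤ 2 * ENNReal.ofReal (Real.exp (-x)) := by
    rintro ⟨t, s, a, k⟩
    refine M.dataLaw_visits_next_le (n := n) μ t s a (f := fun y => if k y then 1 else 0)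
        (fun y => by positivity) (fun y => by split_ifs <;> norm_num)
        (sum_mul_le_of_le (M.trans_nonneg t s a) (M.sum_trans t s a).le zero_le_one
          fun y => by split_ifs <;> norm_num) hx
  have hsub : {D | ¬ M.SubsetBound μ x D} ⊆ ⋃ z, B z := by
    intro D hD
    by_contra hcon
    exact hD fun t s a k => not_lt.1 fun h => hcon (Set.mem_iUnion.2 ⟨(t, s, a, k), h⟩)
  refine (measure_mono hsub).trans ((measure_iUnion_le_card_mul _ B hBle).trans_eq ?_)
  congr 1
  simp only [Fintype.card_prod, Fintype.card_fin, Fintype.card_fun, Fintype.card_bool]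
  push_cast
  ring

/-- At the level `x = 6 log (H S A / δ)` all the deviation bounds hold with probability at least
`1 - δ`; the bounds for all the `2 ^ S` sets of next states are affordable only for
`δ < exp (-S)`. -/
lemma dataLaw_bad_le (M : MDP 𝒮 𝒜) (μ π : Policy 𝒮 𝒜) (hH : 0 < H) [Nonempty 𝒮]
    (hA : 2 ≤ Fintype.card 𝒜) {δ : ℝ} (hδ : 0 < δ) (hδ1 : δ < 1) :
    M.dataLaw μ H n {D | ¬ (M.GoodData μ π
        (6 * Real.log (H * Fintype.card 𝒮 * Fintype.card 𝒜 / δ)) D ∧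
      (δ < Real.exp (-(Fintype.card 𝒮 : ℝ)) → M.SubsetBound μ
        (6 * Real.log (H * Fintype.card 𝒮 * Fintype.card 𝒜 / δ)) D))} ≤ ENNReal.ofReal δ := by
  set S := (Fintype.card 𝒮 : ℝ) with hS
  set A := (Fintype.card 𝒜 : ℝ) with hAdef
  have hH1 : (1 : ℝ) ≤ H := by exact_mod_cast hH
  have hS1 : 1 ≤ S := by rw [hS]; exact_mod_cast Fintype.card_pos
  have hA2 : 2 ≤ A := by rw [hAdef]; exact_mod_cast hA
  set K := H * S * A with hK
  have hHS : 1 ≤ H * S := by nlinarith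
  have hK2 : 2 ≤ K := by nlinarith
  have hK0 : 0 < K := by linarith
  set x := 6 * Real.log (K / δ) with hx
  have hx0 : 0 < x := by
    have : 0 < Real.log (K / δ) := Real.log_pos (by rw [lt_div_iff₀ hδ]; linarith)
    positivity
  set q := δ / K with hq
  have hq0 : 0 < q := div_pos hδ hK0
  have hqK : K * q = δ := by rw [hq]; field_simp
  have hq2 : q ≤ δ / 2 := div_le_div_of_nonneg_left hδ.le (by norm_num) hK2
  have hexp : Real.exp (-x) = q ^ 6 := by
    have h1 : -x = ((6 : ℕ) : ℝ) * Real.log q := by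
      rw [hx, hq, ← inv_div, Real.log_inv]
      push_cast
      ring
    rw [h1, Real.exp_nat_mul, Real.exp_log hq0]
  have hδq : q ^ 4 ≤ δ / 16 := by
    calc q ^ 4 ≤ (δ / 2) ^ 4 := pow_le_pow_left₀ hq0.le hq2 4
      _ = δ / 16 * δ ^ 3 := by ring
      _ ≤ δ / 16 * 1 := mul_le_mul_of_nonneg_left (pow_le_one₀ hδ.le hδ1.le) (by positivity)
      _ = δ / 16 := mul_one _
  have hgood : 12 * (H * S * A * S) * Real.exp (-x) ≤ 12 / 16 * δ := by
    have h1 : S ≤ K := by nlinarith [mul_le_mul hH1 hA2 (by norm_num) (by linarith : (0 : ℝ) ≤ H)]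
    rw [hexp]
    calc 12 * (H * S * A * S) * q ^ 6 ≤ 12 * (K * K) * q ^ 6 := by gcongr
      _ = 12 * (K * q) ^ 2 * q ^ 4 := by ring
      _ = 12 * δ ^ 2 * q ^ 4 := by rw [hqK]
      _ ≤ 12 * 1 * (δ / 16) := by
          gcongr
          exact pow_le_one₀ hδ.le hδ1.le
      _ = 12 / 16 * δ := by ring
  have h1 := M.dataLaw_not_goodData_le (n := n) μ π hH hx0
  by_cases hcase : δ < Real.exp (-S)
  · have hsubset : 2 * (H * S * A * 2 ^ Fintype.card 𝒮) * Real.exp (-x) ≤ 4 / 16 * δ := by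
      have h2 : (2 : ℝ) ^ Fintype.card 𝒮 * δ ≤ 1 := by
        have h3 : (2 : ℝ) ^ Fintype.card 𝒮 ≤ Real.exp S := by
          rw [hS, ← mul_one (Fintype.card 𝒮 : ℝ), Real.exp_nat_mul]
          exact pow_le_pow_left₀ (by norm_num) (by linarith [Real.add_one_le_exp (1 : ℝ)]) _
        calc (2 : ℝ) ^ Fintype.card 𝒮 * δ ≤ Real.exp S * Real.exp (-S) :=
              mul_le_mul h3 hcase.le hδ.le (Real.exp_pos S).le
          _ = 1 := by rw [← Real.exp_add, add_neg_cancel, Real.exp_zero]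
      rw [hexp]
      calc 2 * (H * S * A * 2 ^ Fintype.card 𝒮) * q ^ 6 =
            2 * ((2 : ℝ) ^ Fintype.card 𝒮 * (K * q)) * q * q ^ 4 := by rw [hK]; ring
        _ ≤ 2 * 1 * 1 * (δ / 16) := by
            rw [hqK]
            have : q ≤ 1 := by linarith
            gcongr
        _ ≤ 4 / 16 * δ := by linarith
    have h2 := M.dataLaw_not_subsetBound_le (n := n) (H := H) μ hx0
    calc _ ≤ M.dataLaw μ H n ({D | ¬ M.GoodData μ π x D} ∪ {D | ¬ M.SubsetBound μ x D}) := by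
          refine measure_mono fun D hD => ?_
          by_contra hcon
          simp only [Set.mem_union, Set.mem_ofPred_eq, not_or, not_not] at hcon
          exact hD ⟨hcon.1, fun _ => hcon.2⟩
      _ ≤ ENNReal.ofReal (12 / 16 * δ) + ENNReal.ofReal (4 / 16 * δ) :=
          (measure_union_le _ _).trans (add_le_add (h1.trans (ENNReal.ofReal_le_ofReal hgood))
            (h2.trans (ENNReal.ofReal_le_ofReal hsubset)))
      _ = ENNReal.ofReal δ := by
          rw [← ENNReal.ofReal_add (by positivity) (by positivity)]
          congr 1
          ring
  · calc _ ≤ M.dataLaw μ H n {D | ¬ M.GoodData μ π x D} :=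
          measure_mono fun D (hD : ¬ _) hD' => hD ⟨hD', fun h => absurd h hcase⟩
      _ ≤ ENNReal.ofReal δ := h1.trans (ENNReal.ofReal_le_ofReal (by linarith))

end MDP

/-! ### The bounds on the suboptimality -/

/-- Outside the regime in which the row bounds are useful, a bound of the order of
`H * √k * √z` is implied by the trivial bound `H`. -/
lemma le_sqrt_of_regime {Δ H k z e B : ℝ} (hH : 0 ≤ H) (hz : 0 ≤ z) (hB : B ≤ 400)
    (hΔ : Δ ≤ H) (he : 0 ≤ e)
    (h : √(6 * z) * √k ≤ 1 / 25 → Δ ≤ B * (H * √k * √(6 * z)) + e) :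
    Δ ≤ 1000 * √(H ^ 2 * k * z) + e := by
  have h1 : √(H ^ 2 * k * z) = H * √k * √z := by
    rw [Real.sqrt_mul' _ hz, Real.sqrt_mul (sq_nonneg H), Real.sqrt_sq hH]
  have h2 : √(6 * z) ≤ 5 / 2 * √z := by
    rw [Real.sqrt_mul (by norm_num)]
    gcongr
    exact Real.sqrt_le_iff.2 ⟨by norm_num, by norm_num⟩
  have h3 : 0 ≤ H * √k := by positivity
  have h4 := mul_le_mul_of_nonneg_left h2 h3
  rw [h1]
  rcases le_or_gt (√(6 * z) * √k) (1 / 25) with hr | hr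
  · have h5 : B * (H * √k * √(6 * z)) ≤ 400 * (H * √k * √(6 * z)) :=
      mul_le_mul_of_nonneg_right hB (by positivity)
    linarith [h hr]
  · have h5 := mul_le_mul_of_nonneg_left hr.le hH
    linarith

theorem mainTheorem7 :
    ∃ c : ℝ, 0 < c ∧
      ∀ (𝒮 𝒜 Ω : Type*) [Fintype 𝒮] [Fintype 𝒜]
        [MeasurableSpace 𝒮] [DiscreteMeasurableSpace 𝒮]
        [MeasurableSpace 𝒜] [DiscreteMeasurableSpace 𝒜]
        [MeasurableSpace Ω] (P : Measure Ω) [IsProbabilityMeasure P]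
        (M : MDP 𝒮 𝒜) (H n : ℕ) (μ πStar : Policy 𝒮 𝒜) (δ εopt : ℝ)
        (D : Ω → Fin n → Trajectory 𝒮 𝒜 H) (πHatStar πHat : Ω → Policy 𝒮 𝒜)
        (S A L dm : ℝ),
        0 < H → 0 < n → 0 < δ → δ < 1 →
        M.toModel.IsExploratory H μ →
        M.toModel.IsOptimal H πStar →
        -- the data are `n` independent episodes collected with the logging policy `μ`
        iIndepFun (fun (i : Fin n) ω => D ω i) P →
        (∀ i, HasLaw (fun ω => D ω i) (M.trajectoryLaw μ H) P) →
        -- `πHatStar` is the empirically optimal policy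
        (∀ ω, (empiricalModel (D ω)).IsBellmanOptimal H (πHatStar ω)) →
        -- `πHat` is a data-dependent policy with empirical optimization error at most `εopt`
        (∀ᵐ ω ∂P, (empiricalModel (D ω)).value H (πHatStar ω) -
          (empiricalModel (D ω)).value H (πHat ω) ≤ εopt) →
        S = Fintype.card 𝒮 → A = Fintype.card 𝒜 →
        L = Real.log (H * S * A / δ) → dm = M.toModel.minOccupancy H μ →
        -- outside an event of probability at most `δ`, all the bounds hold
        P {ω | ¬ (
            (M.toModel.value H πStar - M.toModel.value H (πHat ω) ≤
              c * √(H ^ 4 * S * L / (dm * n)) + εopt) ∧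
            (δ < Real.exp (-S) →
              M.toModel.value H πStar - M.toModel.value H (πHat ω) ≤
                c * √(H ^ 4 * L / (dm * n)) + εopt) ∧
            (δ < Real.exp (-S) → (πHat ω).IsDeterministic H →
              M.toModel.value H πStar - M.toModel.value H (πHat ω) ≤
                c * √(H ^ 3 * min (H : ℝ) S * L / (dm * n)) + εopt) ∧
            (εopt ≤ √(H : ℝ) / S →
              (∀ t < H, ∀ s, |(empiricalModel (D ω)).valueFunction H (πHat ω) t s -
                (empiricalModel (D ω)).valueFunction H (πHatStar ω) t s| ≤ εopt) →
              M.toModel.value H πStar - M.toModel.value H (πHat ω) ≤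
                c * √(H ^ 3 * L / (dm * n)) + εopt))}
          ≤ ENNReal.ofReal δ := by
  refine ⟨1000, by norm_num, ?_⟩
  intro 𝒮 𝒜 Ω _ _ _ _ _ _ _ P _ M H n μ πStar δ εopt D πHatStar πHat S A L dm hH hn hδ hδ1 hμ
    hstar hind hlaw hopt hε hS hA hL hdm
  have hS' : Nonempty 𝒮 := by
    by_contra hne
    rw [not_nonempty_iff] at hne
    simpa using M.init.2.2
  have hA' : Nonempty 𝒜 := by
    by_contra hne
    rw [not_nonempty_iff] at hne
    simpa using (μ 0 (Classical.arbitrary 𝒮)).2.2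
  have hdm0 : 0 < dm := hdm ▸ M.minOccupancy_pos hH μ
  have hε0 : ∀ ω, (empiricalModel (D ω)).value H (πHatStar ω) -
      (empiricalModel (D ω)).value H (πHat ω) ≤ εopt → 0 ≤ εopt := fun ω hω => by
    have := (hopt ω).value_le (empiricalModel_init_nonneg (D ω)) hH (πHat ω)
    linarith
  rcases Nat.lt_or_ge (Fintype.card 𝒜) 2 with hA1 | hA2
  · -- with a single action there is a single policy
    have hsub : Subsingleton 𝒜 := Fintype.card_le_one_iff_subsingleton.1 (by omega)
    have hπ : ∀ π π' : Policy 𝒮 𝒜, π = π' := fun π π' => by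
      funext t s
      refine Subtype.ext (funext fun a => ?_)
      have h1 := (π t s).2.2
      have h2 := (π' t s).2.2
      rw [Fintype.sum_subsingleton _ a] at h1 h2
      exact h1.trans h2.symm
    refine le_trans (le_of_eq ?_) zero_le
    rw [← ae_iff]
    filter_upwards [hε] with ω hω
    have h0 := hε0 ω hω
    rw [hπ (πHat ω) πStar, sub_self]
    exact ⟨by positivity, fun _ => by positivity, fun _ _ => by positivity,
      fun _ _ => by positivity⟩
  have hmap : P.map D = M.dataLaw μ H n := by
    have h := (iIndepFun_iff_map_fun_eq_pi_map fun i => (hlaw i).aemeasurable).1 hind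
    simp_rw [(hlaw _).map_eq] at h
    exact h
  have hDm : AEMeasurable D P := aemeasurable_pi_lambda _ fun i => (hlaw i).aemeasurable
  set x := 6 * Real.log (H * Fintype.card 𝒮 * Fintype.card 𝒜 / δ) with hx
  have hxL : x = 6 * L := by rw [hx, hL, hS, hA]
  set good : Set (Fin n → Trajectory 𝒮 𝒜 H) := {D | M.GoodData μ πStar x D ∧
    (δ < Real.exp (-(Fintype.card 𝒮 : ℝ)) → M.SubsetBound μ x D)} with hgood
  have hbad : P (D ⁻¹' goodᶜ) ≤ ENNReal.ofReal δ := by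
    refine (Measure.le_map_apply hDm _).trans ?_
    rw [hmap]
    exact M.dataLaw_bad_le μ πStar hH hA2 hδ hδ1
  -- the rest is deterministic, for data in the good event
  refine le_trans (measure_mono_ae ?_) hbad
  filter_upwards [hε] with ω hω hbadω hgoodω
  refine hbadω ?_
  obtain ⟨hD, hSub⟩ : M.GoodData μ πStar x (D ω) ∧
    (δ < Real.exp (-(Fintype.card 𝒮 : ℝ)) → M.SubsetBound μ x (D ω)) := by
      simpa [hgood] using hgoodω
  have he0 := hε0 ω hω
  have hreg : ∀ {B₁ B₂ : ℝ}, |(empiricalModel (D ω)).value H πStar - M.toModel.value H πStar| ≤ B₁ →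
      |(empiricalModel (D ω)).value H (πHat ω) - M.toModel.value H (πHat ω)| ≤ B₂ →
      M.toModel.value H πStar - M.toModel.value H (πHat ω) ≤ B₁ + B₂ + εopt := by
    intro B₁ B₂ h1 h2
    have h3 := (hopt ω).value_le (empiricalModel_init_nonneg (D ω)) hH πStar
    linarith [(abs_le.1 h1).1, (abs_le.1 h2).2]
  have hΔ : M.toModel.value H πStar - M.toModel.value H (πHat ω) ≤ H := by
    linarith [M.value_le H πStar, M.value_nonneg H (πHat ω)]
  have hn' : (0 : ℝ) < n := by exact_mod_cast hn
  have hH1 : (1 : ℝ) ≤ H := by exact_mod_cast hH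
  have hS1 : 1 ≤ S := by rw [hS]; exact_mod_cast Fintype.card_pos
  have hA1 : 1 ≤ A := by rw [hA]; exact_mod_cast Fintype.card_pos
  have hL0 : 0 ≤ L := by
    rw [hL]
    refine Real.log_nonneg ((one_le_div hδ).2 (hδ1.le.trans ?_))
    exact one_le_mul_of_one_le_of_one_le (one_le_mul_of_one_le_of_one_le hH1 hS1) hA1
  set z := L / (dm * n) with hz
  have hz0 : 0 ≤ z := by positivity
  -- the precision of the row bounds: `x = ε ^ 2 * (n * dm)`
  set ε := √(6 * z) with hεdef
  have hε' : 0 ≤ ε := Real.sqrt_nonneg _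
  have hxε : x = ε ^ 2 * (n * M.toModel.minOccupancy H μ) := by
    rw [hεdef, Real.sq_sqrt (by positivity), ← hdm, hxL, hz]
    field_simp
  have hmono : ∀ {k l : ℝ}, k ≤ l →
      1000 * √((H : ℝ) ^ 2 * k * z) + εopt ≤ 1000 * √((H : ℝ) ^ 2 * l * z) + εopt := by
    intro k l hkl
    gcongr
  have hHHS : (H : ℝ) ≤ H * S := le_mul_of_one_le_right (by linarith) hS1
  have hstarε : ∀ {k : ℝ}, (H : ℝ) ≤ k → ε * √k ≤ 1 / 25 →
      |(empiricalModel (D ω)).value H πStar - M.toModel.value H πStar| ≤ 55 * (H * √k * ε) := by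
    intro k hk h
    have hle : √(H : ℝ) ≤ √k := Real.sqrt_le_sqrt hk
    refine (hD.abs_value_sub_le_of_backward hμ hH hn hε'
      ((mul_le_mul_of_nonneg_left hle hε').trans h) hxε).trans ?_
    gcongr
  -- the bound with the factor `H ^ 3 * S`
  have hcard : M.toModel.value H πStar - M.toModel.value H (πHat ω) ≤
      1000 * √((H : ℝ) ^ 2 * (H * S) * z) + εopt := by
    refine le_sqrt_of_regime (B := 80) (Nat.cast_nonneg H) hz0 (by norm_num) hΔ he0 fun h => ?_
    have h2 := hD.abs_value_sub_le_sqrt_card hμ hH hn hε' (hS ▸ h) hxε (πHat ω)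
    rw [← hS] at h2
    linarith [hreg (hstarε hHHS h) h2]
  have hsubset : δ < Real.exp (-S) → M.toModel.value H πStar - M.toModel.value H (πHat ω) ≤
      1000 * √((H : ℝ) ^ 2 * (H ^ 2) * z) + εopt := by
    intro hδS
    refine le_sqrt_of_regime (B := 83) (Nat.cast_nonneg H) hz0 (by norm_num) hΔ he0 fun h => ?_
    have hHH : (H : ℝ) ≤ (H : ℝ) ^ 2 := by nlinarith
    have h1 := hstarε hHH h
    have h2 := hD.abs_value_sub_le_of_subsetBound (hSub (hS ▸ hδS)) hμ hH hn hε'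
      (MDP.le_of_mul_sqrt_le hε' (hH1.trans hHH) h) hxε (πHat ω)
    have e : (H : ℝ) ^ 2 * ε = H * √((H : ℝ) ^ 2) * ε := by
      rw [Real.sqrt_sq (Nat.cast_nonneg H)]
      ring
    rw [e] at h2
    linarith [hreg h1 h2]
  refine ⟨?_, fun hδS => ?_, fun hδS _ => ?_, fun heS hclose => ?_⟩
  · have e : (H : ℝ) ^ 4 * S * L / (dm * n) = (H : ℝ) ^ 2 * (H ^ 2 * S) * z := by rw [hz]; ring
    rw [e]
    exact hcard.trans (hmono (by nlinarith))
  · have e : (H : ℝ) ^ 4 * L / (dm * n) = (H : ℝ) ^ 2 * (H ^ 2) * z := by rw [hz]; ring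
    rw [e]
    exact hsubset hδS
  · have e : (H : ℝ) ^ 3 * min (H : ℝ) S * L / (dm * n) =
        (H : ℝ) ^ 2 * (H * min (H : ℝ) S) * z := by rw [hz]; ring
    rw [e]
    rcases le_total (H : ℝ) S with h | h
    · rw [min_eq_left h, ← sq]
      exact hsubset hδS
    · rw [min_eq_right h]
      exact hcard
  · have e : (H : ℝ) ^ 3 * L / (dm * n) = (H : ℝ) ^ 2 * H * z := by rw [hz]; ring
    rw [e]
    refine le_sqrt_of_regime (B := 182) (Nat.cast_nonneg H) hz0 (by norm_num) hΔ he0 fun h => ?_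
    have h2 := hD.abs_value_sub_le_of_near_optimal hμ hH hn hε' h hxε (π' := πHat ω) he0
      (hS ▸ heS) fun t ht s => by
        rw [← (hopt ω).valueFunction_eq (empiricalModel_trans_nonneg (D ω)) ht.le s]
        exact hclose t ht s
    linarith [hreg (hstarε le_rfl h) h2]
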